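/- For $f:\mathbb R^3\to\mathbb C$ integrable write $\widehat f(\xi)=\int_{\mathbb R^3} e^{-i x\cdot\xi}f(x)\,dx$. Let $\psi\in\mathcal S(\mathbb R^3)$ be complex-valued with $\operatorname{supp}\widehat\psi\subset\{3/5\le|\xi|\le 5/3\}$ and, with $\psi_j(x)=2^{3j}\psi(2^jx)$, $\sum_{j\in\mathbb Z}\widehat{\psi_j}(\xi)=1$ for all $\xi\ne0$; define the homogeneous Besov norm $\|f\|_{\dot B^{s,\infty}_p}=\sup_{j\in\mathbb Z}2^{js}\|\psi_j*f\|_{L^p}$. **Theorem.** Let $3<p<9$ and $\sigma=1-\frac3p$. There is $\eta>0$ such that for every real-valued $u_0\in L^3(\mathbb R^3)$ with $\|u_0\|_{\dot B^{-\sigma,\infty}_p}\le\eta$ there is a global mild solution $u\in C([0,\infty),L^3(\mathbb R^3))\cap Y$ of $\partial_tu-\Delta u=u^3$, $u(0)=u_0$. Here "global mild solution" means that $u(0)=u_0$ and, for every $t>0$, $$u(t)=e^{t\Delta}u_0+\int_0^te^{(t-\tau)\Delta}u(\tau)^3\,d\tau ,$$ where the integral is a Bochner integral in $L^3(\mathbb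 R^3)$ and $e^{t\Delta}f=G_t*f$ with $G_t(x)=(4\pi t)^{-3/2}e^{-|x|^2/(4t)}$. The space $Y$ consists of all bounded $u\in C([0,\infty),L^3(\mathbb R^3))$ such that $t^{\sigma/2}u\in C([0,\infty),L^p(\mathbb R^3))$, such that $t^{\sigma/2}\|u(t)\|_{L^p}\to0$ as $t\to0^+$ and as $t\to\infty$, and such that $$\|u\|_Y=\sup_{t>0}t^{\sigma/2}\|u(t)\|_{L^p}<\infty .$$ -/

import Mathlib

open MeasureTheory Set Filter Topology
open scoped ENNReal FourierTransform

namespace CubicHeat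

noncomputable section

/-- Euclidean three-space. -/
abbrev E3 : Type := EuclideanSpace ℝ (Fin 3)

/-- The space `L³(ℝ³)` of real-valued functions. -/
abbrev L3 : Type := Lp ℝ 3 (volume : Measure E3)

instance factOneLeThree : Fact ((1 : ℝ≥0∞) ≤ 3) := ⟨by norm_num⟩

/-! ### Homogeneous Besov norm -/

/-- The Fourier transform `∫ exp (-i x·ξ) f x dx`
(Mathlib's `𝓕` is `∫ exp (-2π i x·ξ) f x dx`). -/
def fourierHat (f : E3 → ℂ) (ξ : E3) : ℂ :=
  𝓕 f ((2 * Real.pi)⁻¹ • ξ)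

/-- The dilated function `ψ_j x = 2^{3j} ψ (2^j x)`. -/
def dyadic (ψ : E3 → ℂ) (j : ℤ) (x : E3) : ℂ :=
  (((2 : ℝ) ^ (3 * j) : ℝ) : ℂ) * ψ (((2 : ℝ) ^ j) • x)

/-- `ψ` generates a homogeneous Littlewood-Paley decomposition of `ℝ³`: its Fourier transform is
supported in the annulus `3/5 ≤ |ξ| ≤ 5/3`, and the Fourier transforms of the `ψ_j`, `j ∈ ℤ`, sum
to `1` off the origin. -/
structure IsLittlewoodPaley (ψ : SchwartzMap E3 ℂ) : Prop where
  support_subset : tsupport (fourierHat ψ) ⊆ {ξ : E3 | 3 / 5 ≤ ‖ξ‖ ∧ ‖ξ‖ ≤ 5 / 3}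
  hasSum_one : ∀ ξ : E3, ξ ≠ 0 → HasSum (fun j : ℤ => fourierHat (dyadic ψ j) ξ) 1

/-- The dyadic block `ψ_j * f`. -/
def block (ψ : E3 → ℂ) (j : ℤ) (f : E3 → ℝ) (x : E3) : ℂ :=
  ∫ y, dyadic ψ j (x - y) * ((f y : ℝ) : ℂ)

/-- The norm of `f` in the homogeneous Besov space with regularity `s`, integrability `p` and third
index `∞`, namely `sup_j 2^{js} ‖ψ_j * f‖_p`, with value `∞` allowed. -/
def besovNorm (ψ : E3 → ℂ) (s : ℝ) (p : ℝ≥0∞) (f : E3 → ℝ) : ℝ≥0∞ :=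
  ⨆ j : ℤ, ENNReal.ofReal ((2 : ℝ) ^ ((j : ℝ) * s)) * eLpNorm (block ψ j f) p volume

/-! ### Heat semigroup and mild solutions -/

/-- The heat kernel `G_t x = (4πt)^{-3/2} exp (-|x|²/(4t))` of `ℝ³`, for `t > 0`. -/
def heatKernel (t : ℝ) (x : E3) : ℝ :=
  (4 * Real.pi * t) ^ (-(3 / 2) : ℝ) * Real.exp (-‖x‖ ^ 2 / (4 * t))

/-- `e^{tΔ} f = G_t * f`, for `t > 0`. -/
def heat (t : ℝ) (f : E3 → ℝ) (x : E3) : ℝ :=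
  ∫ y, heatKernel t (x - y) * f y

/-- `u : [0, ∞) → L³` is a global mild solution of `∂ₜu - Δu = u³`, `u 0 = u₀`: for every `t > 0`
the function `τ ↦ e^{(t-τ)Δ} (u τ)³` is a Bochner integrable function from `(0, t)` to `L³`, and
`u t = e^{tΔ} u₀ + ∫₀ᵗ e^{(t-τ)Δ} (u τ)³ dτ`. Values of `u` at negative times play no role. -/
structure IsGlobalMildSolution (u₀ : L3) (u : ℝ → L3) : Prop where
  initial : u 0 = u₀
  duhamel : ∀ t : ℝ, 0 < t → ∃ F : ℝ → L3,
    (∀ τ ∈ Ioo (0 : ℝ) t, F τ =ᵐ[volume] heat (t - τ) (fun y => (u τ y) ^ 3)) ∧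
    IntegrableOn F (Ioo (0 : ℝ) t) volume ∧
    u t =ᵐ[volume] fun x => heat t u₀ x + (∫ τ in Ioo (0 : ℝ) t, F τ : L3) x

/-! ### The space `Y` -/

/-- The norm `‖u‖_Y = sup_{t>0} t^{σ/2} ‖u t‖_p`. -/
def weakNorm (p σ : ℝ) (u : ℝ → L3) : ℝ≥0∞ :=
  ⨆ (t : ℝ) (_ : 0 < t), ENNReal.ofReal (t ^ (σ / 2)) * eLpNorm (u t) (ENNReal.ofReal p) volume

/-- The space `Y`: bounded `u ∈ C([0, ∞), L³)` with `t^{σ/2} u ∈ C([0, ∞), L^p)`, with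
`t^{σ/2} ‖u t‖_p` tending to `0` as `t → 0` and as `t → ∞`, and with `‖u‖_Y < ∞`. -/
structure MemY (p σ : ℝ) (u : ℝ → L3) : Prop where
  continuousOn_L3 : ContinuousOn u (Ici 0)
  bounded_L3 : ∃ C : ℝ, ∀ t : ℝ, 0 ≤ t → ‖u t‖ ≤ C
  memLp : ∀ t : ℝ, 0 ≤ t → MemLp (fun x => t ^ (σ / 2) * u t x) (ENNReal.ofReal p) volume
  continuous_Lp : ∀ t₀ : ℝ, 0 ≤ t₀ →
    Tendsto (fun t : ℝ => eLpNorm (fun x => t ^ (σ / 2) * u t x - t₀ ^ (σ / 2) * u t₀ x)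
      (ENNReal.ofReal p) volume) (𝓝[Ici 0] t₀) (𝓝 0)
  tendsto_zero : Tendsto (fun t : ℝ => ENNReal.ofReal (t ^ (σ / 2)) *
    eLpNorm (u t) (ENNReal.ofReal p) volume) (𝓝[>] 0) (𝓝 0)
  tendsto_atTop : Tendsto (fun t : ℝ => ENNReal.ofReal (t ^ (σ / 2)) *
    eLpNorm (u t) (ENNReal.ofReal p) volume) atTop (𝓝 0)
  weakNorm_lt_top : weakNorm p σ u < ∞

end

end CubicHeat

/-! The equation is solved by contraction in the scale-invariant norm `sup t^{σ/2} ‖u(t)‖_p` alone;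
`L³` enters only afterwards. In logarithmic time `s = log t` the unknown `v(s) = e^{sσ/2} u(e^s)` is
sought in `C₀(ℝ, L^p)`: vanishing at both ends of the line is exactly the decay of `t^{σ/2}
‖u(t)‖_p` at `t → 0` and `t → ∞`, and it is built into a complete space.

The cube maps `L^p` to `L^{p/3}`, and `e^{tΔ} : L^{p/3} → L^p` costs `t^{-(1-σ)}`. After the
substitution `τ = tθ` the powers of `t` cancel, and the Duhamel operator is bounded by the beta
integral of `θ^{-3σ/2} (1-θ)^{-(1-σ)}`, finite because `0 < σ < 2/3`, that is, `3 < p < 9`. The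
nonlinearity thus has Lipschitz constant `O(M²)` on the ball of radius `M`, and a fixed point exists
once the linear flow is small (`norm_duhamelPath_sub_le`, `norm_cubePath_sub_le`,
`exists_fixedPoint_of_locally_lipschitz`).

Smallness of the linear flow comes from the Besov norm (`exists_eLpNorm_heat_le`). The flow is
written as `∑ H_j * (ψ_j * u₀)`, where `H_j` is the heat kernel restricted to frequencies near
`2^j`. With `λ = 2^j √t`, the mass of `H_j` is `O(min(1, 1/λ))`, the decay coming from the vanishing
mean of the dyadic kernels, and the sum of `min(1, 1/λ) λ^σ` over `j` is bounded uniformly in `t`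
because `0 < σ < 1`. That the linear flow vanishes at both ends of logarithmic time is a density
argument.

Finally the same Duhamel integral, with the cube of the fixed point as source, is taken with values
in `L³`. The cost `1 - 3σ/2` of `e^{tΔ} : L^{p/3} → L³` and the singularity `τ^{-3σ/2}` add up to
`1`, so the result is a bounded continuous path in `L³` tending to `0` as `t → 0`, with no smallness
required in `L³`. The integrals in `L³` and in `L^p` agree almost everywhere (`integral_Lp_ae_eq`),
so the path obtained is the mild solution. -/

open scoped ZeroAtInfty

namespace CubicHeat

/-! ### Young's inequality for nonnegative kernels -/

/-- The convolution of two nonnegative functions. -/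
noncomputable def lconv (k f : E3 → ℝ≥0∞) (x : E3) : ℝ≥0∞ := ∫⁻ y, k (x - y) * f y

theorem measurable_lconv {k f : E3 → ℝ≥0∞} (hk : Measurable k) (hf : Measurable f) :
    Measurable (lconv k f) := by
  unfold lconv
  exact Measurable.lintegral_prod_right (f := fun x y : E3 => k (x - y) * f y)
    (by unfold Function.uncurry; fun_prop)

theorem lintegral_lconv {k f : E3 → ℝ≥0∞} (hk : Measurable k) (hf : Measurable f) :
    ∫⁻ x, lconv k f x = (∫⁻ x, k x) * ∫⁻ x, f x := by
  unfold lconv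
  rw [lintegral_lintegral_swap (by fun_prop)]
  have : ∀ y, ∫⁻ x, k (x - y) * f y = (∫⁻ x, k x) * f y := by
    intro y
    rw [lintegral_mul_const _ (by fun_prop), lintegral_sub_right_eq_self]
  simp_rw [this]
  rw [lintegral_const_mul _ hf]

theorem lconv_comm (k f : E3 → ℝ≥0∞) (x : E3) : lconv k f x = lconv f k x := by
  unfold lconv
  rw [← lintegral_sub_left_eq_self _ x]
  simp [mul_comm]

theorem lconv_le_of_le {k f : E3 → ℝ≥0∞} (hf : Measurable f) {B : ℝ≥0∞} (hB : ∀ x, k x ≤ B)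
    (x : E3) : lconv k f x ≤ B * ∫⁻ y, f y := by
  rw [← lintegral_const_mul _ hf]
  exact lintegral_mono fun _ => mul_le_mul' (hB _) le_rfl

/-- Hölder for the splitting `k = k^{1/q'} k^{1/q}`, i.e. Jensen for the measure with density `k (x
- ·)`. -/
theorem lconv_rpow_le {k f : E3 → ℝ≥0∞} (hk : Measurable k) (hf : Measurable f) {q : ℝ}
    (hq : 1 ≤ q) (x : E3) :
    lconv k f x ^ q ≤ (∫⁻ y, k y) ^ (q - 1) * lconv k (fun y => f y ^ q) x := by
  rcases hq.eq_or_lt with rfl | hq1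
  · simp
  have hq0 : 0 < q := by linarith
  have hc := Real.HolderConjugate.conjExponent hq1
  set q' := q.conjExponent with hq'
  have key := ENNReal.lintegral_mul_le_Lp_mul_Lq (volume : Measure E3) hc.symm
    (f := fun y => k (x - y) ^ (1 / q')) (g := fun y => k (x - y) ^ (1 / q) * f y)
    (by fun_prop) (by fun_prop)
  have h0 : 0 < q' := hc.symm.pos
  have e1 : ∀ y, ((fun y => k (x - y) ^ (1 / q')) * fun y => k (x - y) ^ (1 / q) * f y) y
      = k (x - y) * f y := by
    intro y
    simp only [Pi.mul_apply]
    rw [← mul_assoc, ← ENNReal.rpow_add_of_nonneg _ _ (by positivity) (by positivity)]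
    have : 1 / q' + 1 / q = 1 := by simpa [one_div] using hc.symm.inv_add_inv_eq_one
    rw [this, ENNReal.rpow_one]
  have e2 : ∀ y, (k (x - y) ^ (1 / q')) ^ q' = k (x - y) := by
    intro y
    rw [← ENNReal.rpow_mul, one_div_mul_cancel h0.ne', ENNReal.rpow_one]
  have e3 : ∀ y, (k (x - y) ^ (1 / q) * f y) ^ q = k (x - y) * f y ^ q := by
    intro y
    rw [ENNReal.mul_rpow_of_nonneg _ _ hq0.le, ← ENNReal.rpow_mul,
      one_div_mul_cancel hq0.ne', ENNReal.rpow_one]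
  simp_rw [e1, e2, e3] at key
  rw [lintegral_sub_left_eq_self] at key
  calc lconv k f x ^ q ≤ ((∫⁻ y, k y) ^ (1 / q') * (lconv k (fun y => f y ^ q) x) ^ (1 / q)) ^ q :=
        ENNReal.rpow_le_rpow key hq0.le
    _ = _ := by
        rw [ENNReal.mul_rpow_of_nonneg _ _ hq0.le, ← ENNReal.rpow_mul, ← ENNReal.rpow_mul,
          one_div_mul_cancel hq0.ne', ENNReal.rpow_one]
        congr 2
        have := hc.sub_one_mul_conj
        field_simp
        linarith

theorem lconv_le_Lq {k f : E3 → ℝ≥0∞} (hk : Measurable k) (hf : Measurable f) {q : ℝ}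
    (hq : 1 ≤ q) {B : ℝ≥0∞} (hB : ∀ x, k x ≤ B) (x : E3) :
    lconv k f x ≤ (∫⁻ y, k y) ^ (1 - 1 / q) * B ^ (1 / q) * (∫⁻ y, f y ^ q) ^ (1 / q) := by
  have hq0 : 0 < q := by linarith
  have h := (lconv_rpow_le hk hf hq x).trans
    (mul_le_mul' le_rfl (lconv_le_of_le (hf.pow_const q) hB x))
  have h2 := ENNReal.rpow_le_rpow h (one_div_nonneg.2 hq0.le)
  rw [← ENNReal.rpow_mul, mul_one_div_cancel hq0.ne', ENNReal.rpow_one] at h2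
  refine h2.trans_eq ?_
  rw [ENNReal.mul_rpow_of_nonneg _ _ (by positivity), ENNReal.mul_rpow_of_nonneg _ _ (by positivity),
    ← ENNReal.rpow_mul, ← mul_assoc]
  congr 3
  field_simp

/-- Young's inequality for a kernel that is integrable and bounded. -/
theorem lintegral_lconv_rpow_le {k f : E3 → ℝ≥0∞} (hk : Measurable k) (hf : Measurable f)
    {q r : ℝ} (hq : 1 ≤ q) (hqr : q ≤ r) {B : ℝ≥0∞} (hB : ∀ x, k x ≤ B) :
    (∫⁻ x, lconv k f x ^ r) ^ (1 / r) ≤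
      (∫⁻ y, k y) ^ (1 - (1 / q - 1 / r)) * B ^ (1 / q - 1 / r) * (∫⁻ y, f y ^ q) ^ (1 / q) := by
  have hq0 : 0 < q := by linarith
  have hr0 : 0 < r := by linarith
  set A := ∫⁻ y, k y
  set N := (∫⁻ y, f y ^ q) ^ (1 / q) with hN
  have hNq : ∫⁻ y, f y ^ q = N ^ q := by
    rw [hN, ← ENNReal.rpow_mul, one_div_mul_cancel hq0.ne', ENNReal.rpow_one]
  have hd : 0 ≤ 1 / q - 1 / r := sub_nonneg.2 (one_div_le_one_div_of_le hq0 hqr)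
  have hq1 : 1 / q ≤ 1 := by rw [div_le_one hq0]; exact hq
  have h1r : 0 ≤ 1 / r := by positivity
  -- Interpolation: of the `r` powers, `r - q` are bounded by the supremum and the remaining `q` are
  -- kept for integration.
  have hpt : ∀ x, lconv k f x ^ r ≤
      (A ^ (1 - 1 / q) * B ^ (1 / q) * N) ^ (r - q) * (A ^ (q - 1) * lconv k (fun y => f y ^ q) x) := by
    intro x
    have : lconv k f x ^ r = lconv k f x ^ (r - q) * lconv k f x ^ q := by
      rw [← ENNReal.rpow_add_of_nonneg _ _ (by linarith) hq0.le]; simp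
    rw [this]
    exact mul_le_mul' (ENNReal.rpow_le_rpow (lconv_le_Lq hk hf hq hB x) (by linarith))
      (lconv_rpow_le hk hf hq x)
  have hint : ∫⁻ x, lconv k f x ^ r ≤
      (A ^ (1 - 1 / q) * B ^ (1 / q) * N) ^ (r - q) * (A ^ (q - 1) * (A * N ^ q)) := by
    refine (lintegral_mono hpt).trans_eq ?_
    rw [lintegral_const_mul _ ((measurable_lconv hk (hf.pow_const q)).const_mul _),
      lintegral_const_mul _ (measurable_lconv hk (hf.pow_const q)),
      lintegral_lconv hk (hf.pow_const q), hNq]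
  refine (ENNReal.rpow_le_rpow hint h1r).trans_eq ?_
  have e0 : A ^ (q - 1) * (A * N ^ q) = A ^ q * N ^ q := by
    rw [← mul_assoc]
    congr 1
    nth_rewrite 2 [← ENNReal.rpow_one A]
    rw [← ENNReal.rpow_add_of_nonneg _ _ (by linarith) zero_le_one]; simp
  have hrq : 0 ≤ r - q := by linarith
  rw [e0]
  simp only [ENNReal.mul_rpow_of_nonneg _ _ hrq, ENNReal.mul_rpow_of_nonneg _ _ h1r,
    ← ENNReal.rpow_mul]
  have a1 : A ^ (1 - (1 / q - 1 / r)) = A ^ ((1 - 1 / q) * (r - q) * (1 / r)) * A ^ (q * (1 / r)) := by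
    rw [← ENNReal.rpow_add_of_nonneg _ _ (by have := sub_nonneg.2 hq1; positivity) (by positivity)]
    congr 1
    field_simp
    ring
  have a2 : B ^ (1 / q - 1 / r) = B ^ (1 / q * (r - q) * (1 / r)) := by
    congr 1
    field_simp
  have a3 : N = N ^ ((r - q) * (1 / r)) * N ^ (q * (1 / r)) := by
    rw [← ENNReal.rpow_add_of_nonneg _ _ (by positivity) (by positivity)]
    have : (r - q) * (1 / r) + q * (1 / r) = 1 := by field_simp; ring
    rw [this, ENNReal.rpow_one]
  rw [a1, a2]
  conv_rhs => rw [a3]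
  ring

theorem eLpNorm_le_of_enorm_le_lconv {F G : Type*} [NormedAddCommGroup F] [NormedAddCommGroup G]
    {k : E3 → ℝ≥0∞} (hk : Measurable k) {f : E3 → F} (hf : StronglyMeasurable f) {h : E3 → G}
    (hh : ∀ x, ‖h x‖ₑ ≤ lconv k (fun y => ‖f y‖ₑ) x) {q r : ℝ≥0∞} (hq : 1 ≤ q) (hqr : q ≤ r)
    (hr : r ≠ ∞) {B : ℝ≥0∞} (hB : ∀ x, k x ≤ B) :
    eLpNorm h r volume ≤ (∫⁻ y, k y) ^ (1 - (1 / q.toReal - 1 / r.toReal)) *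
      B ^ (1 / q.toReal - 1 / r.toReal) * eLpNorm f q volume := by
  have hq' : q ≠ ∞ := ne_top_of_le_ne_top hr hqr
  have hq0 : q ≠ 0 := (zero_lt_one.trans_le hq).ne'
  have hr0 : r ≠ 0 := (zero_lt_one.trans_le (hq.trans hqr)).ne'
  rw [eLpNorm_eq_lintegral_rpow_enorm_toReal hr0 hr, eLpNorm_eq_lintegral_rpow_enorm_toReal hq0 hq']
  refine le_trans ?_ (lintegral_lconv_rpow_le hk hf.enorm ?_ ?_ hB)
  · gcongr with x
    exact hh x
  · rw [← ENNReal.toReal_one]; exact ENNReal.toReal_mono hq' hq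
  · exact ENNReal.toReal_mono hr hqr

/-! ### The heat kernel -/

theorem heatKernel_nonneg {t : ℝ} (ht : 0 < t) (x : E3) : 0 ≤ heatKernel t x := by
  unfold heatKernel; positivity

theorem continuous_heatKernel (t : ℝ) : Continuous (heatKernel t) := by
  unfold heatKernel; fun_prop

theorem heatKernel_le {t : ℝ} (ht : 0 < t) (x : E3) :
    heatKernel t x ≤ (4 * Real.pi * t) ^ (-(3 / 2) : ℝ) := by
  unfold heatKernel
  refine mul_le_of_le_one_right (by positivity) (Real.exp_le_one_iff.2 ?_)
  rw [neg_div]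
  exact neg_nonpos.2 (by positivity)

theorem heatKernel_eq (t : ℝ) (x : E3) :
    heatKernel t x = (4 * Real.pi * t) ^ (-(3 / 2) : ℝ) * Real.exp (-(1 / (4 * t)) * ‖x‖ ^ 2) := by
  unfold heatKernel
  congr 2
  ring

theorem integral_heatKernel {t : ℝ} (ht : 0 < t) : ∫ x, heatKernel t x = 1 := by
  simp_rw [heatKernel_eq]
  rw [integral_const_mul, GaussianFourier.integral_rexp_neg_mul_sq_norm (by positivity)]
  have : Real.pi / (1 / (4 * t)) = 4 * Real.pi * t := by field_simp
  rw [this, ← Real.rpow_add (by positivity)]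
  norm_num

theorem integrable_heatKernel {t : ℝ} (ht : 0 < t) : Integrable (heatKernel t) := by
  -- A non-integrable function has integral `0` by convention, which contradicts the value `1`.
  by_contra h
  have := integral_heatKernel ht
  rw [integral_undef h] at this
  norm_num at this

theorem enorm_heatKernel {t : ℝ} (ht : 0 < t) (x : E3) :
    ‖heatKernel t x‖ₑ = ENNReal.ofReal (heatKernel t x) :=
  Real.enorm_of_nonneg (heatKernel_nonneg ht x)

theorem lintegral_enorm_heatKernel {t : ℝ} (ht : 0 < t) : ∫⁻ x, ‖heatKernel t x‖ₑ = 1 := by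
  simp_rw [enorm_heatKernel ht]
  rw [← ofReal_integral_eq_lintegral_ofReal (integrable_heatKernel ht)
    (ae_of_all _ (heatKernel_nonneg ht)), integral_heatKernel ht, ENNReal.ofReal_one]

theorem enorm_heatKernel_le {t : ℝ} (ht : 0 < t) (x : E3) :
    ‖heatKernel t x‖ₑ ≤ ENNReal.ofReal ((4 * Real.pi * t) ^ (-(3 / 2) : ℝ)) := by
  rw [enorm_heatKernel ht]
  exact ENNReal.ofReal_le_ofReal (heatKernel_le ht x)

theorem measurable_enorm_heatKernel (t : ℝ) : Measurable fun x => ‖heatKernel t x‖ₑ :=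
  (continuous_heatKernel t).measurable.enorm

theorem continuousAt_heatKernel {t : ℝ} (ht : 0 < t) (x : E3) :
    ContinuousAt (fun s => heatKernel s x) t := by
  unfold heatKernel
  refine ContinuousAt.mul (ContinuousAt.rpow_const (by fun_prop) (Or.inl (by positivity))) ?_
  refine Real.continuous_exp.continuousAt.comp ?_
  exact ContinuousAt.div (by fun_prop) (by fun_prop) (by positivity)

/-- A single integrable majorant for all times near `t`. The factor `8 = 4^{3/2}` compares the
heights at times `t/2` and `2t`. -/
theorem heatKernel_le_mul_heatKernel {s t : ℝ} (ht : 0 < t) (h1 : t / 2 ≤ s) (h2 : s ≤ 2 * t)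
    (x : E3) : heatKernel s x ≤ 8 * heatKernel (2 * t) x := by
  unfold heatKernel
  have hs : 0 < s := by linarith
  have e1 : (4 * Real.pi * s) ^ (-(3 / 2) : ℝ) ≤ (4 * Real.pi * (2 * t) / 4) ^ (-(3 / 2) : ℝ) := by
    apply Real.rpow_le_rpow_of_nonpos (by positivity) _ (by norm_num)
    have := Real.pi_pos
    nlinarith
  have e2 : (4 * Real.pi * (2 * t) / 4) ^ (-(3 / 2) : ℝ)
      = 8 * (4 * Real.pi * (2 * t)) ^ (-(3 / 2) : ℝ) := by
    rw [Real.div_rpow (by positivity) (by norm_num)]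
    have : (4 : ℝ) ^ (-(3 / 2) : ℝ) = 1 / 8 := by
      rw [show (4 : ℝ) = 2 ^ (2 : ℝ) by norm_num, ← Real.rpow_mul (by norm_num)]
      norm_num
    rw [this]; ring
  have e3 : Real.exp (-‖x‖ ^ 2 / (4 * s)) ≤ Real.exp (-‖x‖ ^ 2 / (4 * (2 * t))) := by
    apply Real.exp_le_exp.2
    rw [neg_div, neg_div]
    apply neg_le_neg
    gcongr
  calc _ ≤ (8 * (4 * Real.pi * (2 * t)) ^ (-(3 / 2) : ℝ)) *
        Real.exp (-‖x‖ ^ 2 / (4 * (2 * t))) := by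
        rw [← e2]; gcongr
    _ = _ := by ring

theorem tendsto_lintegral_heatKernel_sub {t : ℝ} (ht : 0 < t) :
    Tendsto (fun s => ∫⁻ x, ‖heatKernel s x - heatKernel t x‖ₑ) (𝓝 t) (𝓝 0) := by
  have h2t : 0 < 2 * t := by positivity
  have : (0 : ℝ≥0∞) = ∫⁻ _ : E3, 0 := by simp
  rw [this]
  have hev : ∀ᶠ s in 𝓝 t, s ∈ Icc (t / 2) (2 * t) :=
    Icc_mem_nhds (by linarith) (by linarith)
  refine tendsto_lintegral_filter_of_dominated_convergence
    (fun x => ENNReal.ofReal (16 * heatKernel (2 * t) x)) ?_ ?_ ?_ ?_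
  · exact .of_forall fun s => ((continuous_heatKernel s).sub (continuous_heatKernel t)).measurable.enorm
  · filter_upwards [hev] with s hs
    refine ae_of_all _ fun x => ?_
    rw [← ofReal_norm]
    apply ENNReal.ofReal_le_ofReal
    have a := heatKernel_le_mul_heatKernel ht hs.1 hs.2 x
    have b := heatKernel_le_mul_heatKernel ht (by linarith) (by linarith) x (s := t)
    have hs0 : 0 < s := by linarith [hs.1]
    have c := heatKernel_nonneg hs0 x
    have d := heatKernel_nonneg ht x
    rw [Real.norm_eq_abs, abs_le]
    constructor <;> linarith
  · exact ((integrable_heatKernel h2t).const_mul 16).lintegral_lt_top.ne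
  · refine ae_of_all _ fun x => ?_
    have := (continuousAt_heatKernel ht x).tendsto.sub_const (heatKernel t x)
    rw [sub_self] at this
    simpa using this.enorm

/-- Half of the Gaussian exponent absorbs the factor `‖x‖` at the cost of `2√t`; the change of
normalisation to time `2t` costs `2^{3/2} ≤ 3`. -/
theorem norm_mul_heatKernel_le {t : ℝ} (ht : 0 < t) (x : E3) :
    ‖x‖ * heatKernel t x ≤ 6 * √t * heatKernel (2 * t) x := by
  unfold heatKernel
  have hst : 0 < √t := Real.sqrt_pos.2 ht
  have hsq : √t ^ 2 = t := Real.sq_sqrt ht.le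
  have e1 : ‖x‖ * Real.exp (-‖x‖ ^ 2 / (4 * t)) ≤ 2 * √t * Real.exp (-‖x‖ ^ 2 / (4 * (2 * t))) := by
    have : Real.exp (-‖x‖ ^ 2 / (4 * t)) =
        Real.exp (-‖x‖ ^ 2 / (4 * (2 * t))) * Real.exp (-(‖x‖ ^ 2 / (8 * t))) := by
      rw [← Real.exp_add]; congr 1; field_simp; ring
    rw [this]
    have h1 : ‖x‖ * Real.exp (-(‖x‖ ^ 2 / (8 * t))) ≤ 2 * √t := by
      rw [Real.exp_neg, ← div_eq_mul_inv, div_le_iff₀ (Real.exp_pos _)]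
      have h2 := Real.add_one_le_exp (‖x‖ ^ 2 / (8 * t))
      have h3 : ‖x‖ ≤ 2 * √t * (‖x‖ ^ 2 / (8 * t) + 1) := by
        have : 2 * √t * (‖x‖ ^ 2 / (8 * t) + 1) - ‖x‖ = ((‖x‖ - 2 * √t) ^ 2 + 4 * t) / (4 * √t) := by
          generalize √t = s at hst hsq
          subst hsq
          field_simp
          ring
        have h4 : 0 ≤ ((‖x‖ - 2 * √t) ^ 2 + 4 * t) / (4 * √t) := by positivity
        linarith
      exact h3.trans (by gcongr)
    calc _ = Real.exp (-‖x‖ ^ 2 / (4 * (2 * t))) * (‖x‖ * Real.exp (-(‖x‖ ^ 2 / (8 * t)))) := by ring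
      _ ≤ Real.exp (-‖x‖ ^ 2 / (4 * (2 * t))) * (2 * √t) := by gcongr
      _ = _ := by ring
  have e2 : (4 * Real.pi * t) ^ (-(3 / 2) : ℝ) ≤ 3 * (4 * Real.pi * (2 * t)) ^ (-(3 / 2) : ℝ) := by
    have h0 : (4 * Real.pi * (2 * t)) = 2 * (4 * Real.pi * t) := by ring
    rw [h0, Real.mul_rpow zero_le_two (show (0 : ℝ) ≤ 4 * Real.pi * t by positivity), ← mul_assoc]
    refine le_mul_of_one_le_left (by positivity) ?_
    rw [Real.rpow_neg zero_le_two, ← div_eq_mul_inv, le_div_iff₀ (by positivity), one_mul,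
      show (3 / 2 : ℝ) = 1 + 1 / 2 by norm_num, Real.rpow_add two_pos, Real.rpow_one,
      ← Real.sqrt_eq_rpow]
    nlinarith [Real.sqrt_nonneg 2, Real.sq_sqrt (show (0:ℝ) ≤ 2 by norm_num)]
  calc _ = (4 * Real.pi * t) ^ (-(3 / 2) : ℝ) * (‖x‖ * Real.exp (-‖x‖ ^ 2 / (4 * t))) := by ring
    _ ≤ (3 * (4 * Real.pi * (2 * t)) ^ (-(3 / 2) : ℝ)) *
        (2 * √t * Real.exp (-‖x‖ ^ 2 / (4 * (2 * t)))) := by gcongr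
    _ = _ := by ring

theorem abs_exp_neg_sub_exp_neg_le (a b : ℝ) :
    |Real.exp (-a) - Real.exp (-b)| ≤ |a - b| * (Real.exp (-a) + Real.exp (-b)) := by
  wlog h : a ≤ b generalizing a b
  · rw [abs_sub_comm, abs_sub_comm a, add_comm]; exact this b a (by linarith)
  have h1 : Real.exp (-b) ≤ Real.exp (-a) := Real.exp_le_exp.2 (by linarith)
  rw [abs_of_nonneg (by linarith), abs_of_nonpos (by linarith)]
  have h2 : Real.exp (-b) = Real.exp (-a) * Real.exp (a - b) := by rw [← Real.exp_add]; ring_nf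
  have h3 := Real.add_one_le_exp (a - b)
  have h4 := Real.exp_pos (-a)
  have h5 := Real.exp_pos (-b)
  nlinarith

/-- The cross terms are removed by the triangle inequality, so that each kernel is weighted by the
norm of its own argument and the bound integrates by translation invariance. -/
theorem abs_heatKernel_sub_le {t : ℝ} (ht : 0 < t) (x y : E3) :
    |heatKernel t (x - y) - heatKernel t x| ≤ ‖y‖ / (4 * t) *
      ((2 * ‖x - y‖ + ‖y‖) * heatKernel t (x - y) + (2 * ‖x‖ + ‖y‖) * heatKernel t x) := by
  have hc : 0 < (4 * Real.pi * t) ^ (-(3 / 2) : ℝ) := by positivity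
  have h := abs_exp_neg_sub_exp_neg_le (‖x - y‖ ^ 2 / (4 * t)) (‖x‖ ^ 2 / (4 * t))
  have n1 : |‖x - y‖ - ‖x‖| ≤ ‖y‖ := by simpa using abs_norm_sub_norm_le (x - y) x
  have n2 : |‖x - y‖ ^ 2 / (4 * t) - ‖x‖ ^ 2 / (4 * t)| ≤ ‖y‖ / (4 * t) * (‖x - y‖ + ‖x‖) := by
    have : ‖x - y‖ ^ 2 / (4 * t) - ‖x‖ ^ 2 / (4 * t) =
        (‖x - y‖ - ‖x‖) * ((‖x - y‖ + ‖x‖) / (4 * t)) := by ring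
    rw [this, abs_mul, abs_of_nonneg (a := (‖x - y‖ + ‖x‖) / (4 * t)) (by positivity)]
    calc _ ≤ ‖y‖ * ((‖x - y‖ + ‖x‖) / (4 * t)) := by gcongr
      _ = _ := by ring
  obtain ⟨n3, n4⟩ := abs_le.1 n1
  unfold heatKernel
  rw [← mul_sub, abs_mul, abs_of_pos hc, neg_div, neg_div]
  have p1 := Real.exp_pos (-(‖x - y‖ ^ 2 / (4 * t)))
  have p2 := Real.exp_pos (-(‖x‖ ^ 2 / (4 * t)))
  set A := Real.exp (-(‖x - y‖ ^ 2 / (4 * t)))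
  set B := Real.exp (-(‖x‖ ^ 2 / (4 * t)))
  have h' : |A - B| ≤ ‖y‖ / (4 * t) * (‖x - y‖ + ‖x‖) * (A + B) := h.trans (by gcongr)
  have h'' : (‖x - y‖ + ‖x‖) * (A + B) ≤ (2 * ‖x - y‖ + ‖y‖) * A + (2 * ‖x‖ + ‖y‖) * B := by
    nlinarith
  calc _ ≤ (4 * Real.pi * t) ^ (-(3 / 2) : ℝ) *
        (‖y‖ / (4 * t) * ((2 * ‖x - y‖ + ‖y‖) * A + (2 * ‖x‖ + ‖y‖) * B)) := by
        gcongr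
        refine h'.trans ?_
        rw [mul_assoc]
        gcongr
    _ = _ := by ring

/-- This `L¹` modulus of continuity is what the vanishing mean of the dyadic kernels turns into
decay at high frequency. The quadratic term is harmless, as a Schwartz function has finite second
moment. -/
theorem lintegral_heatKernel_translate_sub_le {t : ℝ} (ht : 0 < t) (y : E3) :
    ∫⁻ x, ‖heatKernel t (x - y) - heatKernel t x‖ₑ ≤
      ENNReal.ofReal (6 * (‖y‖ / √t) * (1 + ‖y‖ / √t)) := by
  have h2t : 0 < 2 * t := by positivity
  have hst : 0 < √t := Real.sqrt_pos.2 ht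
  have hsq : √t ^ 2 = t := Real.sq_sqrt ht.le
  set g : E3 → ℝ := fun x => 12 * √t * heatKernel (2 * t) x + ‖y‖ * heatKernel t x with hg
  have hgi : Integrable g :=
    ((integrable_heatKernel h2t).const_mul _).add ((integrable_heatKernel ht).const_mul _)
  have hgint : ∫ x, g x = 12 * √t + ‖y‖ := by
    rw [hg, integral_add ((integrable_heatKernel h2t).const_mul _)
      ((integrable_heatKernel ht).const_mul _), integral_const_mul, integral_const_mul,
      integral_heatKernel h2t, integral_heatKernel ht]
    ring
  have hgb : ∀ x, (2 * ‖x‖ + ‖y‖) * heatKernel t x ≤ g x := by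
    intro x
    have := norm_mul_heatKernel_le ht x
    simp only [hg]
    linarith
  have hpt : ∀ x, ‖heatKernel t (x - y) - heatKernel t x‖ₑ ≤
      ENNReal.ofReal (‖y‖ / (4 * t) * (g (x - y) + g x)) := by
    intro x
    rw [← ofReal_norm]
    apply ENNReal.ofReal_le_ofReal
    refine (abs_heatKernel_sub_le ht x y).trans ?_
    gcongr
    · exact hgb _
    · exact hgb _
  refine (lintegral_mono hpt).trans ?_
  have hgn : ∀ x, 0 ≤ g x := fun x => by
    have a := heatKernel_nonneg ht x
    have b := heatKernel_nonneg h2t x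
    simp only [hg]; positivity
  rw [← ofReal_integral_eq_lintegral_ofReal]
  · apply ENNReal.ofReal_le_ofReal
    rw [integral_const_mul, integral_add (hgi.comp_sub_right y) hgi,
      integral_sub_right_eq_self g y, hgint]
    have : ‖y‖ / (4 * t) * (12 * √t + ‖y‖ + (12 * √t + ‖y‖))
      = ‖y‖ / √t * (6 + (1/2) * (‖y‖ / √t)) := by
      rw [← hsq, Real.sqrt_sq hst.le]; field_simp; ring
    rw [this]
    have : 0 ≤ ‖y‖ / √t := by positivity
    nlinarith
  · exact ((hgi.comp_sub_right y).add hgi).const_mul _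
  · refine ae_of_all _ fun x => ?_
    have := hgn x
    have := hgn (x - y)
    simp only [Pi.zero_apply]
    positivity

/-! ### Convolution operators on `L^q` -/

section Conv

variable {𝕜 : Type*} [RCLike 𝕜]

/-- The convolution of two functions on `ℝ³`. -/
noncomputable def conv (K f : E3 → 𝕜) (x : E3) : 𝕜 := ∫ y, K (x - y) * f y

/-- A kernel is admissible if it is integrable and bounded. -/
structure IsAdmissible (K : E3 → 𝕜) : Prop where
  measurable : Measurable K
  lintegral_ne_top : ∫⁻ x, ‖K x‖ₑ ≠ ∞
  bounded : ∃ B : ℝ≥0∞, B ≠ ∞ ∧ ∀ x, ‖K x‖ₑ ≤ B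

theorem enorm_conv_le (K f : E3 → 𝕜) (x : E3) :
    ‖conv K f x‖ₑ ≤ lconv (fun y => ‖K y‖ₑ) (fun y => ‖f y‖ₑ) x := by
  refine (enorm_integral_le_lintegral_enorm _).trans_eq ?_
  simp [lconv, enorm_mul]

theorem stronglyMeasurable_conv {K f : E3 → 𝕜} (hK : Measurable K) (hf : StronglyMeasurable f) :
    StronglyMeasurable (conv K f) := by
  have : StronglyMeasurable (Function.uncurry fun x y : E3 => K (x - y) * f y) := by
    apply Measurable.stronglyMeasurable
    have := hf.measurable
    unfold Function.uncurry
    fun_prop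
  exact this.integral_prod_right

theorem conv_congr_ae (K : E3 → 𝕜) {f g : E3 → 𝕜} (h : f =ᵐ[volume] g) : conv K f = conv K g := by
  ext x
  apply integral_congr_ae
  filter_upwards [h] with y hy
  rw [hy]

theorem IsAdmissible.lconv_lt_top {K f : E3 → 𝕜} (hK : IsAdmissible K)
    (hf : StronglyMeasurable f) {q : ℝ≥0∞} (hq : 1 ≤ q) (hq' : q ≠ ∞) (hfq : MemLp f q volume)
    (x : E3) : lconv (fun y => ‖K y‖ₑ) (fun y => ‖f y‖ₑ) x < ∞ := by
  obtain ⟨B, hB, hKB⟩ := hK.bounded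
  have hq1 : 1 ≤ q.toReal := by
    rw [← ENNReal.toReal_one]; exact ENNReal.toReal_mono hq' hq
  have hqr : 1 / q.toReal ≤ 1 := by rw [div_le_one (by linarith)]; exact hq1
  refine (lconv_le_Lq hK.measurable.enorm hf.enorm hq1 hKB x).trans_lt ?_
  refine ENNReal.mul_lt_top (ENNReal.mul_lt_top ?_ ?_) ?_
  · exact ENNReal.rpow_lt_top_of_nonneg (by linarith) hK.lintegral_ne_top
  · exact ENNReal.rpow_lt_top_of_nonneg (by positivity) hB
  · rw [← eLpNorm_eq_lintegral_rpow_enorm_toReal (zero_lt_one.trans_le hq).ne' hq']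
    exact hfq.2

theorem integrable_conv_of_lconv_lt_top {K f : E3 → 𝕜} (hK : Measurable K)
    (hf : StronglyMeasurable f) {x : E3}
    (h : lconv (fun y => ‖K y‖ₑ) (fun y => ‖f y‖ₑ) x < ∞) :
    Integrable (fun y => K (x - y) * f y) := by
  constructor
  · have := hf.measurable
    exact Measurable.aestronglyMeasurable (by fun_prop)
  · simpa [HasFiniteIntegral, lconv] using h

theorem IsAdmissible.integrable {K f : E3 → 𝕜} (hK : IsAdmissible K)
    (hf : StronglyMeasurable f) {q : ℝ≥0∞} (hq : 1 ≤ q) (hq' : q ≠ ∞) (hfq : MemLp f q volume)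
    (x : E3) : Integrable (fun y => K (x - y) * f y) :=
  integrable_conv_of_lconv_lt_top hK.measurable hf (hK.lconv_lt_top hf hq hq' hfq x)

theorem eLpNorm_conv_le {K f : E3 → 𝕜} (hK : Measurable K) (hf : StronglyMeasurable f)
    {q r : ℝ≥0∞} (hq : 1 ≤ q) (hqr : q ≤ r) (hr : r ≠ ∞) {B : ℝ≥0∞} (hB : ∀ x, ‖K x‖ₑ ≤ B) :
    eLpNorm (conv K f) r volume ≤ (∫⁻ y, ‖K y‖ₑ) ^ (1 - (1 / q.toReal - 1 / r.toReal)) *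
      B ^ (1 / q.toReal - 1 / r.toReal) * eLpNorm f q volume :=
  eLpNorm_le_of_enorm_le_lconv hK.enorm hf (enorm_conv_le K f) hq hqr hr hB

theorem IsAdmissible.eLpNorm_conv_le_L1 {K f : E3 → 𝕜} (hK : IsAdmissible K)
    (hf : StronglyMeasurable f) {q : ℝ≥0∞} (hq : 1 ≤ q) (hq' : q ≠ ∞) :
    eLpNorm (conv K f) q volume ≤ (∫⁻ y, ‖K y‖ₑ) * eLpNorm f q volume := by
  obtain ⟨B, _, hKB⟩ := hK.bounded
  simpa using eLpNorm_conv_le hK.measurable hf hq le_rfl hq' hKB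

end Conv

theorem heat_eq_conv (t : ℝ) (f : E3 → ℝ) : heat t f = conv (heatKernel t) f := rfl

theorem isAdmissible_heatKernel {t : ℝ} (ht : 0 < t) : IsAdmissible (heatKernel t) where
  measurable := (continuous_heatKernel t).measurable
  lintegral_ne_top := by simp [lintegral_enorm_heatKernel ht]
  bounded := ⟨_, ENNReal.ofReal_ne_top, enorm_heatKernel_le ht⟩

theorem heat_congr_ae {t : ℝ} {f g : E3 → ℝ} (h : f =ᵐ[volume] g) : heat t f = heat t g :=
  conv_congr_ae _ h

/-! ### The heat semigroup as an operator from `L^q` to `L^r` -/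

/-- The smoothing exponent `(3/2)(1/q - 1/r)` of the heat semigroup from `L^q` to `L^r`. -/
noncomputable def smoothingExp (q r : ℝ≥0∞) : ℝ := 3 / 2 * (1 / q.toReal - 1 / r.toReal)

section Exponents

variable {q r : ℝ≥0∞}

theorem one_le_toReal (hq : 1 ≤ q) (hq' : q ≠ ∞) : 1 ≤ q.toReal := by
  rw [← ENNReal.toReal_one]; exact ENNReal.toReal_mono hq' hq

theorem exponent_gap_nonneg (hq : 1 ≤ q) (hqr : q ≤ r) (hr : r ≠ ∞) :
    0 ≤ 1 / q.toReal - 1 / r.toReal :=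
  sub_nonneg.2 (one_div_le_one_div_of_le
    (zero_lt_one.trans_le (one_le_toReal hq (ne_top_of_le_ne_top hr hqr)))
    (ENNReal.toReal_mono hr hqr))

theorem exponent_gap_lt_one (hq : 1 ≤ q) (hqr : q ≤ r) (hr : r ≠ ∞) :
    1 / q.toReal - 1 / r.toReal < 1 := by
  have h1 := one_le_toReal hq (ne_top_of_le_ne_top hr hqr)
  have h2 := one_le_toReal (hq.trans hqr) hr
  have h3 : 1 / q.toReal ≤ 1 := by rw [div_le_one (by linarith)]; exact h1
  have h4 : 0 < 1 / r.toReal := by positivity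
  linarith

/-- Young's inequality for a kernel of mass one and height at most `t^{-3/2}`; the powers of `4π`
are at most one and are dropped. -/
theorem eLpNorm_heat_le {t : ℝ} (ht : 0 < t) {f : E3 → ℝ} (hf : StronglyMeasurable f)
    (hq : 1 ≤ q) (hqr : q ≤ r) (hr : r ≠ ∞) :
    eLpNorm (heat t f) r volume ≤
      ENNReal.ofReal (t ^ (-smoothingExp q r)) * eLpNorm f q volume := by
  have h := eLpNorm_conv_le (isAdmissible_heatKernel ht).measurable hf hq hqr hr
    (enorm_heatKernel_le ht)
  rw [lintegral_enorm_heatKernel ht, ENNReal.one_rpow, one_mul] at h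
  refine h.trans ?_
  gcongr
  have hd := exponent_gap_nonneg hq hqr hr
  rw [ENNReal.ofReal_rpow_of_nonneg (by positivity) hd, ← Real.rpow_mul (by positivity)]
  apply ENNReal.ofReal_le_ofReal
  have : -(3 / 2) * (1 / q.toReal - 1 / r.toReal) = -smoothingExp q r := by
    unfold smoothingExp; ring
  rw [this]
  apply Real.rpow_le_rpow_of_nonpos ht _ (by unfold smoothingExp; linarith)
  have := Real.pi_gt_three
  nlinarith

theorem memLp_heat {t : ℝ} (ht : 0 < t) {f : E3 → ℝ} (hf : StronglyMeasurable f)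
    (hfq : MemLp f q volume) (hq : 1 ≤ q) (hqr : q ≤ r) (hr : r ≠ ∞) :
    MemLp (heat t f) r volume :=
  ⟨(stronglyMeasurable_conv (isAdmissible_heatKernel ht).measurable hf).aestronglyMeasurable,
    (eLpNorm_heat_le ht hf hq hqr hr).trans_lt (ENNReal.mul_lt_top ENNReal.ofReal_lt_top hfq.2)⟩

end Exponents

section HeatOp

variable (q r : ℝ≥0∞) [hq : Fact (1 ≤ q)] [hr : Fact (1 ≤ r)]

open Classical in
/-- The heat semigroup `e^{tΔ}` as a bounded operator from `L^q` to `L^r`, for `1 ≤ q ≤ r < ∞` and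
`t > 0`. -/
noncomputable def heatOp (t : ℝ) :
    Lp ℝ q (volume : Measure E3) →L[ℝ] Lp ℝ r (volume : Measure E3) :=
  if h : 0 < t ∧ q ≤ r ∧ r ≠ ∞ then
    LinearMap.mkContinuous
      { toFun := fun f => (memLp_heat h.1 (Lp.stronglyMeasurable f) (Lp.memLp f) hq.out h.2.1
          h.2.2).toLp (heat t f)
        map_add' := by
          intro f g
          rw [← MemLp.toLp_add]
          apply MemLp.toLp_congr
          refine ae_of_all _ fun x => ?_
          have hq' : q ≠ ∞ := ne_top_of_le_ne_top h.2.2 h.2.1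
          rw [heat_congr_ae (Lp.coeFn_add f g), Pi.add_apply]
          simp only [heat, Pi.add_apply, mul_add]
          exact integral_add
            ((isAdmissible_heatKernel h.1).integrable (Lp.stronglyMeasurable f) hq.out hq'
              (Lp.memLp f) x)
            ((isAdmissible_heatKernel h.1).integrable (Lp.stronglyMeasurable g) hq.out hq'
              (Lp.memLp g) x)
        map_smul' := by
          intro c f
          rw [RingHom.id_apply, ← MemLp.toLp_const_smul]
          apply MemLp.toLp_congr
          refine ae_of_all _ fun x => ?_
          rw [heat_congr_ae (Lp.coeFn_smul c f), Pi.smul_apply]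
          simp only [heat, Pi.smul_apply, smul_eq_mul, ← integral_const_mul]
          congr 1
          ext y
          ring }
      (t ^ (-smoothingExp q r))
      (by
        intro f
        simp only [LinearMap.coe_mk, AddHom.coe_mk, Lp.norm_toLp]
        rw [Lp.norm_def, ← ENNReal.toReal_ofReal (Real.rpow_nonneg h.1.le (-smoothingExp q r)),
          ← ENNReal.toReal_mul]
        exact ENNReal.toReal_mono
          (ENNReal.mul_ne_top ENNReal.ofReal_ne_top (Lp.memLp f).2.ne)
          (eLpNorm_heat_le h.1 (Lp.stronglyMeasurable f) hq.out h.2.1 h.2.2))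
  else 0

variable {q r}

theorem coeFn_heatOp (hqr : q ≤ r) (hr' : r ≠ ∞) {t : ℝ} (ht : 0 < t)
    (f : Lp ℝ q (volume : Measure E3)) : heatOp q r t f =ᵐ[volume] heat t f := by
  rw [heatOp, dif_pos ⟨ht, hqr, hr'⟩]
  exact MemLp.coeFn_toLp (memLp_heat ht (Lp.stronglyMeasurable f) (Lp.memLp f) hq.out hqr hr')

/-- With `|t|` the bound also covers the default value `0` of the operator. -/
theorem norm_heatOp_le (t : ℝ) : ‖heatOp q r t‖ ≤ |t| ^ (-smoothingExp q r) := by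
  by_cases h : 0 < t ∧ q ≤ r ∧ r ≠ ∞
  · rw [heatOp, dif_pos h, abs_of_pos h.1]
    exact LinearMap.mkContinuous_norm_le _ (Real.rpow_nonneg h.1.le _) _
  · rw [heatOp, dif_neg h, norm_zero]
    positivity

theorem norm_heatOp_apply_le {t : ℝ} (ht : 0 < t) (f : Lp ℝ q (volume : Measure E3)) :
    ‖heatOp q r t f‖ ≤ t ^ (-smoothingExp q r) * ‖f‖ := by
  have := norm_heatOp_le (q := q) (r := r) t
  rw [abs_of_pos ht] at this
  exact (heatOp q r t).le_of_opNorm_le this f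

/-- Continuity holds in operator norm, so it survives application to a moving vector. Young's
inequality is applied to the difference of two kernels: its mass tends to zero, its height stays
bounded, and the mass enters with the positive power `1 - d`. -/
theorem continuousOn_heatOp (hqr : q ≤ r) (hr' : r ≠ ∞) :
    ContinuousOn (fun t => heatOp q r t) (Ioi 0) := by
  intro t (ht : 0 < t)
  apply ContinuousAt.continuousWithinAt
  have hq' : q ≠ ∞ := ne_top_of_le_ne_top hr' hqr
  set d := 1 / q.toReal - 1 / r.toReal with hd
  have hd0 : 0 ≤ d := exponent_gap_nonneg hq.out hqr hr'
  have hd1 : 0 < 1 - d := sub_pos.2 (exponent_gap_lt_one hq.out hqr hr')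
  set B : ℝ≥0∞ := 2 * ENNReal.ofReal ((4 * Real.pi * (t / 2)) ^ (-(3 / 2) : ℝ)) with hB
  have hBtop : B ≠ ∞ := by simp [hB, ENNReal.mul_eq_top]
  set A : ℝ → ℝ≥0∞ := fun s => ∫⁻ x, ‖heatKernel s x - heatKernel t x‖ₑ with hA
  have hAlim : Tendsto A (𝓝 t) (𝓝 0) := tendsto_lintegral_heatKernel_sub ht
  have hlim : Tendsto (fun s => (A s ^ (1 - d) * B ^ d).toReal) (𝓝 t) (𝓝 0) := by
    have h1 : Tendsto (fun s => A s ^ (1 - d)) (𝓝 t) (𝓝 0) := by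
      have := hAlim.ennrpow_const (1 - d)
      rwa [ENNReal.zero_rpow_of_pos hd1] at this
    have h2 := ENNReal.Tendsto.mul_const h1
      (Or.inr (ENNReal.rpow_ne_top_of_nonneg hd0 hBtop) : (0 : ℝ≥0∞) ≠ 0 ∨ B ^ d ≠ ∞)
    rw [zero_mul] at h2
    exact (ENNReal.tendsto_toReal ENNReal.zero_ne_top).comp h2
  rw [ContinuousAt, tendsto_iff_norm_sub_tendsto_zero]
  refine squeeze_zero' (.of_forall fun _ => norm_nonneg _) ?_ hlim
  have hAfin : ∀ᶠ s in 𝓝 t, A s < ∞ := hAlim.eventually_lt_const ENNReal.zero_lt_top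
  filter_upwards [hAfin, Ioi_mem_nhds (show t / 2 < t by linarith)] with s hs (hs2 : t / 2 < s)
  have hs0 : 0 < s := by linarith
  refine ContinuousLinearMap.opNorm_le_bound _ ENNReal.toReal_nonneg fun f => ?_
  have hae : (heatOp q r s - heatOp q r t) f =ᵐ[volume]
      conv (fun x => heatKernel s x - heatKernel t x) f := by
    rw [sub_apply]
    filter_upwards [Lp.coeFn_sub (heatOp q r s f) (heatOp q r t f), coeFn_heatOp hqr hr' hs0 f,
      coeFn_heatOp hqr hr' ht f] with x h1 h2 h3
    rw [h1, Pi.sub_apply, h2, h3, heat_eq_conv, heat_eq_conv]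
    simp only [conv, sub_mul]
    exact (integral_sub
      ((isAdmissible_heatKernel hs0).integrable (Lp.stronglyMeasurable f) hq.out hq' (Lp.memLp f) x)
      ((isAdmissible_heatKernel ht).integrable (Lp.stronglyMeasurable f) hq.out hq'
        (Lp.memLp f) x)).symm
  have hbd : ∀ x, ‖heatKernel s x - heatKernel t x‖ₑ ≤ B := by
    intro x
    refine (enorm_sub_le).trans ?_
    rw [hB, two_mul]
    have hm : ∀ u : ℝ, t / 2 ≤ u → ‖heatKernel u x‖ₑ ≤
        ENNReal.ofReal ((4 * Real.pi * (t / 2)) ^ (-(3 / 2) : ℝ)) := by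
      intro u hu
      have hu0 : 0 < u := by linarith
      refine (enorm_heatKernel_le hu0 x).trans (ENNReal.ofReal_le_ofReal ?_)
      apply Real.rpow_le_rpow_of_nonpos (by positivity) _ (by norm_num)
      gcongr
    exact add_le_add (hm s hs2.le) (hm t (by linarith))
  have key := eLpNorm_conv_le (K := fun x => heatKernel s x - heatKernel t x)
    ((continuous_heatKernel s).sub (continuous_heatKernel t)).measurable
    (Lp.stronglyMeasurable f) hq.out hqr hr' hbd
  rw [Lp.norm_def, Lp.norm_def, eLpNorm_congr_ae hae, ← ENNReal.toReal_mul]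
  refine ENNReal.toReal_mono (ENNReal.mul_ne_top (ENNReal.mul_ne_top ?_ ?_) (Lp.memLp f).2.ne) key
  · exact ENNReal.rpow_ne_top_of_nonneg hd1.le hs.ne
  · exact ENNReal.rpow_ne_top_of_nonneg hd0 hBtop

end HeatOp

/-! ### Behaviour of the heat semigroup for small and large times -/

/-- Equiboundedness lets decay along a filter pass to limits of vectors, which reduces decay of the
heat flow to a dense class. -/
theorem isClosed_setOf_tendsto_zero {X Y : Type*} [NormedAddCommGroup X] [NormedSpace ℝ X]
    [NormedAddCommGroup Y] [NormedSpace ℝ Y] {T : ℝ → X →L[ℝ] Y} {l : Filter ℝ} {C : ℝ}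
    (hT : ∀ᶠ t in l, ‖T t‖ ≤ C) : IsClosed {f | Tendsto (fun t => T t f) l (𝓝 0)} := by
  refine isClosed_of_closure_subset fun f hf => ?_
  rw [mem_ofPred_eq, Metric.tendsto_nhds]
  intro ε hε
  obtain ⟨g, hg, hfg⟩ := Metric.mem_closure_iff.1 hf (ε / (2 * (|C| + 1))) (by positivity)
  rw [mem_ofPred_eq, Metric.tendsto_nhds] at hg
  filter_upwards [hT, hg (ε / 2) (by positivity)] with t h1 h2
  rw [dist_zero_right] at h2 ⊢
  rw [dist_eq_norm, lt_div_iff₀ (by positivity)] at hfg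
  have h3 : ‖T t (f - g)‖ ≤ |C| * ‖f - g‖ := (T t).le_of_opNorm_le (h1.trans (le_abs_self C)) _
  have h4 : T t f = T t (f - g) + T t g := by simp
  have h5 := norm_nonneg (f - g)
  rw [h4]
  refine (norm_add_le _ _).trans_lt ?_
  nlinarith

theorem smoothingExp_pos {q r : ℝ≥0∞} (hq : 1 ≤ q) (hqr : q < r) (hr' : r ≠ ∞) : 0 < smoothingExp q r := by
  have h1 := one_le_toReal hq (ne_top_of_le_ne_top hr' hqr.le)
  have h2 : q.toReal < r.toReal := (ENNReal.toReal_lt_toReal (ne_top_of_le_ne_top hr' hqr.le) hr').2 hqr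
  have h3 : 1 / r.toReal < 1 / q.toReal := one_div_lt_one_div_of_lt (by linarith) h2
  unfold smoothingExp
  linarith

theorem lintegral_lintegral_translate_swap {k : E3 → ℝ≥0∞} (hk : Measurable k) {F : E3 → ℝ}
    (hF : Measurable F) (a : ℝ) :
    ∫⁻ x, ∫⁻ y, k y * ‖F (x - y) - F x‖ₑ ^ a = ∫⁻ y, k y * ∫⁻ x, ‖F (x - y) - F x‖ₑ ^ a := by
  have h : ∀ y, Measurable fun x => ‖F (x - y) - F x‖ₑ ^ a := fun y =>
    ((hF.comp (measurable_id.sub_const y)).sub hF).enorm.pow_const a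
  have h2 : Measurable fun z : E3 × E3 => k z.2 * ‖F (z.1 - z.2) - F z.1‖ₑ ^ a :=
    (hk.comp measurable_snd).mul
      (((hF.comp (measurable_fst.sub measurable_snd)).sub (hF.comp measurable_fst)).enorm.pow_const a)
  rw [lintegral_lintegral_swap h2.aemeasurable]
  congr 1
  ext y
  rw [lintegral_const_mul _ (h y)]

section

variable {q r : ℝ≥0∞} [hq : Fact (1 ≤ q)] [hr : Fact (1 ≤ r)]

/-- For a function lying in several Lebesgue spaces the flow may be estimated from any of them: `a =
r` is used for small times and `a = 1` for large times. -/
theorem norm_heatOp_le_of_ae_eq (hqr : q ≤ r) (hr' : r ≠ ∞) {t : ℝ} (ht : 0 < t)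
    {f : Lp ℝ q (volume : Measure E3)} {g : E3 → ℝ} (hfg : f =ᵐ[volume] g)
    (hg : StronglyMeasurable g) {a : ℝ≥0∞} (ha : 1 ≤ a) (har : a ≤ r) (hga : MemLp g a volume) :
    ‖heatOp q r t f‖ ≤ t ^ (-smoothingExp a r) * (eLpNorm g a volume).toReal := by
  rw [Lp.norm_def, eLpNorm_congr_ae (coeFn_heatOp hqr hr' ht f), heat_congr_ae hfg,
    ← ENNReal.toReal_ofReal (Real.rpow_nonneg ht.le (-smoothingExp a r)), ← ENNReal.toReal_mul]
  exact ENNReal.toReal_mono (ENNReal.mul_ne_top ENNReal.ofReal_ne_top hga.2.ne)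
    (eLpNorm_heat_le ht hg ha har hr')

/-- The weighted operators `t^{α} e^{tΔ}` have norm at most one, so decay need only be checked on
indicators, which lie in both `L¹` and `L^r`. -/
theorem tendsto_heatOp_of_indicator {l : Filter ℝ} (hl : ∀ᶠ t in l, 0 < t) (hqr : q < r)
    (hr' : r ≠ ∞)
    (hind : ∀ (g : E3 → ℝ) (f : Lp ℝ q (volume : Measure E3)), StronglyMeasurable g →
      f =ᵐ[volume] g → MemLp g 1 volume → MemLp g r volume →
      Tendsto (fun t => t ^ smoothingExp q r * ‖heatOp q r t f‖) l (𝓝 0))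
    (f : Lp ℝ q (volume : Measure E3)) :
    Tendsto (fun t => t ^ smoothingExp q r * ‖heatOp q r t f‖) l (𝓝 0) := by
  have hq' : q ≠ ∞ := ne_top_of_le_ne_top hr' hqr.le
  have hequiv : ∀ f : Lp ℝ q (volume : Measure E3),
      Tendsto (fun t => t ^ smoothingExp q r * ‖heatOp q r t f‖) l (𝓝 0) ↔
      Tendsto (fun t => (t ^ smoothingExp q r • heatOp q r t) f) l (𝓝 0) := by
    intro f
    rw [tendsto_zero_iff_norm_tendsto_zero (f := fun t => (t ^ smoothingExp q r • heatOp q r t) f)]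
    apply tendsto_congr'
    filter_upwards [hl] with t ht
    rw [smul_apply, norm_smul, Real.norm_of_nonneg (Real.rpow_nonneg ht.le _)]
  have hclosed := isClosed_setOf_tendsto_zero (T := fun t => t ^ smoothingExp q r • heatOp q r t)
    (l := l) (C := 1) (by
      filter_upwards [hl] with t ht
      rw [norm_smul, Real.norm_of_nonneg (Real.rpow_nonneg ht.le _)]
      have := norm_heatOp_le (q := q) (r := r) t
      rw [abs_of_pos ht, Real.rpow_neg ht.le] at this
      rwa [← le_div_iff₀' (Real.rpow_pos_of_pos ht _), one_div])
  rw [hequiv]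
  refine Lp.induction hq' (motive := fun f => Tendsto
    (fun t => (t ^ smoothingExp q r • heatOp q r t) f) l (𝓝 0)) ?_ ?_ hclosed f
  · intro c s hs hμ
    rw [← hequiv]
    have hm : ∀ a : ℝ≥0∞, MemLp (s.indicator fun _ => c) a (volume : Measure E3) := fun a =>
      memLp_indicator_const a hs c (Or.inr hμ.ne)
    refine hind (s.indicator fun _ => c) _ (stronglyMeasurable_const.indicator hs) ?_ (hm 1) (hm r)
    rw [Lp.simpleFunc.coe_indicatorConst]
    exact indicatorConstLp_coeFn
  · intro f g hf hg _ h1 h2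
    simpa using h1.add h2

theorem tendsto_heatOp_nhdsGT_zero (hqr : q < r) (hr' : r ≠ ∞)
    (f : Lp ℝ q (volume : Measure E3)) :
    Tendsto (fun t => t ^ smoothingExp q r * ‖heatOp q r t f‖) (𝓝[>] 0) (𝓝 0) := by
  have hl : ∀ᶠ t in 𝓝[>] (0 : ℝ), 0 < t := self_mem_nhdsWithin
  refine tendsto_heatOp_of_indicator hl hqr hr' (fun g f hg hfg h1 h2 => ?_) f
  have hk := smoothingExp_pos hq.out hqr hr'
  have hlim : Tendsto (fun t : ℝ => t ^ smoothingExp q r * (eLpNorm g r volume).toReal)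
      (𝓝[>] 0) (𝓝 0) := by
    have : Tendsto (fun t : ℝ => t ^ smoothingExp q r) (𝓝[>] 0) (𝓝 0) := by
      have := (Real.continuousAt_rpow_const 0 (smoothingExp q r) (Or.inr hk.le)).tendsto
      rw [Real.zero_rpow hk.ne'] at this
      exact this.mono_left nhdsWithin_le_nhds
    simpa using this.mul_const (eLpNorm g r volume).toReal
  refine squeeze_zero' ?_ ?_ hlim
  · filter_upwards [hl] with t ht
    positivity
  · filter_upwards [hl] with t ht
    have := norm_heatOp_le_of_ae_eq hqr.le hr' ht hfg hg hr.out le_rfl h2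
    have e : smoothingExp r r = 0 := by simp [smoothingExp]
    rw [e, neg_zero, Real.rpow_zero, one_mul] at this
    gcongr

theorem tendsto_heatOp_atTop (hq1 : 1 < q) (hqr : q < r) (hr' : r ≠ ∞)
    (f : Lp ℝ q (volume : Measure E3)) :
    Tendsto (fun t => t ^ smoothingExp q r * ‖heatOp q r t f‖) atTop (𝓝 0) := by
  have hl : ∀ᶠ t in (atTop : Filter ℝ), 0 < t := eventually_gt_atTop 0
  refine tendsto_heatOp_of_indicator hl hqr hr' (fun g f hg hfg h1 h2 => ?_) f
  have hk := smoothingExp_pos le_rfl hq1 (ne_top_of_le_ne_top hr' hqr.le)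
  have hlim : Tendsto (fun t : ℝ => t ^ (-smoothingExp 1 q) * (eLpNorm g 1 volume).toReal)
      atTop (𝓝 0) := by
    simpa using (tendsto_rpow_neg_atTop hk).mul_const (eLpNorm g 1 volume).toReal
  refine squeeze_zero' ?_ ?_ hlim
  · filter_upwards [hl] with t ht
    positivity
  · filter_upwards [hl] with t ht
    have := norm_heatOp_le_of_ae_eq hqr.le hr' ht hfg hg le_rfl hr.out h1
    -- Starting from `L¹` leaves a surplus decay `t^{-(3/2)(1 - 1/q)}`, a negative power since `q >
    -- 1`.
    have e : -smoothingExp 1 q = smoothingExp q r + -smoothingExp 1 r := by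
      simp only [smoothingExp]; ring
    rw [e, Real.rpow_add ht, mul_assoc]
    gcongr

/-! ### Strong continuity of the heat semigroup at time zero. -/

theorem tendsto_lintegral_translate_sub (hq' : q ≠ ∞) (f : Lp ℝ q (volume : Measure E3)) :
    Tendsto (fun y : E3 => ∫⁻ x, ‖f (x - y) - f x‖ₑ ^ q.toReal) (𝓝 0) (𝓝 0) := by
  have hq0 : q ≠ 0 := (zero_lt_one.trans_le hq.out).ne'
  have hq1 := one_le_toReal hq.out hq'
  let g : E3 → C(E3, E3) := fun y => ⟨fun x => x - y, by fun_prop⟩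
  have hgc : Continuous g :=
    (ContinuousMap.mk (fun a : E3 × E3 => a.2 - a.1) (by fun_prop)).curry.continuous
  have hgm : ∀ y, MeasurePreserving (g y) (volume : Measure E3) volume := fun y =>
    measurePreserving_sub_right volume y
  have h := (continuous_const (y := f)).compMeasurePreservingLp hgc hgm hq'
  have h0 : Lp.compMeasurePreserving (g 0) (hgm 0) f = f := by
    apply Lp.ext
    filter_upwards [Lp.coeFn_compMeasurePreserving f (hgm 0)] with x hx
    rw [hx]
    simp [g]
  have h1 := h.tendsto 0
  rw [h0, Lp.tendsto_Lp_iff_tendsto_eLpNorm'] at h1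
  have h2 := h1.ennrpow_const q.toReal
  rw [ENNReal.zero_rpow_of_pos (by linarith)] at h2
  refine h2.congr fun y => ?_
  rw [eLpNorm_eq_lintegral_rpow_enorm_toReal hq0 hq', ← ENNReal.rpow_mul,
    one_div_mul_cancel (by linarith), ENNReal.rpow_one]
  apply lintegral_congr_ae
  filter_upwards [Lp.coeFn_compMeasurePreserving f (hgm y)] with x hx
  rw [Pi.sub_apply, hx]
  simp [g]

theorem lintegral_translate_sub_le (hq' : q ≠ ∞) (f : Lp ℝ q (volume : Measure E3)) (y : E3) :
    ∫⁻ x, ‖f (x - y) - f x‖ₑ ^ q.toReal ≤ (2 * eLpNorm f q volume) ^ q.toReal := by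
  have hq0 : q ≠ 0 := (zero_lt_one.trans_le hq.out).ne'
  have hq1 := one_le_toReal hq.out hq'
  have hm := measurePreserving_sub_right (volume : Measure E3) y
  have h := eLpNorm_sub_le (μ := (volume : Measure E3)) (p := q) (f := fun x => f (x - y)) (g := f)
    ((Lp.aestronglyMeasurable f).comp_measurePreserving hm) (Lp.aestronglyMeasurable f) hq.out
  have h2 : eLpNorm (fun x => f (x - y)) q volume = eLpNorm f q volume :=
    eLpNorm_comp_measurePreserving (Lp.aestronglyMeasurable f) hm
  rw [h2, ← two_mul] at h
  refine le_trans (le_of_eq ?_) (ENNReal.rpow_le_rpow h (by linarith : 0 ≤ q.toReal))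
  rw [eLpNorm_eq_lintegral_rpow_enorm_toReal hq0 hq', ← ENNReal.rpow_mul,
    one_div_mul_cancel (by linarith), ENNReal.rpow_one]
  rfl

/-- As the kernel has mass one, `e^{tΔ} f - f` is an average of translation differences of `f`;
Jensen brings the power inside and Tonelli exchanges the integrals. -/
theorem lintegral_heat_sub_rpow_le (hq' : q ≠ ∞) (f : Lp ℝ q (volume : Measure E3)) {t : ℝ}
    (ht : 0 < t) :
    ∫⁻ x, ‖heat t f x - f x‖ₑ ^ q.toReal ≤
      ∫⁻ y, ‖heatKernel t y‖ₑ * ∫⁻ x, ‖f (x - y) - f x‖ₑ ^ q.toReal := by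
  have hq1 := one_le_toReal hq.out hq'
  have hfm := (Lp.stronglyMeasurable f).measurable
  have hkm := measurable_enorm_heatKernel t
  have hpt : ∀ x, ‖heat t f x - f x‖ₑ ^ q.toReal ≤
      ∫⁻ y, ‖heatKernel t y‖ₑ * ‖f (x - y) - f x‖ₑ ^ q.toReal := by
    intro x
    have e : heat t f x - f x = conv (heatKernel t) (fun y => f y - f x) x := by
      have h1 : ∫ y, heatKernel t (x - y) * f x = f x := by
        rw [integral_mul_const, integral_sub_left_eq_self (heatKernel t) volume x,
          integral_heatKernel ht, one_mul]
      unfold conv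
      simp only [mul_sub]
      rw [integral_sub ((isAdmissible_heatKernel ht).integrable (Lp.stronglyMeasurable f) hq.out
        hq' (Lp.memLp f) x) (((integrable_heatKernel ht).comp_sub_left x).mul_const _), h1]
      rfl
    rw [e]
    refine (ENNReal.rpow_le_rpow (enorm_conv_le _ _ x) (by linarith)).trans ?_
    refine (lconv_rpow_le hkm (hfm.sub_const _).enorm hq1 x).trans_eq ?_
    rw [lintegral_enorm_heatKernel ht, ENNReal.one_rpow, one_mul, lconv_comm]
    unfold lconv
    simp only [mul_comm]
  refine (lintegral_mono hpt).trans_eq ?_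
  exact lintegral_lintegral_translate_swap hkm hfm _

theorem lintegral_heatKernel_mul_norm_le {t : ℝ} (ht : 0 < t) :
    ∫⁻ y, ‖heatKernel t y‖ₑ * ‖y‖ₑ ≤ ENNReal.ofReal (6 * √t) := by
  have h : ∀ y : E3, ‖heatKernel t y‖ₑ * ‖y‖ₑ ≤ ENNReal.ofReal (6 * √t) * ‖heatKernel (2 * t) y‖ₑ := by
    intro y
    rw [enorm_heatKernel ht, enorm_heatKernel (by positivity), ← ofReal_norm,
      ← ENNReal.ofReal_mul (heatKernel_nonneg ht y), ← ENNReal.ofReal_mul (by positivity), mul_comm]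
    exact ENNReal.ofReal_le_ofReal (norm_mul_heatKernel_le ht y)
  refine (lintegral_mono h).trans_eq ?_
  rw [lintegral_const_mul _ (measurable_enorm_heatKernel _),
    lintegral_enorm_heatKernel (by positivity), mul_one]

/-- Approximate identity: near the origin `ω` is small, and away from it Chebyshev with the first
moment `O(√t)` of the kernel suffices. -/
theorem tendsto_lintegral_heatKernel_mul {ω : E3 → ℝ≥0∞} {M : ℝ≥0∞}
    (hM : M ≠ ∞) (hωM : ∀ y, ω y ≤ M) (hω : Tendsto ω (𝓝 0) (𝓝 0)) :
    Tendsto (fun t => ∫⁻ y, ‖heatKernel t y‖ₑ * ω y) (𝓝[>] 0) (𝓝 0) := by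
  rw [ENNReal.tendsto_nhds_zero]
  intro ε hε
  have hε2 : 0 < ε / 2 := ENNReal.half_pos hε.ne'
  obtain ⟨δ, hδ, hb⟩ := Metric.eventually_nhds_iff.1
    ((ENNReal.tendsto_nhds_zero.1 hω) (ε / 2) hε2)
  have hlim : Tendsto (fun t : ℝ => M / ENNReal.ofReal δ * ENNReal.ofReal (6 * √t)) (𝓝[>] 0)
      (𝓝 0) := by
    have h1 : Tendsto (fun t : ℝ => ENNReal.ofReal (6 * √t)) (𝓝[>] 0) (𝓝 0) := by
      have : Continuous fun t : ℝ => ENNReal.ofReal (6 * √t) :=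
        ENNReal.continuous_ofReal.comp (by fun_prop)
      simpa using (this.tendsto 0).mono_left nhdsWithin_le_nhds
    have h2 := ENNReal.Tendsto.const_mul (a := M / ENNReal.ofReal δ) h1 (Or.inr
      (ENNReal.div_ne_top hM (by simpa using hδ)))
    simpa using h2
  filter_upwards [(ENNReal.tendsto_nhds_zero.1 hlim) (ε / 2) hε2, self_mem_nhdsWithin] with t h1 ht
  have ht : 0 < t := ht
  have hpt : ∀ y, ‖heatKernel t y‖ₑ * ω y ≤
      ‖heatKernel t y‖ₑ * (ε / 2) + M / ENNReal.ofReal δ * (‖heatKernel t y‖ₑ * ‖y‖ₑ) := by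
    intro y
    by_cases hy : ‖y‖ < δ
    · exact le_add_right (mul_le_mul' le_rfl (hb (by simpa using hy)))
    · refine le_add_left ?_
      have h3 : ENNReal.ofReal δ ≤ ‖y‖ₑ := by
        rw [← ofReal_norm]; exact ENNReal.ofReal_le_ofReal (not_lt.1 hy)
      have hδ0 : ENNReal.ofReal δ ≠ 0 := by simpa using hδ
      calc ‖heatKernel t y‖ₑ * ω y ≤ ‖heatKernel t y‖ₑ * M := mul_le_mul' le_rfl (hωM y)
        _ = M / ENNReal.ofReal δ * (‖heatKernel t y‖ₑ * ENNReal.ofReal δ) := by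
            rw [mul_comm _ (ENNReal.ofReal δ), ← mul_assoc,
              ENNReal.div_mul_cancel hδ0 ENNReal.ofReal_ne_top, mul_comm]
        _ ≤ _ := by gcongr
  have hkm := measurable_enorm_heatKernel t
  refine (lintegral_mono hpt).trans ?_
  rw [lintegral_add_left (by fun_prop), lintegral_mul_const _ hkm, lintegral_enorm_heatKernel ht,
    one_mul, lintegral_const_mul _ (by fun_prop)]
  calc _ ≤ ε / 2 + M / ENNReal.ofReal δ * ENNReal.ofReal (6 * √t) := by
        gcongr; exact lintegral_heatKernel_mul_norm_le ht
    _ ≤ ε / 2 + ε / 2 := by gcongr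
    _ = ε := ENNReal.add_halves ε

/-- The heat semigroup is strongly continuous at time zero. -/
theorem tendsto_heatOp_self (hq' : q ≠ ∞) (f : Lp ℝ q (volume : Measure E3)) :
    Tendsto (fun t => heatOp q q t f) (𝓝[>] 0) (𝓝 f) := by
  have hq0 : q ≠ 0 := (zero_lt_one.trans_le hq.out).ne'
  have hq1 := one_le_toReal hq.out hq'
  rw [Lp.tendsto_Lp_iff_tendsto_eLpNorm']
  have hω := tendsto_lintegral_heatKernel_mul (M := (2 * eLpNorm f q volume) ^ q.toReal)
    (ENNReal.rpow_ne_top_of_nonneg (by linarith)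
      (ENNReal.mul_ne_top ENNReal.ofNat_ne_top (Lp.memLp f).2.ne))
    (lintegral_translate_sub_le hq' f) (tendsto_lintegral_translate_sub hq' f)
  have h2 := hω.ennrpow_const (1 / q.toReal)
  rw [ENNReal.zero_rpow_of_pos (by positivity)] at h2
  refine tendsto_of_tendsto_of_tendsto_of_le_of_le' tendsto_const_nhds h2
    (.of_forall fun _ => zero_le) ?_
  filter_upwards [self_mem_nhdsWithin] with t ht
  have ht : 0 < t := ht
  rw [eLpNorm_eq_lintegral_rpow_enorm_toReal hq0 hq']
  refine ENNReal.rpow_le_rpow ?_ (by positivity)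
  refine le_trans (le_of_eq ?_) (lintegral_heat_sub_rpow_le hq' f ht)
  apply lintegral_congr_ae
  filter_upwards [coeFn_heatOp le_rfl hq' ht f] with x hx
  rw [Pi.sub_apply, hx]

end

/-! ### The cubic nonlinearity -/

section Cube

variable {p p₂ q : ℝ≥0∞} [hp : Fact (1 ≤ p)] [hp₂ : Fact (1 ≤ p₂)] [hq : Fact (1 ≤ q)]
  [ENNReal.HolderTriple p p p₂] [ENNReal.HolderTriple p p₂ q]

variable (p₂ q) in
/-- The cube of a function in `L^p`, as an element of `L^{p/3}`. -/
noncomputable def cube (f : Lp ℝ p (volume : Measure E3)) : Lp ℝ q (volume : Measure E3) :=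
  f • (f • f : Lp ℝ p₂ (volume : Measure E3))

omit hp hp₂ hq in
theorem coeFn_cube (f : Lp ℝ p (volume : Measure E3)) :
    cube p₂ q f =ᵐ[volume] fun x => f x ^ 3 := by
  unfold cube
  filter_upwards [Lp.coeFn_lpSMul (r := q) f (f • f : Lp ℝ p₂ (volume : Measure E3)),
    Lp.coeFn_lpSMul (r := p₂) f f] with x h1 h2
  rw [h1, Pi.smul_apply', h2, Pi.smul_apply', smul_eq_mul, smul_eq_mul]
  ring

-- With `h = f - g`, the difference of cubes telescopes into `h f f + g h f + g g h`, and Hölder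
-- bounds each of the three products by `M² ‖h‖`.
omit hp₂ in
theorem norm_cube_sub_le {M : ℝ} {f g : Lp ℝ p (volume : Measure E3)} (hf : ‖f‖ ≤ M)
    (hg : ‖g‖ ≤ M) : ‖cube p₂ q f - cube p₂ q g‖ ≤ 3 * M ^ 2 * ‖f - g‖ := by
  have hM : 0 ≤ M := (norm_nonneg f).trans hf
  -- Writing `f = h + g` reduces the telescoping to additivity of the product in each factor.
  have key : ∀ h : Lp ℝ p (volume : Measure E3), ‖h + g‖ ≤ M →
      ‖cube p₂ q (h + g) - cube p₂ q g‖ ≤ 3 * M ^ 2 * ‖h‖ := by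
    intro h hh
    have e : cube p₂ q (h + g) - cube p₂ q g =
        ((h • ((h + g) • (h + g) : Lp ℝ p₂ (volume : Measure E3)) : Lp ℝ q (volume : Measure E3)) +
        (g • (h • (h + g) : Lp ℝ p₂ (volume : Measure E3)) : Lp ℝ q (volume : Measure E3))) +
        (g • (g • h : Lp ℝ p₂ (volume : Measure E3)) : Lp ℝ q (volume : Measure E3)) := by
      unfold cube
      simp only [Lp.smul_add, Lp.add_smul]
      abel
    have n2 : ∀ a b : Lp ℝ p (volume : Measure E3),
        ‖(a • b : Lp ℝ p₂ (volume : Measure E3))‖ ≤ ‖a‖ * ‖b‖ := fun a b => Lp.norm_smul_le a b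
    have n3 : ∀ a b c : Lp ℝ p (volume : Measure E3),
        ‖(a • (b • c : Lp ℝ p₂ (volume : Measure E3)) : Lp ℝ q (volume : Measure E3))‖ ≤
          ‖a‖ * (‖b‖ * ‖c‖) := fun a b c =>
      (Lp.norm_smul_le _ _).trans (mul_le_mul_of_nonneg_left (n2 b c) (norm_nonneg a))
    rw [e]
    refine (norm_add₃_le).trans ?_
    have b1 : ‖h‖ * (‖h + g‖ * ‖h + g‖) ≤ ‖h‖ * (M * M) := by gcongr
    have b2 : ‖g‖ * (‖h‖ * ‖h + g‖) ≤ M * (‖h‖ * M) := by gcongr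
    have b3 : ‖g‖ * (‖g‖ * ‖h‖) ≤ M * (M * ‖h‖) := by gcongr
    linarith [n3 h (h + g) (h + g), n3 g h (h + g), n3 g g h]
  have := key (f - g) (by simpa using hf)
  simpa using this

omit hp hp₂ hq in
theorem cube_zero : cube p₂ q (0 : Lp ℝ p (volume : Measure E3)) = 0 := by
  unfold cube
  simp

omit hp₂ in
theorem continuous_cube : Continuous (cube p₂ q : Lp ℝ p (volume : Measure E3) → _) := by
  rw [continuous_iff_continuousAt]
  intro f
  rw [ContinuousAt, tendsto_iff_norm_sub_tendsto_zero]
  have h : Tendsto (fun g => 3 * (‖f‖ + 1) ^ 2 * ‖g - f‖) (𝓝 f) (𝓝 0) := by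
    have : Continuous fun g => 3 * (‖f‖ + 1) ^ 2 * ‖g - f‖ := by fun_prop
    simpa using this.tendsto f
  refine squeeze_zero' (.of_forall fun _ => norm_nonneg _) ?_ h
  filter_upwards [Metric.ball_mem_nhds f one_pos] with g hg
  rw [mem_ball_iff_norm] at hg
  refine norm_cube_sub_le ?_ (by linarith)
  have := norm_sub_norm_le g f
  linarith

variable (p₂ q) in
/-- The cube of a path in `L^p` vanishing at infinity. -/
noncomputable def cubePath (v : C₀(ℝ, Lp ℝ p (volume : Measure E3))) :
    C₀(ℝ, Lp ℝ q (volume : Measure E3)) where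
  toFun s := cube p₂ q (v s)
  continuous_toFun := continuous_cube.comp v.continuous
  zero_at_infty' := by
    have := (continuous_cube (p₂ := p₂) (q := q)).tendsto (0 : Lp ℝ p (volume : Measure E3))
    rw [cube_zero] at this
    exact this.comp v.zero_at_infty'

omit hp hp₂ hq in
theorem _root_.ZeroAtInftyContinuousMap.norm_apply_le {F : Type*} [NormedAddCommGroup F]
    (v : C₀(ℝ, F)) (s : ℝ) : ‖v s‖ ≤ ‖v‖ :=
  v.toBCF.norm_coe_le_norm s

omit hp hp₂ hq in
theorem _root_.ZeroAtInftyContinuousMap.norm_le_of_forall {F : Type*} [NormedAddCommGroup F]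
    {v : C₀(ℝ, F)} {C : ℝ} (hC : 0 ≤ C) (h : ∀ s, ‖v s‖ ≤ C) : ‖v‖ ≤ C :=
  (BoundedContinuousFunction.norm_le hC).2 h

omit hp₂ in
theorem norm_cubePath_sub_le {M : ℝ} {v w : C₀(ℝ, Lp ℝ p (volume : Measure E3))} (hv : ‖v‖ ≤ M)
    (hw : ‖w‖ ≤ M) : ‖cubePath p₂ q v - cubePath p₂ q w‖ ≤ 3 * M ^ 2 * ‖v - w‖ := by
  refine ZeroAtInftyContinuousMap.norm_le_of_forall (by positivity) fun s => ?_
  refine (norm_cube_sub_le ((v.norm_apply_le s).trans hv) ((w.norm_apply_le s).trans hw)).trans ?_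
  gcongr
  exact (v - w).norm_apply_le s

end Cube

/-! ### The Duhamel integral in logarithmic time -/

section Duhamel

/-- The majorant of every Duhamel integrand: the singularity at `0` comes from the weight of the
source, the one at `1` from the smoothing of the semigroup. -/
theorem integrableOn_beta {a b : ℝ} (ha : a < 1) (hb : b < 1) :
    IntegrableOn (fun θ : ℝ => θ ^ (-a) * (1 - θ) ^ (-b)) (Ioo 0 1) := by
  have h := Complex.betaIntegral_convergent (u := ((1 - a : ℝ) : ℂ)) (v := ((1 - b : ℝ) : ℂ))
    (by simpa using ha) (by simpa using hb)
  rw [intervalIntegrable_iff_integrableOn_Ioo_of_le zero_le_one] at h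
  have hn : IntegrableOn (fun x : ℝ => ‖(x : ℂ) ^ (((1 - a : ℝ) : ℂ) - 1) *
      (1 - (x : ℂ)) ^ (((1 - b : ℝ) : ℂ) - 1)‖) (Ioo 0 1) := Integrable.norm h
  refine hn.congr_fun (fun θ hθ => ?_) measurableSet_Ioo
  have h1 : 0 < 1 - θ := by linarith [hθ.2]
  have e : (1 : ℂ) - (θ : ℂ) = ((1 - θ : ℝ) : ℂ) := by push_cast; ring
  simp only [norm_mul]
  rw [e, Complex.norm_cpow_eq_rpow_re_of_pos hθ.1, Complex.norm_cpow_eq_rpow_re_of_pos h1]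
  simp

variable {q r : ℝ≥0∞} [hq : Fact (1 ≤ q)] [hr : Fact (1 ≤ r)]

variable (r) in
/-- The integrand of the Duhamel integral at time `e^s`, in the variable `θ = τ / e^s`. -/
noncomputable def duhamelIntegrand (β : ℝ) (g : ℝ → Lp ℝ q (volume : Measure E3)) (s θ : ℝ) :
    Lp ℝ r (volume : Measure E3) :=
  -- In the application the power of `e^s` collects the Jacobian `e^s` of `τ = e^s θ`, the factor
  -- `e^{-βs}` of `τ^{-β}`, and the weight of the target space (`e^{sσ/2}` for `L^p`, none for
  -- `L³`).
  (Real.exp s ^ smoothingExp q r * θ ^ (-β)) •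
    heatOp q r (Real.exp s * (1 - θ)) (g (s + Real.log θ))

/-- Scale invariance: the power of `e^s` cancels the smoothing cost, so the kernel in `θ` does not
depend on `s`. -/
theorem norm_duhamelIntegrand_le (β : ℝ) (g : ℝ → Lp ℝ q (volume : Measure E3)) (s : ℝ) {θ : ℝ}
    (hθ : θ ∈ Ioo (0 : ℝ) 1) :
    ‖duhamelIntegrand r β g s θ‖ ≤
      θ ^ (-β) * (1 - θ) ^ (-smoothingExp q r) * ‖g (s + Real.log θ)‖ := by
  have h0 := hθ.1
  have h1 : 0 < 1 - θ := by linarith [hθ.2]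
  have hs := Real.exp_pos s
  unfold duhamelIntegrand
  rw [norm_smul, Real.norm_of_nonneg (by positivity)]
  calc _ ≤ Real.exp s ^ smoothingExp q r * θ ^ (-β) *
        ((Real.exp s * (1 - θ)) ^ (-smoothingExp q r) * ‖g (s + Real.log θ)‖) := by
        gcongr
        exact norm_heatOp_apply_le (by positivity) _
    _ = (Real.exp s ^ smoothingExp q r * Real.exp s ^ (-smoothingExp q r)) *
        (θ ^ (-β) * (1 - θ) ^ (-smoothingExp q r) * ‖g (s + Real.log θ)‖) := by
        rw [Real.mul_rpow hs.le h1.le]; ring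
    _ = _ := by rw [← Real.rpow_add hs]; simp

/-- The general parameter space serves twice: for measurability in `θ` at fixed `s`, and for
continuity in `s` at fixed `θ`. -/
theorem continuousOn_duhamelIntegrand (hqr : q ≤ r) (hr' : r ≠ ∞) (β : ℝ)
    {g : ℝ → Lp ℝ q (volume : Measure E3)} (hg : Continuous g) {T : Type*} [TopologicalSpace T]
    {S : Set T} {a b : T → ℝ} (ha : ContinuousOn a S) (hb : ContinuousOn b S)
    (hab : ∀ z ∈ S, b z ∈ Ioo (0 : ℝ) 1) :
    ContinuousOn (fun z => duhamelIntegrand r β g (a z) (b z)) S := by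
  have hexp : ContinuousOn (fun z => Real.exp (a z)) S := Real.continuous_exp.comp_continuousOn ha
  have h1 : ContinuousOn (fun z => Real.exp (a z) ^ smoothingExp q r * b z ^ (-β)) S :=
    (hexp.rpow_const fun z _ => Or.inl (Real.exp_pos _).ne').mul
      (hb.rpow_const fun z hz => Or.inl (hab z hz).1.ne')
  have h2 : ContinuousOn (fun z => Real.exp (a z) * (1 - b z)) S :=
    hexp.mul (continuousOn_const.sub hb)
  have h3 : ContinuousOn (fun z => heatOp q r (Real.exp (a z) * (1 - b z))) S :=
    (continuousOn_heatOp hqr hr').comp h2 fun z hz =>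
      mem_Ioi.2 (mul_pos (Real.exp_pos _) (sub_pos.2 (hab z hz).2))
  have h4 : ContinuousOn (fun z => g (a z + Real.log (b z))) S :=
    hg.comp_continuousOn (ha.add (hb.log fun z hz => (hab z hz).1.ne'))
  exact h1.smul (h3.clm_apply h4)

theorem aestronglyMeasurable_duhamelIntegrand (hqr : q ≤ r) (hr' : r ≠ ∞) (β : ℝ)
    {g : ℝ → Lp ℝ q (volume : Measure E3)} (hg : Continuous g) (s : ℝ) :
    AEStronglyMeasurable (duhamelIntegrand r β g s) (volume.restrict (Ioo (0 : ℝ) 1)) :=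
  (continuousOn_duhamelIntegrand hqr hr' β hg continuousOn_const continuousOn_id
    fun _ hz => hz).aestronglyMeasurable measurableSet_Ioo

theorem norm_duhamelIntegrand_le_of_bound (β : ℝ) {g : ℝ → Lp ℝ q (volume : Measure E3)} {C : ℝ}
    (hC : ∀ s, ‖g s‖ ≤ C) (s : ℝ) :
    ∀ᵐ θ ∂(volume.restrict (Ioo (0 : ℝ) 1)), ‖duhamelIntegrand r β g s θ‖ ≤
      θ ^ (-β) * (1 - θ) ^ (-smoothingExp q r) * C := by
  filter_upwards [ae_restrict_mem measurableSet_Ioo] with θ hθ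
  refine (norm_duhamelIntegrand_le β g s hθ).trans ?_
  have h0 := hθ.1
  have h1 : 0 < 1 - θ := by linarith [hθ.2]
  gcongr
  exact hC _

theorem integrableOn_duhamelIntegrand (hqr : q ≤ r) (hr' : r ≠ ∞) {β : ℝ} (hβ : β < 1)
    (hα : smoothingExp q r < 1) {g : ℝ → Lp ℝ q (volume : Measure E3)} (hg : Continuous g) {C : ℝ}
    (hC : ∀ s, ‖g s‖ ≤ C) (s : ℝ) : IntegrableOn (duhamelIntegrand r β g s) (Ioo 0 1) :=
  Integrable.mono' ((integrableOn_beta hβ hα).mul_const C)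
    (aestronglyMeasurable_duhamelIntegrand hqr hr' β hg s)
    (norm_duhamelIntegrand_le_of_bound β hC s)

/-- Dominated convergence: at fixed `θ` the source is evaluated at a translate of `s`, which still
escapes to infinity. The filter stands for `atBot` and for `atTop`. -/
theorem tendsto_integral_duhamelIntegrand (hqr : q ≤ r) (hr' : r ≠ ∞) {β : ℝ} (hβ : β < 1)
    (hα : smoothingExp q r < 1) (g : C₀(ℝ, Lp ℝ q (volume : Measure E3))) {l : Filter ℝ}
    [l.IsCountablyGenerated] (hl : l ≤ cocompact ℝ)
    (hl' : ∀ a : ℝ, Tendsto (fun s => s + a) l l) :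
    Tendsto (fun s => ∫ θ in Ioo (0 : ℝ) 1, duhamelIntegrand r β g s θ) l (𝓝 0) := by
  have h0 : (0 : Lp ℝ r (volume : Measure E3)) = ∫ θ in Ioo (0 : ℝ) 1, 0 := by simp
  rw [h0]
  refine tendsto_integral_filter_of_dominated_convergence
    (fun θ => θ ^ (-β) * (1 - θ) ^ (-smoothingExp q r) * ‖g‖) ?_ ?_
    ((integrableOn_beta hβ hα).mul_const _) ?_
  · exact .of_forall fun s => aestronglyMeasurable_duhamelIntegrand hqr hr' β g.continuous s
  · exact .of_forall fun s => norm_duhamelIntegrand_le_of_bound β g.norm_apply_le s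
  · filter_upwards [ae_restrict_mem measurableSet_Ioo] with θ hθ
    rw [tendsto_zero_iff_norm_tendsto_zero]
    have h1 : Tendsto (fun s => g (s + Real.log θ)) l (𝓝 0) :=
      (g.zero_at_infty'.mono_left hl).comp (hl' _)
    have h2 := h1.norm.const_mul (θ ^ (-β) * (1 - θ) ^ (-smoothingExp q r))
    rw [norm_zero, mul_zero] at h2
    exact squeeze_zero (fun _ => norm_nonneg _) (fun s => norm_duhamelIntegrand_le β g s hθ) h2

/-- The Duhamel integral as a map between paths vanishing at infinity. -/
noncomputable def duhamelPath (hqr : q ≤ r) (hr' : r ≠ ∞) {β : ℝ} (hβ : β < 1)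
    (hα : smoothingExp q r < 1) (g : C₀(ℝ, Lp ℝ q (volume : Measure E3))) :
    C₀(ℝ, Lp ℝ r (volume : Measure E3)) where
  toFun s := ∫ θ in Ioo (0 : ℝ) 1, duhamelIntegrand r β g s θ
  continuous_toFun := by
    refine continuous_of_dominated
      (fun s => aestronglyMeasurable_duhamelIntegrand hqr hr' β g.continuous s)
      (fun s => norm_duhamelIntegrand_le_of_bound β g.norm_apply_le s)
      ((integrableOn_beta hβ hα).mul_const _) ?_
    filter_upwards [ae_restrict_mem measurableSet_Ioo] with θ hθ
    rw [← continuousOn_univ]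
    exact continuousOn_duhamelIntegrand hqr hr' β g.continuous continuousOn_id continuousOn_const
      fun _ _ => hθ
  zero_at_infty' := by
    rw [cocompact_eq_atBot_atTop, tendsto_sup]
    refine ⟨tendsto_integral_duhamelIntegrand hqr hr' hβ hα g ?_ ?_,
      tendsto_integral_duhamelIntegrand hqr hr' hβ hα g ?_ ?_⟩
    · rw [cocompact_eq_atBot_atTop]; exact le_sup_left
    · exact fun a => tendsto_atBot_add_const_right _ a tendsto_id
    · rw [cocompact_eq_atBot_atTop]; exact le_sup_right
    · exact fun a => tendsto_atTop_add_const_right _ a tendsto_id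

theorem norm_duhamelPath_sub_le (hqr : q ≤ r) (hr' : r ≠ ∞) {β : ℝ} (hβ : β < 1)
    (hα : smoothingExp q r < 1) (g h : C₀(ℝ, Lp ℝ q (volume : Measure E3))) :
    ‖duhamelPath hqr hr' hβ hα g - duhamelPath hqr hr' hβ hα h‖ ≤
      (∫ θ in Ioo (0 : ℝ) 1, θ ^ (-β) * (1 - θ) ^ (-smoothingExp q r)) * ‖g - h‖ := by
  have hpos : 0 ≤ ∫ θ in Ioo (0 : ℝ) 1, θ ^ (-β) * (1 - θ) ^ (-smoothingExp q r) := by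
    refine setIntegral_nonneg measurableSet_Ioo fun θ hθ => ?_
    have h0 := hθ.1
    have h1 : 0 < 1 - θ := by linarith [hθ.2]
    positivity
  refine ZeroAtInftyContinuousMap.norm_le_of_forall (by positivity) fun s => ?_
  have e : (duhamelPath hqr hr' hβ hα g - duhamelPath hqr hr' hβ hα h) s =
      ∫ θ in Ioo (0 : ℝ) 1, duhamelIntegrand r β (g - h) s θ := by
    rw [ZeroAtInftyContinuousMap.sub_apply]
    refine (integral_sub
      (integrableOn_duhamelIntegrand hqr hr' hβ hα g.continuous g.norm_apply_le s)
      (integrableOn_duhamelIntegrand hqr hr' hβ hα h.continuous h.norm_apply_le s)).symm.trans ?_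
    congr 1
    ext1 θ
    simp [duhamelIntegrand, smul_sub]
  rw [e]
  refine (norm_integral_le_of_norm_le ((integrableOn_beta hβ hα).mul_const _)
    (norm_duhamelIntegrand_le_of_bound β (g := (g - h)) (g - h).norm_apply_le s)).trans_eq ?_
  rw [integral_mul_const]

end Duhamel

/-! ### The fixed point -/

/-- Contraction principle for a cubic perturbation. The radius `M` makes the Lipschitz constant `K
M²` equal to `1/2`; as `N 0 = 0`, the nonlinearity uses half of the radius and leaves `M / 2` for
the datum. -/
theorem exists_fixedPoint_of_locally_lipschitz {X : Type*} [NormedAddCommGroup X]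
    [CompleteSpace X] {N : X → X} {K : ℝ} (hK : 0 < K) (h0 : N 0 = 0)
    (hN : ∀ M : ℝ, ∀ v w : X, ‖v‖ ≤ M → ‖w‖ ≤ M → ‖N v - N w‖ ≤ K * M ^ 2 * ‖v - w‖) :
    ∃ ε : ℝ, 0 < ε ∧ ∀ a : X, ‖a‖ ≤ ε → ∃ v : X, v = a + N v := by
  set M : ℝ := √(1 / (2 * K)) with hM
  have hM0 : 0 < M := Real.sqrt_pos.2 (by positivity)
  have hM2 : K * M ^ 2 = 1 / 2 := by
    rw [hM, Real.sq_sqrt (by positivity)]; field_simp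
  refine ⟨M / 2, by positivity, fun a ha => ?_⟩
  have hLip : ∀ v w : X, ‖v‖ ≤ M → ‖w‖ ≤ M → ‖N v - N w‖ ≤ 1 / 2 * ‖v - w‖ := by
    intro v w hv hw
    have := hN M v w hv hw
    rwa [hM2] at this
  have hmaps : MapsTo (fun v => a + N v) (Metric.closedBall 0 M) (Metric.closedBall 0 M) := by
    intro v hv
    rw [mem_closedBall_zero_iff] at hv ⊢
    have := hLip v 0 hv (by simpa using hM0.le)
    rw [h0, sub_zero, sub_zero] at this
    calc ‖a + N v‖ ≤ ‖a‖ + ‖N v‖ := norm_add_le _ _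
      _ ≤ M / 2 + 1 / 2 * M := by gcongr; linarith
      _ = M := by ring
  have hcontr : ContractingWith (1 / 2) (hmaps.restrict _ _ _) := by
    refine ⟨by norm_num [← NNReal.coe_lt_coe], LipschitzWith.of_dist_le_mul fun v w => ?_⟩
    rw [Subtype.dist_eq, Subtype.dist_eq, dist_eq_norm, dist_eq_norm]
    have := hLip v w (mem_closedBall_zero_iff.1 v.2) (mem_closedBall_zero_iff.1 w.2)
    simpa using this
  obtain ⟨v, _, hv, _⟩ := hcontr.exists_fixedPoint' Metric.isClosed_closedBall.isComplete hmaps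
    (x := a) (by rw [mem_closedBall_zero_iff]; linarith) (edist_ne_top _ _)
  exact ⟨v, hv.symm⟩

/-! ### Littlewood-Paley decomposition of the heat kernel -/

theorem continuous_conv {K f : E3 → ℂ} (hK : Continuous K) {B : ℝ} (hB : ∀ x, ‖K x‖ ≤ B)
    (hf : Integrable f) : Continuous (conv K f) := by
  unfold conv
  refine continuous_of_dominated (bound := fun y => B * ‖f y‖) ?_ ?_ (hf.norm.const_mul B) ?_
  · intro x
    exact (hK.comp (by fun_prop : Continuous fun y : E3 => x - y)).aestronglyMeasurable.mul hf.1
  · intro x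
    refine ae_of_all _ fun y => ?_
    rw [norm_mul]
    gcongr
    exact hB _
  · refine ae_of_all _ fun y => ?_
    fun_prop

theorem conv_eq_convolution (K f : E3 → ℂ) :
    conv K f = MeasureTheory.convolution f K (ContinuousLinearMap.mul ℂ ℂ) volume := by
  ext x
  simp [conv, MeasureTheory.convolution, mul_comm]

theorem integrable_conv {K f : E3 → ℂ} (hK : Integrable K) (hf : Integrable f) :
    Integrable (conv K f) := by
  rw [conv_eq_convolution]
  exact hf.integrable_convolution _ hK

theorem fourier_conv {K f : E3 → ℂ} (hK : Integrable K) (hf : Integrable f) (ζ : E3) :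
    𝓕 (conv K f) ζ = 𝓕 K ζ * 𝓕 f ζ := by
  rw [conv_eq_convolution, Real.fourier_mul_convolution_eq hf hK, mul_comm]

/-- The heat kernel as a complex-valued function. -/
noncomputable def heatKernelC (t : ℝ) (x : E3) : ℂ := (heatKernel t x : ℂ)

theorem continuous_heatKernelC (t : ℝ) : Continuous (heatKernelC t) :=
  Complex.continuous_ofReal.comp (continuous_heatKernel t)

theorem integrable_heatKernelC {t : ℝ} (ht : 0 < t) : Integrable (heatKernelC t) :=
  (integrable_heatKernel ht).ofReal

theorem norm_heatKernelC_le {t : ℝ} (ht : 0 < t) (x : E3) :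
    ‖heatKernelC t x‖ ≤ (4 * Real.pi * t) ^ (-(3 / 2) : ℝ) := by
  rw [heatKernelC, Complex.norm_real, Real.norm_of_nonneg (heatKernel_nonneg ht x)]
  exact heatKernel_le ht x

theorem enorm_heatKernelC (t : ℝ) (x : E3) : ‖heatKernelC t x‖ₑ = ‖heatKernel t x‖ₑ := by
  rw [heatKernelC, ← ofReal_norm, Complex.norm_real, ofReal_norm]

theorem integrable_fourier_heatKernelC {t : ℝ} (ht : 0 < t) : Integrable (𝓕 (heatKernelC t)) := by
  set b : ℂ := ((1 / (4 * t) : ℝ) : ℂ) with hb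
  have hbre : 0 < b.re := by rw [hb, Complex.ofReal_re]; positivity
  set c : ℂ := (((4 * Real.pi * t) ^ (-(3 / 2) : ℝ) : ℝ) : ℂ) with hc
  have e1 : heatKernelC t = c • fun x : E3 => Complex.exp (-b * ‖x‖ ^ 2) := by
    ext x
    rw [heatKernelC, heatKernel_eq, Pi.smul_apply, smul_eq_mul, hc, hb]
    push_cast
    ring_nf
  have e2 : 𝓕 (heatKernelC t) = c • 𝓕 (fun x : E3 => Complex.exp (-b * ‖x‖ ^ 2)) := by
    rw [e1]
    ext ζ
    simp only [Real.fourier_eq, Pi.smul_apply, smul_comm _ c, integral_smul]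
  rw [e2]
  refine Integrable.smul c ?_
  have e3 : 𝓕 (fun x : E3 => Complex.exp (-b * ‖x‖ ^ 2)) = fun w : E3 =>
      (Real.pi / b) ^ (Module.finrank ℝ E3 / 2 : ℂ) *
        Complex.exp (-((4 * Real.pi ^ 2 * t : ℝ) : ℂ) * ‖w‖ ^ 2) := by
    ext w
    rw [fourier_gaussian_innerProductSpace hbre]
    congr 2
    have : (t : ℂ) ≠ 0 := by exact_mod_cast ht.ne'
    rw [hb]
    push_cast
    field_simp
  rw [e3]
  refine Integrable.const_mul ?_ _
  have := GaussianFourier.integrable_cexp_neg_mul_sq_norm_add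
    (b := ((4 * Real.pi ^ 2 * t : ℝ) : ℂ)) (by rw [Complex.ofReal_re]; positivity) 0 (0 : E3)
  simpa using this

/-! ### Scaling and frequency supports of the dyadic kernels. -/

theorem fourier_dyadic (ψ : E3 → ℂ) (j : ℤ) (ζ : E3) :
    𝓕 (dyadic ψ j) ζ = 𝓕 ψ (((2 : ℝ) ^ (-j)) • ζ) := by
  have h2 : (0 : ℝ) < 2 ^ j := by positivity
  have h := Measure.integral_comp_smul (volume : Measure E3)
    (fun y => Real.fourierChar (-inner ℝ y (((2 : ℝ) ^ (-j)) • ζ)) • ψ y) ((2 : ℝ) ^ j)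
  rw [Real.fourier_eq, Real.fourier_eq]
  have hfr : Module.finrank ℝ E3 = 3 := by simp
  rw [hfr, abs_of_pos (by positivity)] at h
  have e : ∀ x : E3, Real.fourierChar (-inner ℝ x ζ) • dyadic ψ j x =
      ((2 : ℝ) ^ (3 * j)) • (Real.fourierChar (-inner ℝ (((2 : ℝ) ^ j) • x) (((2 : ℝ) ^ (-j)) • ζ)) •
        ψ (((2 : ℝ) ^ j) • x)) := by
    intro x
    rw [real_inner_smul_left, real_inner_smul_right, ← mul_assoc, ← zpow_add₀ two_ne_zero,
      add_neg_cancel, zpow_zero, one_mul, dyadic, smul_comm]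
    congr 1
  simp_rw [e]
  rw [integral_smul, h, smul_smul, ← zpow_natCast, ← zpow_mul, mul_comm j]
  push_cast
  rw [mul_inv_cancel₀ (by positivity), one_smul]

section LittlewoodPaley

variable {ψ : SchwartzMap E3 ℂ}

theorem continuous_dyadic (ψ : SchwartzMap E3 ℂ) (j : ℤ) : Continuous (dyadic ψ j) := by
  unfold dyadic
  have := ψ.continuous
  fun_prop

theorem integral_norm_dyadic (ψ : SchwartzMap E3 ℂ) (j : ℤ) (k : ℕ) :
    ∫ x, ‖x‖ ^ k * ‖dyadic ψ j x‖ = ((2 : ℝ) ^ (-j)) ^ k * ∫ x, ‖x‖ ^ k * ‖ψ x‖ := by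
  have h2 : (0 : ℝ) < 2 ^ j := by positivity
  have h := Measure.integral_comp_smul (volume : Measure E3) (fun y => ‖y‖ ^ k * ‖ψ y‖) ((2 : ℝ) ^ j)
  have hfr : Module.finrank ℝ E3 = 3 := by simp
  rw [hfr, abs_of_pos (by positivity)] at h
  have e : ∀ x : E3, ‖x‖ ^ k * ‖dyadic ψ j x‖ = ((2 : ℝ) ^ (-j)) ^ k * ((2 : ℝ) ^ (3 * j)) *
      (‖((2 : ℝ) ^ j) • x‖ ^ k * ‖ψ (((2 : ℝ) ^ j) • x)‖) := by
    intro x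
    rw [dyadic, norm_mul, Complex.norm_real, Real.norm_of_nonneg (by positivity), norm_smul,
      Real.norm_of_nonneg h2.le, mul_pow, zpow_neg, inv_pow]
    field_simp
  simp_rw [e]
  rw [integral_const_mul, h, smul_eq_mul, ← zpow_natCast ((2 : ℝ) ^ j) 3, ← zpow_mul, mul_comm j]
  push_cast
  field_simp

theorem integrable_norm_dyadic (ψ : SchwartzMap E3 ℂ) (j : ℤ) (k : ℕ) :
    Integrable fun x => ‖x‖ ^ k * ‖dyadic ψ j x‖ := by
  have h2 : (2 : ℝ) ^ j ≠ 0 := by positivity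
  have h := ((ψ.integrable_pow_mul volume k).comp_smul h2).const_mul
    (((2 : ℝ) ^ (-j)) ^ k * ((2 : ℝ) ^ (3 * j)))
  refine h.congr (ae_of_all _ fun x => ?_)
  have h2 : (0 : ℝ) < 2 ^ j := by positivity
  simp only []
  rw [dyadic, norm_mul, Complex.norm_real, Real.norm_of_nonneg (by positivity), norm_smul,
    Real.norm_of_nonneg h2.le, mul_pow, zpow_neg, inv_pow]
  field_simp

theorem integrable_dyadic (ψ : SchwartzMap E3 ℂ) (j : ℤ) : Integrable (dyadic ψ j) := by
  have := integrable_norm_dyadic ψ j 0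
  simp only [pow_zero, one_mul] at this
  exact (integrable_norm_iff (continuous_dyadic ψ j).aestronglyMeasurable).1 this

theorem fourier_eq_fourierHat (f : E3 → ℂ) (ζ : E3) :
    𝓕 f ζ = fourierHat f ((2 * Real.pi) • ζ) := by
  rw [fourierHat, smul_smul, inv_mul_cancel₀ (by positivity), one_smul]

theorem IsLittlewoodPaley.norm_mem_of_fourier_ne_zero (hψ : IsLittlewoodPaley ψ) {j : ℤ} {ζ : E3}
    (h : 𝓕 (dyadic ψ j) ζ ≠ 0) :
    3 / 5 * (2 : ℝ) ^ j ≤ 2 * Real.pi * ‖ζ‖ ∧ 2 * Real.pi * ‖ζ‖ ≤ 5 / 3 * (2 : ℝ) ^ j := by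
  rw [fourier_dyadic, fourier_eq_fourierHat] at h
  have h1 := hψ.support_subset (subset_tsupport _ (Function.mem_support.2 h))
  have h2 : (0 : ℝ) < 2 ^ j := by positivity
  have e : ‖(2 * Real.pi) • (2 : ℝ) ^ (-j) • ζ‖ = 2 * Real.pi * ‖ζ‖ / 2 ^ j := by
    rw [norm_smul, norm_smul, Real.norm_of_nonneg (by positivity),
      Real.norm_of_nonneg (by positivity), zpow_neg]
    field_simp
  rw [mem_ofPred_eq, e, le_div_iff₀ h2, div_le_iff₀ h2] at h1
  exact h1

theorem IsLittlewoodPaley.mem_Icc_of_fourier_ne_zero (hψ : IsLittlewoodPaley ψ) {i j : ℤ} {ζ : E3}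
    (hi : 𝓕 (dyadic ψ i) ζ ≠ 0) (hj : 𝓕 (dyadic ψ j) ζ ≠ 0) :
    i ∈ Finset.Icc (j - 1) (j + 1) := by
  have aux : ∀ {i j : ℤ}, 𝓕 (dyadic ψ i) ζ ≠ 0 → 𝓕 (dyadic ψ j) ζ ≠ 0 → i ≤ j + 1 := by
    intro i j hi hj
    by_contra hlt
    have h1 := (hψ.norm_mem_of_fourier_ne_zero hi).1
    have h2 := (hψ.norm_mem_of_fourier_ne_zero hj).2
    -- Annuli two octaves apart are disjoint, since `4 · 3/5 > 5/3`.
    have h3 : (2 : ℝ) ^ (j + 2) ≤ 2 ^ i := zpow_le_zpow_right₀ (by norm_num) (by omega)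
    rw [zpow_add₀ two_ne_zero] at h3
    have h4 : (0 : ℝ) < 2 ^ j := by positivity
    norm_num at h3
    linarith
  rw [Finset.mem_Icc]
  have := aux hi hj
  have := aux hj hi
  omega

theorem IsLittlewoodPaley.fourier_dyadic_zero (hψ : IsLittlewoodPaley ψ) (j : ℤ) :
    𝓕 (dyadic ψ j) 0 = 0 := by
  by_contra h
  have h1 := (hψ.norm_mem_of_fourier_ne_zero h).1
  have h4 : (0 : ℝ) < 2 ^ j := by positivity
  simp at h1
  linarith

theorem IsLittlewoodPaley.integral_dyadic (hψ : IsLittlewoodPaley ψ) (j : ℤ) :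
    ∫ x, dyadic ψ j x = 0 := by
  have := hψ.fourier_dyadic_zero j
  simpa [Real.fourier_eq] using this

theorem IsLittlewoodPaley.hasSum_fourier (hψ : IsLittlewoodPaley ψ) {ζ : E3} (hζ : ζ ≠ 0) :
    HasSum (fun j : ℤ => 𝓕 (dyadic ψ j) ζ) 1 := by
  have h := hψ.hasSum_one ((2 * Real.pi) • ζ) (smul_ne_zero (by positivity) hζ)
  simpa only [← fourier_eq_fourierHat] using h

/-- Where the `j`-th piece is nonzero only its two neighbours and itself can contribute to the
partition of unity, so these three already sum to one. -/
theorem IsLittlewoodPaley.sum_fourier_mul (hψ : IsLittlewoodPaley ψ) (j : ℤ) (ζ : E3) :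
    (∑ k ∈ Finset.Icc (-1 : ℤ) 1, 𝓕 (dyadic ψ (j + k)) ζ) * 𝓕 (dyadic ψ j) ζ =
      𝓕 (dyadic ψ j) ζ := by
  by_cases h : 𝓕 (dyadic ψ j) ζ = 0
  · rw [h, mul_zero]
  have hζ : ζ ≠ 0 := by
    rintro rfl
    exact h (hψ.fourier_dyadic_zero j)
  have h1 : HasSum (fun i : ℤ => 𝓕 (dyadic ψ i) ζ)
      (∑ i ∈ Finset.Icc (j - 1) (j + 1), 𝓕 (dyadic ψ i) ζ) := by
    refine hasSum_sum_of_ne_finset_zero fun i hi => ?_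
    by_contra h2
    exact hi (hψ.mem_Icc_of_fourier_ne_zero h2 h)
  have h2 : ∑ k ∈ Finset.Icc (-1 : ℤ) 1, 𝓕 (dyadic ψ (j + k)) ζ =
      ∑ i ∈ Finset.Icc (j - 1) (j + 1), 𝓕 (dyadic ψ i) ζ := by
    have := Finset.sum_map (Finset.Icc (-1 : ℤ) 1) (addLeftEmbedding j)
      (fun i => 𝓕 (dyadic ψ i) ζ)
    rw [Finset.map_add_left_Icc] at this
    rw [sub_eq_add_neg, this]
    rfl
  rw [h2, h1.unique (hψ.hasSum_fourier hζ), one_mul]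

theorem exists_norm_fourier_dyadic_le (ψ : SchwartzMap E3 ℂ) :
    ∃ C : ℝ, 0 ≤ C ∧ ∀ (j : ℤ) (ζ : E3), ‖𝓕 (dyadic ψ j) ζ‖ ≤ C := by
  refine ⟨∫ x, ‖ψ x‖, by positivity, fun j ζ => ?_⟩
  rw [fourier_dyadic]
  exact VectorFourier.norm_fourierIntegral_le_integral_norm _ _ _ _ _

/-- At most three indices are active at a given frequency. The bound is uniform in the index set, as
dominated convergence requires. -/
theorem IsLittlewoodPaley.sum_norm_fourier_le (hψ : IsLittlewoodPaley ψ) {C : ℝ} (hC : 0 ≤ C)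
    (h : ∀ (j : ℤ) (ζ : E3), ‖𝓕 (dyadic ψ j) ζ‖ ≤ C) (s : Finset ℤ) (ζ : E3) :
    ∑ j ∈ s, ‖𝓕 (dyadic ψ j) ζ‖ ≤ 3 * C := by
  by_cases h0 : ∀ j ∈ s, 𝓕 (dyadic ψ j) ζ = 0
  · rw [Finset.sum_eq_zero fun j hj => by rw [h0 j hj, norm_zero]]
    positivity
  push Not at h0
  obtain ⟨j₀, -, hj₀⟩ := h0
  calc ∑ j ∈ s, ‖𝓕 (dyadic ψ j) ζ‖ ≤ ∑ j ∈ Finset.Icc (j₀ - 1) (j₀ + 1), ‖𝓕 (dyadic ψ j) ζ‖ := by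
        rw [← Finset.sum_filter_ne_zero]
        refine Finset.sum_le_sum_of_subset_of_nonneg (fun j hj => ?_) fun _ _ _ => norm_nonneg _
        exact hψ.mem_Icc_of_fourier_ne_zero (norm_ne_zero_iff.1 (Finset.mem_filter.1 hj).2) hj₀
    _ ≤ ∑ j ∈ Finset.Icc (j₀ - 1) (j₀ + 1), C := Finset.sum_le_sum fun j _ => h j ζ
    _ = 3 * C := by
        rw [Finset.sum_const, Int.card_Icc, nsmul_eq_mul]
        congr 1
        have : (j₀ + 1 + 1 - (j₀ - 1)).toNat = 3 := by omega
        rw [this]; norm_num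

variable (ψ) in
/-- The sum of the heat kernel localised at the three frequencies `2^{j-1}`, `2^j`, `2^{j+1}`. -/
noncomputable def fatBlock (t : ℝ) (j : ℤ) (x : E3) : ℂ :=
  ∑ k ∈ Finset.Icc (-1 : ℤ) 1, conv (heatKernelC t) (dyadic ψ (j + k)) x

theorem continuous_heatKernelC_conv_dyadic {t : ℝ} (ht : 0 < t) (j : ℤ) :
    Continuous (conv (heatKernelC t) (dyadic ψ j)) :=
  continuous_conv (continuous_heatKernelC t) (norm_heatKernelC_le ht) (integrable_dyadic ψ j)

theorem continuous_fatBlock {t : ℝ} (ht : 0 < t) (j : ℤ) : Continuous (fatBlock ψ t j) :=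
  continuous_finsetSum _ fun k _ => continuous_heatKernelC_conv_dyadic ht (j + k)

theorem integrable_fatBlock {t : ℝ} (ht : 0 < t) (j : ℤ) : Integrable (fatBlock ψ t j) :=
  integrable_finsetSum _ fun k _ =>
    integrable_conv (integrable_heatKernelC ht) (integrable_dyadic ψ (j + k))

theorem fourier_fatBlock {t : ℝ} (ht : 0 < t) (j : ℤ) (ζ : E3) :
    𝓕 (fatBlock ψ t j) ζ =
      𝓕 (heatKernelC t) ζ * ∑ k ∈ Finset.Icc (-1 : ℤ) 1, 𝓕 (dyadic ψ (j + k)) ζ := by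
  rw [Finset.mul_sum]
  simp_rw [← fourier_conv (integrable_heatKernelC ht) (integrable_dyadic ψ _)]
  simp_rw [Real.fourier_eq]
  rw [← integral_finsetSum]
  · simp_rw [fatBlock, Finset.smul_sum]
  · intro k _
    exact (Real.fourierIntegral_convergent_iff ζ).2
      (integrable_conv (integrable_heatKernelC ht) (integrable_dyadic ψ (j + k)))

/-- Widening the localisation of the heat kernel leaves a separate factor `ψ_j`, which is later
convolved with the datum to give its Besov block. -/
theorem IsLittlewoodPaley.fourier_conv_fatBlock (hψ : IsLittlewoodPaley ψ) {t : ℝ} (ht : 0 < t)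
    (j : ℤ) (ζ : E3) :
    𝓕 (conv (fatBlock ψ t j) (dyadic ψ j)) ζ = 𝓕 (heatKernelC t) ζ * 𝓕 (dyadic ψ j) ζ := by
  rw [fourier_conv (integrable_fatBlock ht j) (integrable_dyadic ψ j), fourier_fatBlock ht,
    mul_assoc, hψ.sum_fourier_mul]

theorem exists_norm_fatBlock_le {t : ℝ} (ht : 0 < t) (j : ℤ) :
    ∃ B : ℝ, ∀ x, ‖fatBlock ψ t j x‖ ≤ B := by
  refine ⟨∑ k ∈ Finset.Icc (-1 : ℤ) 1, ∫ y, (4 * Real.pi * t) ^ (-(3 / 2) : ℝ) *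
    ‖dyadic ψ (j + k) y‖, fun x => ?_⟩
  refine norm_sum_le_of_le _ fun k _ => ?_
  refine norm_integral_le_of_norm_le ((integrable_dyadic ψ (j + k)).norm.const_mul _)
    (ae_of_all _ fun y => ?_)
  rw [norm_mul]
  gcongr
  exact norm_heatKernelC_le ht _

/-- The heat kernel is the sum of its Littlewood-Paley pieces. -/
theorem IsLittlewoodPaley.hasSum_heatKernelC (hψ : IsLittlewoodPaley ψ) {t : ℝ} (ht : 0 < t)
    (x : E3) :
    HasSum (fun j : ℤ => conv (fatBlock ψ t j) (dyadic ψ j) x) (heatKernelC t x) := by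
  obtain ⟨C, hC, hbd⟩ := exists_norm_fourier_dyadic_le ψ
  have hGi := integrable_fourier_heatKernelC ht
  have hcont : ∀ j, Continuous (𝓕 (dyadic ψ j)) := fun j =>
    VectorFourier.fourierIntegral_continuous Real.continuous_fourierChar
      (by exact continuous_inner) (integrable_dyadic ψ j)
  have hprod : ∀ j, Integrable fun ζ => 𝓕 (heatKernelC t) ζ * 𝓕 (dyadic ψ j) ζ := fun j =>
    hGi.mul_bdd (c := C) (hcont j).aestronglyMeasurable (ae_of_all _ (hbd j))
  have hpiece : ∀ j, conv (fatBlock ψ t j) (dyadic ψ j) x =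
      ∫ ζ, Real.fourierChar (inner ℝ ζ x) • (𝓕 (heatKernelC t) ζ * 𝓕 (dyadic ψ j) ζ) := by
    intro j
    obtain ⟨B, hB⟩ := exists_norm_fatBlock_le (ψ := ψ) ht j
    have e : 𝓕 (conv (fatBlock ψ t j) (dyadic ψ j)) =
        fun ζ => 𝓕 (heatKernelC t) ζ * 𝓕 (dyadic ψ j) ζ :=
      funext (hψ.fourier_conv_fatBlock ht j)
    have := (continuous_conv (continuous_fatBlock ht j) hB
      (integrable_dyadic ψ j)).fourierInv_fourier_eq
      (integrable_conv (integrable_fatBlock ht j) (integrable_dyadic ψ j)) (by rw [e]; exact hprod j)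
    rw [← this, e, Real.fourierInv_eq]
  have hG : heatKernelC t x = ∫ ζ, Real.fourierChar (inner ℝ ζ x) • 𝓕 (heatKernelC t) ζ := by
    have := (continuous_heatKernelC t).fourierInv_fourier_eq (integrable_heatKernelC ht) hGi
    rw [← Real.fourierInv_eq, this]
  simp_rw [hpiece, hG]
  have hprod' : ∀ j, Integrable fun ζ => Real.fourierChar (inner ℝ ζ x) •
      (𝓕 (heatKernelC t) ζ * 𝓕 (dyadic ψ j) ζ) := by
    intro j
    have := (Real.fourierIntegral_convergent_iff (-x)).2 (hprod j)
    simpa using this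
  rw [HasSum]
  simp_rw [← integral_finsetSum _ fun j _ => hprod' j]
  refine tendsto_integral_filter_of_dominated_convergence
    (fun ζ => ‖𝓕 (heatKernelC t) ζ‖ * (3 * C)) ?_ ?_ (hGi.norm.mul_const _) ?_
  · exact .of_forall fun s => (integrable_finsetSum _ fun j _ => hprod' j).1
  · refine .of_forall fun s => ae_of_all _ fun ζ => ?_
    refine (norm_sum_le _ _).trans ?_
    simp_rw [Circle.norm_smul, norm_mul, ← Finset.mul_sum]
    gcongr
    exact hψ.sum_norm_fourier_le hC hbd s ζ
  -- The partition of unity fails only at the origin, a null set.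
  · have h0 : ∀ᵐ ζ : E3, ζ ≠ 0 := by
      rw [ae_iff]; simp
    filter_upwards [h0] with ζ hζ
    have h1 := ((hψ.hasSum_fourier hζ).mul_left (𝓕 (heatKernelC t) ζ)).const_smul
      (Real.fourierChar (inner ℝ ζ x))
    rw [mul_one] at h1
    exact h1

end LittlewoodPaley

section

/-! ### Bounds for the Littlewood-Paley pieces of the heat kernel -/

/-- The moments of the modulus of a Schwartz function. -/
noncomputable def moment (ψ : SchwartzMap E3 ℂ) (k : ℕ) : ℝ := ∫ x, ‖x‖ ^ k * ‖ψ x‖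

theorem moment_nonneg (ψ : SchwartzMap E3 ℂ) (k : ℕ) : 0 ≤ moment ψ k :=
  integral_nonneg fun _ => by positivity

variable {ψ : SchwartzMap E3 ℂ}

theorem lintegral_enorm_dyadic (ψ : SchwartzMap E3 ℂ) (j : ℤ) :
    ∫⁻ x, ‖dyadic ψ j x‖ₑ = ENNReal.ofReal (moment ψ 0) := by
  have h := integral_norm_dyadic ψ j 0
  have hi := integrable_norm_dyadic ψ j 0
  simp only [pow_zero, one_mul] at h hi
  simp_rw [← ofReal_norm]
  rw [← ofReal_integral_eq_lintegral_ofReal hi (ae_of_all _ fun _ => norm_nonneg _), h]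
  simp [moment]

theorem exists_enorm_dyadic_le (ψ : SchwartzMap E3 ℂ) :
    ∃ B : ℝ, 0 ≤ B ∧ ∀ (j : ℤ) (x : E3), ‖dyadic ψ j x‖ₑ ≤ ENNReal.ofReal (B * 2 ^ (3 * j)) := by
  refine ⟨‖ψ.toBoundedContinuousFunction‖, norm_nonneg _, fun j x => ?_⟩
  rw [← ofReal_norm]
  apply ENNReal.ofReal_le_ofReal
  rw [dyadic, norm_mul, Complex.norm_real, Real.norm_of_nonneg (by positivity), mul_comm]
  gcongr
  exact ψ.toBoundedContinuousFunction.norm_coe_le_norm _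

theorem measurable_dyadic (ψ : SchwartzMap E3 ℂ) (j : ℤ) : Measurable (dyadic ψ j) :=
  (continuous_dyadic ψ j).measurable

theorem isAdmissible_dyadic (ψ : SchwartzMap E3 ℂ) (j : ℤ) : IsAdmissible (dyadic ψ j) where
  measurable := measurable_dyadic ψ j
  lintegral_ne_top := by rw [lintegral_enorm_dyadic]; exact ENNReal.ofReal_ne_top
  bounded := by
    obtain ⟨B, -, hB⟩ := exists_enorm_dyadic_le ψ
    exact ⟨_, ENNReal.ofReal_ne_top, hB j⟩

theorem lintegral_enorm_heatKernelC_conv_dyadic_le {t : ℝ} (ht : 0 < t) (j : ℤ) :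
    ∫⁻ x, ‖conv (heatKernelC t) (dyadic ψ j) x‖ₑ ≤ ENNReal.ofReal (moment ψ 0) := by
  refine (lintegral_mono (enorm_conv_le _ _)).trans_eq ?_
  rw [lintegral_lconv (continuous_heatKernelC t).measurable.enorm (measurable_dyadic ψ j).enorm]
  simp_rw [enorm_heatKernelC]
  rw [lintegral_enorm_heatKernel ht, one_mul, lintegral_enorm_dyadic]

/-- The vanishing mean of `ψ_j` allows `G_t(x)` to be subtracted from `G_t(x - y)`; the translation
modulus then meets the first two moments of `ψ_j`, of sizes `2^{-j}` and `2^{-2j}`. -/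
theorem IsLittlewoodPaley.lintegral_enorm_heatKernelC_conv_dyadic_le_of_cancel
    (hψ : IsLittlewoodPaley ψ) {t : ℝ} (ht : 0 < t) (j : ℤ) :
    ∫⁻ x, ‖conv (heatKernelC t) (dyadic ψ j) x‖ₑ ≤
      ENNReal.ofReal (6 * ((2 ^ j * √t)⁻¹ * moment ψ 1 + (2 ^ j * √t)⁻¹ ^ 2 * moment ψ 2)) := by
  have hst : 0 < √t := Real.sqrt_pos.2 ht
  have hpt : ∀ x, ‖conv (heatKernelC t) (dyadic ψ j) x‖ₑ ≤
      ∫⁻ y, ‖heatKernel t (x - y) - heatKernel t x‖ₑ * ‖dyadic ψ j y‖ₑ := by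
    intro x
    have hint : Integrable fun y => heatKernelC t (x - y) * dyadic ψ j y := by
      refine (integrable_dyadic ψ j).bdd_mul (c := (4 * Real.pi * t) ^ (-(3 / 2) : ℝ)) ?_ ?_
      · exact ((continuous_heatKernelC t).comp (by fun_prop)).aestronglyMeasurable
      · exact ae_of_all _ fun y => norm_heatKernelC_le ht _
    have e : conv (heatKernelC t) (dyadic ψ j) x =
        ∫ y, (heatKernelC t (x - y) - heatKernelC t x) * dyadic ψ j y := by
      simp_rw [sub_mul]
      rw [integral_sub hint ((integrable_dyadic ψ j).const_mul _), integral_const_mul,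
        hψ.integral_dyadic, mul_zero, sub_zero]
      rfl
    rw [e]
    refine (enorm_integral_le_lintegral_enorm _).trans_eq ?_
    congr 1
    ext y
    rw [enorm_mul]
    congr 1
    rw [heatKernelC, heatKernelC, ← Complex.ofReal_sub, ← ofReal_norm, Complex.norm_real,
      ofReal_norm]
  refine (lintegral_mono hpt).trans ?_
  have hm1 : Measurable fun z : E3 × E3 => ‖heatKernel t (z.1 - z.2) - heatKernel t z.1‖ₑ :=
    (((continuous_heatKernel t).comp (by fun_prop)).sub
      ((continuous_heatKernel t).comp (by fun_prop))).measurable.enorm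
  have hm2 : ∀ y, Measurable fun x : E3 => ‖heatKernel t (x - y) - heatKernel t x‖ₑ := fun y =>
    (((continuous_heatKernel t).comp (by fun_prop)).sub (continuous_heatKernel t)).measurable.enorm
  have hm3 := (measurable_dyadic ψ j).enorm
  rw [lintegral_lintegral_swap (hm1.mul (hm3.comp measurable_snd)).aemeasurable]
  have hstep : ∀ y, ∫⁻ x, ‖heatKernel t (x - y) - heatKernel t x‖ₑ * ‖dyadic ψ j y‖ₑ ≤
      ENNReal.ofReal (6 / √t * (‖y‖ ^ 1 * ‖dyadic ψ j y‖) +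
        6 / √t ^ 2 * (‖y‖ ^ 2 * ‖dyadic ψ j y‖)) := by
    intro y
    rw [lintegral_mul_const _ (hm2 y)]
    refine (mul_le_mul' (lintegral_heatKernel_translate_sub_le ht y) le_rfl).trans_eq ?_
    rw [← ofReal_norm (dyadic ψ j y), ← ENNReal.ofReal_mul (by positivity)]
    congr 1
    field_simp
  refine (lintegral_mono hstep).trans_eq ?_
  have i1 := (integrable_norm_dyadic ψ j 1).const_mul (6 / √t)
  have i2 := (integrable_norm_dyadic ψ j 2).const_mul (6 / √t ^ 2)
  have i3 : Integrable fun y : E3 => 6 / √t * (‖y‖ ^ 1 * ‖dyadic ψ j y‖) +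
      6 / √t ^ 2 * (‖y‖ ^ 2 * ‖dyadic ψ j y‖) := i1.add i2
  rw [← ofReal_integral_eq_lintegral_ofReal i3 (ae_of_all _ fun y => by
    simp only [Pi.zero_apply]; positivity), integral_add i1 i2, integral_const_mul,
    integral_const_mul, integral_norm_dyadic, integral_norm_dyadic, zpow_neg]
  congr 1
  simp only [moment]
  field_simp

/-- Low frequencies use only the mass of the kernels, high frequencies the cancellation. The final
factor `6` is three neighbours times the loss `2` from the lowest of them. -/
theorem IsLittlewoodPaley.exists_lintegral_enorm_fatBlock_le (hψ : IsLittlewoodPaley ψ) :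
    ∃ C : ℝ, 0 ≤ C ∧ ∀ (t : ℝ), 0 < t → ∀ j : ℤ,
      ∫⁻ x, ‖fatBlock ψ t j x‖ₑ ≤ ENNReal.ofReal (C * min 1 (2 ^ j * √t)⁻¹) := by
  have m0 := moment_nonneg ψ 0
  have m1 := moment_nonneg ψ 1
  have m2 := moment_nonneg ψ 2
  set D := moment ψ 0 + 6 * moment ψ 1 + 6 * moment ψ 2 with hD
  have hD0 : 0 ≤ D := by positivity
  have hsingle : ∀ t : ℝ, 0 < t → ∀ j : ℤ, ∫⁻ x, ‖conv (heatKernelC t) (dyadic ψ j) x‖ₑ ≤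
      ENNReal.ofReal (D * min 1 (2 ^ j * √t)⁻¹) := by
    intro t ht j
    have hst : 0 < √t := Real.sqrt_pos.2 ht
    have hl : (0 : ℝ) < (2 ^ j * √t)⁻¹ := by positivity
    rcases le_total 1 (2 ^ j * √t)⁻¹ with h | h
    · refine (lintegral_enorm_heatKernelC_conv_dyadic_le ht j).trans (ENNReal.ofReal_le_ofReal ?_)
      rw [min_eq_left h]; linarith
    · refine (hψ.lintegral_enorm_heatKernelC_conv_dyadic_le_of_cancel ht j).trans
        (ENNReal.ofReal_le_ofReal ?_)
      rw [min_eq_right h]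
      set l := (2 ^ j * √t)⁻¹
      have h2 : l ^ 2 ≤ l := by nlinarith
      have h3 : l ^ 2 * moment ψ 2 ≤ l * moment ψ 2 := by gcongr
      have h4 : 0 ≤ moment ψ 0 * l := by positivity
      rw [hD]
      linarith
  refine ⟨6 * D, by positivity, fun t ht j => ?_⟩
  have hst : 0 < √t := Real.sqrt_pos.2 ht
  have hmeas : ∀ k : ℤ, Measurable fun x => ‖conv (heatKernelC t) (dyadic ψ (j + k)) x‖ₑ :=
    fun k => (continuous_heatKernelC_conv_dyadic ht (j + k)).measurable.enorm
  calc ∫⁻ x, ‖fatBlock ψ t j x‖ₑ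
      ≤ ∫⁻ x, ∑ k ∈ Finset.Icc (-1 : ℤ) 1, ‖conv (heatKernelC t) (dyadic ψ (j + k)) x‖ₑ :=
        lintegral_mono fun x => enorm_sum_le _ _
    _ = ∑ k ∈ Finset.Icc (-1 : ℤ) 1, ∫⁻ x, ‖conv (heatKernelC t) (dyadic ψ (j + k)) x‖ₑ :=
        lintegral_finsetSum _ fun k _ => hmeas k
    _ ≤ ∑ k ∈ Finset.Icc (-1 : ℤ) 1, ENNReal.ofReal (2 * D * min 1 (2 ^ j * √t)⁻¹) := by
        refine Finset.sum_le_sum fun k hk => (hsingle t ht (j + k)).trans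
          (ENNReal.ofReal_le_ofReal ?_)
        have h1 : (2 : ℝ) ^ (-1 : ℤ) ≤ 2 ^ k :=
          zpow_le_zpow_right₀ one_le_two (Finset.mem_Icc.1 hk).1
        have h2 : ((2 : ℝ) ^ (j + k) * √t)⁻¹ ≤ 2 * (2 ^ j * √t)⁻¹ := by
          rw [zpow_add₀ two_ne_zero, mul_right_comm, mul_inv, mul_comm]
          gcongr
          rw [inv_le_comm₀ (by positivity) two_pos]
          simpa using h1
        have h3 : min 1 ((2 : ℝ) ^ (j + k) * √t)⁻¹ ≤ 2 * min 1 (2 ^ j * √t)⁻¹ := by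
          rw [mul_min_of_nonneg _ _ zero_le_two]
          exact min_le_min (by norm_num) h2
        calc _ ≤ D * (2 * min 1 (2 ^ j * √t)⁻¹) := by gcongr
          _ = _ := by ring
    _ = _ := by
        rw [Finset.sum_const, ← ENNReal.ofReal_nsmul]
        congr 1
        simp
        ring

theorem enorm_fatBlock_le {t : ℝ} (ht : 0 < t) (j : ℤ) (x : E3) :
    ‖fatBlock ψ t j x‖ₑ ≤
      3 * (ENNReal.ofReal ((4 * Real.pi * t) ^ (-(3 / 2) : ℝ)) * ENNReal.ofReal (moment ψ 0)) := by
  refine (enorm_sum_le _ _).trans ?_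
  calc _ ≤ ∑ k ∈ Finset.Icc (-1 : ℤ) 1,
        ENNReal.ofReal ((4 * Real.pi * t) ^ (-(3 / 2) : ℝ)) * ENNReal.ofReal (moment ψ 0) := by
        refine Finset.sum_le_sum fun k _ => (enorm_conv_le _ _ x).trans ?_
        rw [← lintegral_enorm_dyadic ψ (j + k)]
        refine lconv_le_of_le (measurable_dyadic ψ _).enorm (fun y => ?_) x
        rw [enorm_heatKernelC]
        exact enorm_heatKernel_le ht y
    _ = _ := by simp

theorem IsLittlewoodPaley.isAdmissible_fatBlock (hψ : IsLittlewoodPaley ψ) {t : ℝ} (ht : 0 < t)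
    (j : ℤ) : IsAdmissible (fatBlock ψ t j) where
  measurable := (continuous_fatBlock ht j).measurable
  lintegral_ne_top := by
    obtain ⟨C, -, hC⟩ := hψ.exists_lintegral_enorm_fatBlock_le
    exact ((hC t ht j).trans_lt ENNReal.ofReal_lt_top).ne
  bounded := ⟨_, ENNReal.mul_ne_top ENNReal.ofNat_ne_top
    (ENNReal.mul_ne_top ENNReal.ofReal_ne_top ENNReal.ofReal_ne_top), enorm_fatBlock_le ht j⟩

/-- Mass and height interpolate to the `L^{3/2}` norm of the kernel, dual to `L³`. -/
theorem lconv_le_of_bounds {k f : E3 → ℝ≥0∞} (hk : Measurable k) (hf : Measurable f) {a b : ℝ}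
    (ha : ∫⁻ x, k x ≤ ENNReal.ofReal a) (ha0 : 0 ≤ a) (hb : ∀ x, k x ≤ ENNReal.ofReal b)
    (hb0 : 0 ≤ b) (x : E3) :
    lconv k f x ≤ ENNReal.ofReal (a ^ (2 / 3 : ℝ) * b ^ (1 / 3 : ℝ)) *
      (∫⁻ y, f y ^ (3 : ℝ)) ^ (1 / 3 : ℝ) := by
  refine (lconv_le_Lq hk hf (q := 3) (by norm_num) hb x).trans ?_
  gcongr
  rw [ENNReal.ofReal_mul (by positivity), ← ENNReal.ofReal_rpow_of_nonneg ha0 (by norm_num),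
    ← ENNReal.ofReal_rpow_of_nonneg hb0 (by norm_num)]
  rw [show (1 : ℝ) - 1 / 3 = 2 / 3 by norm_num]
  gcongr

theorem pow_rpow_comm' {x : ℝ} (hx : 0 ≤ x) (n : ℕ) (y : ℝ) : (x ^ n) ^ y = (x ^ y) ^ n := by
  rw [← Real.rpow_natCast, ← Real.rpow_mul hx, mul_comm, Real.rpow_mul hx, Real.rpow_natCast]

/-- The Littlewood-Paley pieces of the heat kernel act summably on `L³`. -/
theorem IsLittlewoodPaley.exists_summable_lconv_le (hψ : IsLittlewoodPaley ψ) {t : ℝ}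
    (ht : 0 < t) : ∃ w : ℤ → ℝ, Summable w ∧ (∀ j, 0 ≤ w j) ∧
      ∀ (f : E3 → ℝ≥0∞), Measurable f → ∀ (j : ℤ) (x : E3),
        lconv (fun y => ‖conv (fatBlock ψ t j) (dyadic ψ j) y‖ₑ) f x ≤
          ENNReal.ofReal (w j) * (∫⁻ y, f y ^ (3 : ℝ)) ^ (1 / 3 : ℝ) := by
  obtain ⟨C, hC0, hC⟩ := hψ.exists_lintegral_enorm_fatBlock_le
  obtain ⟨B, hB0, hB⟩ := exists_enorm_dyadic_le ψ
  have m0 := moment_nonneg ψ 0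
  have hst : 0 < √t := Real.sqrt_pos.2 ht
  set S : ℝ := 3 * ((4 * Real.pi * t) ^ (-(3 / 2) : ℝ) * moment ψ 0) * moment ψ 0 with hS
  have hS0 : 0 ≤ S := by positivity
  -- `a j` bounds the mass of the `j`-th piece and `b j` its height.
  set a : ℤ → ℝ := fun j => C * min 1 (2 ^ j * √t)⁻¹ * moment ψ 0 with ha
  set b : ℤ → ℝ := fun j => min S (B * 2 ^ (3 * j) * C) with hb
  have hmin : ∀ j : ℤ, 0 ≤ min 1 ((2 : ℝ) ^ j * √t)⁻¹ := fun j => le_min zero_le_one (by positivity)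
  have ha0 : ∀ j, 0 ≤ a j := fun j => mul_nonneg (mul_nonneg hC0 (hmin j)) m0
  have hb0 : ∀ j, 0 ≤ b j := fun j => le_min hS0 (by positivity)
  have hHm : ∀ j, Measurable fun x => ‖fatBlock ψ t j x‖ₑ := fun j =>
    (continuous_fatBlock ht j).measurable.enorm
  have hdm : ∀ j, Measurable fun x => ‖dyadic ψ j x‖ₑ := fun j => (measurable_dyadic ψ j).enorm
  have hla : ∀ j, ∫⁻ x, ‖conv (fatBlock ψ t j) (dyadic ψ j) x‖ₑ ≤ ENNReal.ofReal (a j) := by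
    intro j
    refine (lintegral_mono (enorm_conv_le _ _)).trans ?_
    rw [lintegral_lconv (hHm j) (hdm j), lintegral_enorm_dyadic, ha,
      ENNReal.ofReal_mul (mul_nonneg hC0 (hmin j))]
    gcongr
    exact hC t ht j
  have hlb : ∀ j x, ‖conv (fatBlock ψ t j) (dyadic ψ j) x‖ₑ ≤ ENNReal.ofReal (b j) := by
    intro j x
    refine (enorm_conv_le _ _ x).trans ?_
    rw [hb, ENNReal.ofReal_min]
    refine le_min ?_ ?_
    · refine (lconv_le_of_le (hdm j) (enorm_fatBlock_le ht j) x).trans_eq ?_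
      rw [lintegral_enorm_dyadic, hS, ENNReal.ofReal_mul (by positivity),
        ENNReal.ofReal_mul (by positivity), ENNReal.ofReal_mul (by positivity)]
      simp
    · rw [lconv_comm, ENNReal.ofReal_mul (by positivity)]
      refine (lconv_le_of_le (hHm j) (hB j) x).trans ?_
      gcongr
      refine (hC t ht j).trans (ENNReal.ofReal_le_ofReal ?_)
      exact mul_le_of_le_one_right hC0 (min_le_left _ _)
  have hLm : ∀ j, Measurable fun x => ‖conv (fatBlock ψ t j) (dyadic ψ j) x‖ₑ := fun j =>
    (stronglyMeasurable_conv (continuous_fatBlock ht j).measurable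
      (continuous_dyadic ψ j).stronglyMeasurable).measurable.enorm
  refine ⟨fun j => a j ^ (2 / 3 : ℝ) * b j ^ (1 / 3 : ℝ), ?_, fun j => ?_, fun f hf j x =>
    lconv_le_of_bounds (hLm j) hf (hla j) (ha0 j) (hlb j) (hb0 j) x⟩
  -- For `j → ∞` the mass supplies the decay `2^{-2j/3}`; for `j → -∞` the height `O(2^{3j})`
  -- supplies `2^{j}`.
  · apply Summable.of_nat_of_neg
    · have hr : ((1 / 2 : ℝ) ^ (2 / 3 : ℝ)) < 1 :=
        Real.rpow_lt_one (by norm_num) (by norm_num) (by norm_num)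
      refine Summable.of_nonneg_of_le (fun n => mul_nonneg (Real.rpow_nonneg (ha0 _) _)
        (Real.rpow_nonneg (hb0 _) _)) (fun n => ?_) ((summable_geometric_of_lt_one
          (by positivity) hr).mul_left ((C * (√t)⁻¹ * moment ψ 0) ^ (2 / 3 : ℝ) * S ^ (1 / 3 : ℝ)))
      have h1 : a n ≤ (C * (√t)⁻¹ * moment ψ 0) * (1 / 2) ^ n := by
        have : a n ≤ C * (2 ^ (n : ℤ) * √t)⁻¹ * moment ψ 0 := by
          simp only [ha]
          gcongr
          exact min_le_right _ _
        refine this.trans_eq ?_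
        rw [zpow_natCast, one_div, inv_pow, mul_inv]
        ring
      have h2 : a n ^ (2 / 3 : ℝ) ≤
          (C * (√t)⁻¹ * moment ψ 0) ^ (2 / 3 : ℝ) * ((1 / 2) ^ (2 / 3 : ℝ)) ^ n := by
        rw [← pow_rpow_comm' (by norm_num), ← Real.mul_rpow (by positivity) (by positivity)]
        exact Real.rpow_le_rpow (ha0 _) h1 (by norm_num)
      have h3 : b n ^ (1 / 3 : ℝ) ≤ S ^ (1 / 3 : ℝ) :=
        Real.rpow_le_rpow (hb0 _) (min_le_left _ _) (by norm_num)
      calc _ ≤ ((C * (√t)⁻¹ * moment ψ 0) ^ (2 / 3 : ℝ) * ((1 / 2) ^ (2 / 3 : ℝ)) ^ n) *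
            S ^ (1 / 3 : ℝ) := mul_le_mul h2 h3 (Real.rpow_nonneg (hb0 _) _) (by positivity)
        _ = _ := by ring
    · have hr : ((1 / 8 : ℝ) ^ (1 / 3 : ℝ)) < 1 :=
        Real.rpow_lt_one (by norm_num) (by norm_num) (by norm_num)
      refine Summable.of_nonneg_of_le (fun n => mul_nonneg (Real.rpow_nonneg (ha0 _) _)
        (Real.rpow_nonneg (hb0 _) _)) (fun n => ?_) ((summable_geometric_of_lt_one
          (by positivity) hr).mul_left ((C * moment ψ 0) ^ (2 / 3 : ℝ) * (B * C) ^ (1 / 3 : ℝ)))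
      have h1 : a (-n) ^ (2 / 3 : ℝ) ≤ (C * moment ψ 0) ^ (2 / 3 : ℝ) := by
        refine Real.rpow_le_rpow (ha0 _) ?_ (by norm_num)
        simp only [ha]
        gcongr
        exact mul_le_of_le_one_right hC0 (min_le_left _ _)
      have h2 : b (-n) ≤ (B * C) * (1 / 8) ^ n := by
        refine (min_le_right _ _).trans_eq ?_
        rw [show (3 * -(n : ℤ)) = -((3 * n : ℕ) : ℤ) by push_cast; ring, zpow_neg, zpow_natCast,
          pow_mul, one_div, inv_pow]
        norm_num
        ring
      have h3 : b (-n) ^ (1 / 3 : ℝ) ≤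
          (B * C) ^ (1 / 3 : ℝ) * ((1 / 8) ^ (1 / 3 : ℝ)) ^ n := by
        rw [← pow_rpow_comm' (by norm_num), ← Real.mul_rpow (by positivity) (by positivity)]
        exact Real.rpow_le_rpow (hb0 _) h2 (by norm_num)
      calc _ ≤ (C * moment ψ 0) ^ (2 / 3 : ℝ) *
            ((B * C) ^ (1 / 3 : ℝ) * ((1 / 8) ^ (1 / 3 : ℝ)) ^ n) :=
            mul_le_mul h1 h3 (Real.rpow_nonneg (hb0 _) _) (by positivity)
        _ = _ := by ring
  · exact mul_nonneg (Real.rpow_nonneg (ha0 _) _) (Real.rpow_nonneg (hb0 _) _)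

/-! ### The heat semigroup and the Besov norm -/

theorem conv_conv {H φ u : E3 → ℂ} (hH : IsAdmissible H) (hφ : IsAdmissible φ)
    (hu : StronglyMeasurable u) (hu3 : MemLp u 3 volume) (x : E3) :
    conv (conv H φ) u x = conv H (conv φ u) x := by
  have hHm := hH.measurable
  have hφm := hφ.measurable
  have hum := hu.measurable
  have e1 : ∀ y, conv H φ (x - y) = ∫ w, H (x - w) * φ (w - y) := by
    intro y
    rw [conv, ← integral_sub_right_eq_self _ y]
    congr 1
    ext w
    congr 2
    abel
  have hint : Integrable (Function.uncurry fun y w : E3 => H (x - w) * φ (w - y) * u y)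
      (volume.prod volume) := by
    have hm : Measurable (Function.uncurry fun y w : E3 => H (x - w) * φ (w - y) * u y) := by
      unfold Function.uncurry
      fun_prop
    refine ⟨hm.aestronglyMeasurable, ?_⟩
    rw [HasFiniteIntegral, lintegral_prod_symm _ hm.enorm.aemeasurable]
    have e : ∀ w, ∫⁻ y, ‖H (x - w) * φ (w - y) * u y‖ₑ =
        ‖H (x - w)‖ₑ * lconv (fun y => ‖φ y‖ₑ) (fun y => ‖u y‖ₑ) w := by
      intro w
      simp_rw [enorm_mul, mul_assoc]
      rw [lintegral_const_mul _ (by fun_prop)]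
      rfl
    simp only [Function.uncurry_apply_pair]
    simp_rw [e]
    obtain ⟨B, hB, hHB⟩ := hH.bounded
    obtain ⟨B', hB', hφB⟩ := hφ.bounded
    have hM := measurable_lconv hφm.enorm hum.enorm
    have h1 := lconv_le_Lq hHm.enorm hM (q := 3) (by norm_num) hHB x
    refine lt_of_le_of_lt h1 (ENNReal.mul_lt_top (ENNReal.mul_lt_top ?_ ?_) ?_)
    · exact ENNReal.rpow_lt_top_of_nonneg (by norm_num) hH.lintegral_ne_top
    · exact ENNReal.rpow_lt_top_of_nonneg (by norm_num) hB
    · refine (lintegral_lconv_rpow_le hφm.enorm hum.enorm (q := 3) (r := 3) (by norm_num) le_rfl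
        hφB).trans_lt (ENNReal.mul_lt_top (ENNReal.mul_lt_top ?_ ?_) ?_)
      · exact ENNReal.rpow_lt_top_of_nonneg (by norm_num) hφ.lintegral_ne_top
      · exact ENNReal.rpow_lt_top_of_nonneg (by norm_num) hB'
      · have := hu3.2
        rw [eLpNorm_eq_lintegral_rpow_enorm_toReal (by norm_num) (by norm_num)] at this
        simpa using this
  calc conv (conv H φ) u x = ∫ y, ∫ w, H (x - w) * φ (w - y) * u y := by
        rw [conv]
        congr 1
        ext y
        rw [e1, integral_mul_const]
    _ = ∫ w, ∫ y, H (x - w) * φ (w - y) * u y := integral_integral_swap hint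
    _ = _ := by
        rw [conv]
        congr 1
        ext w
        simp_rw [mul_assoc]
        rw [integral_const_mul]
        rfl

/-- Here `u ∈ L³` is essential: it makes the pieces absolutely summable at every point, so no
low-frequency part is lost and the sum passes under the convolution. -/
theorem IsLittlewoodPaley.hasSum_conv (hψ : IsLittlewoodPaley ψ) {t : ℝ} (ht : 0 < t)
    {u : E3 → ℂ} (hu : StronglyMeasurable u) (hu3 : MemLp u 3 volume) (x : E3) :
    HasSum (fun j : ℤ => conv (fatBlock ψ t j) (conv (dyadic ψ j) u) x)
      (conv (heatKernelC t) u x) := by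
  obtain ⟨w, hw, hw0, hwb⟩ := hψ.exists_summable_lconv_le ht
  have hN : (∫⁻ y, ‖u y‖ₑ ^ (3 : ℝ)) ^ (1 / 3 : ℝ) ≠ ∞ := by
    have := hu3.2
    rw [eLpNorm_eq_lintegral_rpow_enorm_toReal (by norm_num) (by norm_num)] at this
    simpa using this.ne
  have hLm : ∀ j, Measurable (conv (fatBlock ψ t j) (dyadic ψ j)) := fun j =>
    (stronglyMeasurable_conv (continuous_fatBlock ht j).measurable
      (continuous_dyadic ψ j).stronglyMeasurable).measurable
  have hlt : ∀ j, ENNReal.ofReal (w j) * (∫⁻ y, ‖u y‖ₑ ^ (3 : ℝ)) ^ (1 / 3 : ℝ) < ∞ := fun j =>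
    ENNReal.mul_lt_top ENNReal.ofReal_lt_top hN.lt_top
  have hint : ∀ j, Integrable fun y => conv (fatBlock ψ t j) (dyadic ψ j) (x - y) * u y := fun j =>
    integrable_conv_of_lconv_lt_top (hLm j) hu
      ((hwb _ hu.enorm j x).trans_lt (hlt j))
  have hsum : Summable fun j =>
      ∫ y, ‖conv (fatBlock ψ t j) (dyadic ψ j) (x - y) * u y‖ := by
    refine Summable.of_nonneg_of_le (fun j => integral_nonneg fun _ => norm_nonneg _) (fun j => ?_)
      (hw.mul_right ((∫⁻ y, ‖u y‖ₑ ^ (3 : ℝ)) ^ (1 / 3 : ℝ)).toReal)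
    rw [integral_norm_eq_lintegral_enorm (hint j).1, ← ENNReal.toReal_ofReal (hw0 j),
      ← ENNReal.toReal_mul]
    refine ENNReal.toReal_mono (hlt j).ne (le_trans (le_of_eq ?_) (hwb _ hu.enorm j x))
    simp [lconv, enorm_mul]
  have key := hasSum_integral_of_summable_integral_norm hint hsum
  have e : ∀ y, ∑' j, conv (fatBlock ψ t j) (dyadic ψ j) (x - y) * u y =
      heatKernelC t (x - y) * u y := fun y =>
    ((hψ.hasSum_heatKernelC ht (x - y)).mul_right (u y)).tsum_eq
  simp_rw [e] at key
  simp_rw [← conv_conv (hψ.isAdmissible_fatBlock ht _) (isAdmissible_dyadic ψ _) hu hu3]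
  exact key

theorem exists_sum_dyadic_le {σ : ℝ} (h0 : 0 < σ) (h1 : σ < 1) :
    ∃ S : ℝ, 0 ≤ S ∧ ∀ (a : ℝ), 0 < a → ∀ s : Finset ℤ,
      ∑ j ∈ s, min 1 ((2 : ℝ) ^ j * a)⁻¹ * ((2 : ℝ) ^ j * a) ^ σ ≤ S := by
  -- A majorant of the summand on the octave `[2^n, 2^{n+1}]`: the decreasing factor is taken at the
  -- left end, the increasing one at the right. It decays for `n → ∞` because `σ < 1` and for `n →
  -- -∞` because `σ > 0`. Scaling by `a` only shifts the index.
  set h : ℤ → ℝ := fun n => min 1 ((2 : ℝ) ^ n)⁻¹ * ((2 : ℝ) ^ (n + 1)) ^ σ with hh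
  have hn : ∀ n, 0 ≤ h n := fun n =>
    mul_nonneg (le_min zero_le_one (by positivity)) (by positivity)
  have hsum : Summable h := by
    apply Summable.of_nat_of_neg
    · have hr : (2 : ℝ) ^ σ / 2 < 1 := by
        rw [div_lt_one two_pos]
        simpa using Real.rpow_lt_rpow_of_exponent_lt one_lt_two h1
      refine Summable.of_nonneg_of_le (fun n => hn n) (fun n => ?_)
        ((summable_geometric_of_lt_one (by positivity) hr).mul_left ((2 : ℝ) ^ σ))
      calc h n ≤ ((2 : ℝ) ^ (n : ℤ))⁻¹ * ((2 : ℝ) ^ ((n : ℤ) + 1)) ^ σ := by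
            simp only [hh]; gcongr; exact min_le_right _ _
        _ = _ := by
            rw [zpow_add₀ two_ne_zero, zpow_natCast, zpow_one,
              Real.mul_rpow (by positivity) zero_le_two, pow_rpow_comm' zero_le_two, div_pow]
            ring
    · have hr : ((2 : ℝ) ^ σ)⁻¹ < 1 := inv_lt_one_of_one_lt₀ (Real.one_lt_rpow one_lt_two h0)
      refine Summable.of_nonneg_of_le (fun n => hn _) (fun n => ?_)
        ((summable_geometric_of_lt_one (by positivity) hr).mul_left ((2 : ℝ) ^ σ))
      calc h (-n) ≤ 1 * ((2 : ℝ) ^ (-(n : ℤ) + 1)) ^ σ := by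
            simp only [hh]; gcongr; exact min_le_left _ _
        _ = _ := by
            rw [zpow_add₀ two_ne_zero, zpow_neg, zpow_natCast, zpow_one,
              Real.mul_rpow (by positivity) zero_le_two, ← inv_pow, pow_rpow_comm' (by norm_num),
              Real.inv_rpow zero_le_two]
            ring
  refine ⟨∑' n, h n, tsum_nonneg hn, fun a ha s => ?_⟩
  obtain ⟨m, hm1, hm2⟩ := exists_mem_Ico_zpow ha one_lt_two
  have hterm : ∀ j : ℤ, min 1 ((2 : ℝ) ^ j * a)⁻¹ * ((2 : ℝ) ^ j * a) ^ σ ≤ h (j + m) := by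
    intro j
    have e1 : (2 : ℝ) ^ (j + m) ≤ 2 ^ j * a := by
      rw [zpow_add₀ two_ne_zero]; gcongr
    have e2 : (2 : ℝ) ^ j * a ≤ 2 ^ (j + m + 1) := by
      rw [add_assoc, zpow_add₀ two_ne_zero]; gcongr
    simp only [hh]
    gcongr
  have hshift : Summable fun j => h (j + m) := (Equiv.addRight m).summable_iff.2 hsum
  calc _ ≤ ∑ j ∈ s, h (j + m) := Finset.sum_le_sum fun j _ => hterm j
    _ ≤ ∑' j, h (j + m) := hshift.sum_le_tsum s fun j _ => hn _
    _ = _ := (Equiv.addRight m).tsum_eq h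

theorem eLpNorm_block_le {σ : ℝ} {p : ℝ≥0∞} {f : E3 → ℝ} {η : ℝ}
    (h : besovNorm ψ (-σ) p f ≤ ENNReal.ofReal η) (j : ℤ) :
    eLpNorm (block ψ j f) p volume ≤ ENNReal.ofReal (((2 : ℝ) ^ j) ^ σ * η) := by
  have h1 := (le_iSup (fun j : ℤ => ENNReal.ofReal ((2 : ℝ) ^ ((j : ℝ) * -σ)) *
    eLpNorm (block ψ j f) p volume) j).trans h
  have hpos : (0 : ℝ) < (2 : ℝ) ^ ((j : ℝ) * -σ) := by positivity
  have e : ((2 : ℝ) ^ j) ^ σ * (2 : ℝ) ^ ((j : ℝ) * -σ) = 1 := by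
    rw [← Real.rpow_intCast, ← Real.rpow_mul zero_le_two, ← Real.rpow_add two_pos]
    simp
  calc eLpNorm (block ψ j f) p volume
      = ENNReal.ofReal (((2 : ℝ) ^ j) ^ σ) * (ENNReal.ofReal ((2 : ℝ) ^ ((j : ℝ) * -σ)) *
          eLpNorm (block ψ j f) p volume) := by
        rw [← mul_assoc, ← ENNReal.ofReal_mul (by positivity), e, ENNReal.ofReal_one, one_mul]
    _ ≤ ENNReal.ofReal (((2 : ℝ) ^ j) ^ σ) * ENNReal.ofReal η := by gcongr
    _ = _ := by rw [← ENNReal.ofReal_mul (by positivity)]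

/-- The heat semigroup characterises the homogeneous Besov norm of negative regularity: the bound of
the heat flow by the Besov norm. -/
theorem IsLittlewoodPaley.exists_eLpNorm_heat_le (hψ : IsLittlewoodPaley ψ) {σ : ℝ} (h0 : 0 < σ)
    (h1 : σ < 1) {p : ℝ≥0∞} (hp : 1 ≤ p) (hp' : p ≠ ∞) :
    ∃ C : ℝ, 0 < C ∧ ∀ (u₀ : L3) (η : ℝ), 0 ≤ η → besovNorm ψ (-σ) p u₀ ≤ ENNReal.ofReal η →
      ∀ t : ℝ, 0 < t → eLpNorm (heat t u₀) p volume ≤ ENNReal.ofReal (C * η * t ^ (-(σ / 2))) := by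
  obtain ⟨A, hA0, hA⟩ := hψ.exists_lintegral_enorm_fatBlock_le
  obtain ⟨S, hS0, hS⟩ := exists_sum_dyadic_le h0 h1
  -- The added `1` keeps the constant positive, as it is later divided by.
  refine ⟨A * S + 1, by positivity, fun u₀ η hη hbesov t ht => ?_⟩
  have hst : 0 < √t := Real.sqrt_pos.2 ht
  set u : E3 → ℂ := fun y => ((u₀ y : ℝ) : ℂ) with hu
  have hum : StronglyMeasurable u :=
    Complex.continuous_ofReal.comp_stronglyMeasurable (Lp.stronglyMeasurable u₀)
  have hu3 : MemLp u 3 volume := (Lp.memLp u₀).ofReal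
  have hheat : ∀ x, conv (heatKernelC t) u x = ((heat t u₀ x : ℝ) : ℂ) := by
    intro x
    simp only [conv, heat, hu, heatKernelC, ← Complex.ofReal_mul]
    exact integral_ofReal
  have hnorm : eLpNorm (heat t u₀) p volume = eLpNorm (conv (heatKernelC t) u) p volume :=
    eLpNorm_congr_norm_ae (ae_of_all _ fun x => by rw [hheat, Complex.norm_real])
  have hbm : ∀ j, StronglyMeasurable (conv (dyadic ψ j) u) := fun j =>
    stronglyMeasurable_conv (measurable_dyadic ψ j) hum
  have hTm : ∀ j, StronglyMeasurable (conv (fatBlock ψ t j) (conv (dyadic ψ j) u)) := fun j =>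
    stronglyMeasurable_conv (continuous_fatBlock ht j).measurable (hbm j)
  have hmin : ∀ j : ℤ, 0 ≤ min 1 ((2 : ℝ) ^ j * √t)⁻¹ := fun j => le_min zero_le_one (by positivity)
  have hT : ∀ j, eLpNorm (conv (fatBlock ψ t j) (conv (dyadic ψ j) u)) p volume ≤
      ENNReal.ofReal (A * η * t ^ (-(σ / 2)) *
        (min 1 ((2 : ℝ) ^ j * √t)⁻¹ * ((2 : ℝ) ^ j * √t) ^ σ)) := by
    intro j
    refine ((hψ.isAdmissible_fatBlock ht j).eLpNorm_conv_le_L1 (hbm j) hp hp').trans ?_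
    refine (mul_le_mul' (hA t ht j) (eLpNorm_block_le hbesov j)).trans_eq ?_
    rw [← ENNReal.ofReal_mul (mul_nonneg hA0 (hmin j)), Real.mul_rpow (by positivity) hst.le,
      Real.sqrt_eq_rpow, ← Real.rpow_mul ht.le]
    congr 1
    have : t ^ (-(σ / 2)) * t ^ (1 / 2 * σ) = 1 := by
      rw [← Real.rpow_add ht, show -(σ / 2) + 1 / 2 * σ = 0 by ring, Real.rpow_zero]
    calc _ = A * η * (min 1 ((2 : ℝ) ^ j * t ^ (1 / 2 : ℝ))⁻¹ * ((2 : ℝ) ^ j) ^ σ) *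
          (t ^ (-(σ / 2)) * t ^ (1 / 2 * σ)) := by rw [this]; ring
      _ = _ := by ring
  have hpart : ∀ s : Finset ℤ,
      eLpNorm (fun x => ∑ j ∈ s, conv (fatBlock ψ t j) (conv (dyadic ψ j) u) x) p volume ≤
        ENNReal.ofReal ((A * S + 1) * η * t ^ (-(σ / 2))) := by
    intro s
    have e : (fun x => ∑ j ∈ s, conv (fatBlock ψ t j) (conv (dyadic ψ j) u) x) =
        ∑ j ∈ s, conv (fatBlock ψ t j) (conv (dyadic ψ j) u) := by
      ext x; rw [Finset.sum_apply]
    rw [e]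
    refine (eLpNorm_sum_le (fun j _ => (hTm j).aestronglyMeasurable) hp).trans ?_
    refine (Finset.sum_le_sum fun j _ => hT j).trans ?_
    rw [← ENNReal.ofReal_sum_of_nonneg fun j _ => by
      have := hmin j; positivity, ← Finset.mul_sum]
    apply ENNReal.ofReal_le_ofReal
    have hk : 0 ≤ η * t ^ (-(σ / 2)) := by positivity
    calc _ ≤ A * η * t ^ (-(σ / 2)) * S := by gcongr; exact hS _ hst s
      _ ≤ _ := by linarith
  rw [hnorm]
  have hseq : Tendsto (fun n : ℕ => Finset.Icc (-(n : ℤ)) n) atTop atTop := by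
    refine tendsto_atTop_finset_of_monotone (fun a b hab => Finset.Icc_subset_Icc (by omega)
      (by omega)) fun x => ⟨x.natAbs, ?_⟩
    rw [Finset.mem_Icc]
    omega
  -- Fatou: uniform `L^p` bounds on the partial sums and pointwise convergence suffice; convergence
  -- in `L^p` is not needed.
  refine (Lp.eLpNorm_lim_le_liminf_eLpNorm
    (f := fun (n : ℕ) x => ∑ j ∈ Finset.Icc (-(n : ℤ)) n,
      conv (fatBlock ψ t j) (conv (dyadic ψ j) u) x) (fun n => ?_) _
    (ae_of_all _ fun x => (hψ.hasSum_conv ht hum hu3 x).comp hseq)).trans ?_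
  · exact (Finset.stronglyMeasurable_fun_sum _ fun j _ => hTm j).aestronglyMeasurable
  · refine liminf_le_of_le (by isBoundedDefault) fun b hb => ?_
    obtain ⟨n, hn⟩ := hb.exists
    exact hn.trans (hpart _)

end

/-! ### Bochner integrals in different Lebesgue spaces -/

theorem exists_setIntegralCLM {q : ℝ≥0∞} [hq : Fact (1 ≤ q)] {s : Set E3} (hs : MeasurableSet s)
    (hμs : volume s ≠ ∞) :
    ∃ φ : Lp ℝ q (volume : Measure E3) →L[ℝ] ℝ, ∀ f, φ f = ∫ x in s, f x := by
  have hconj : q.conjExponent.HolderConjugate q := (ENNReal.HolderConjugate.conjExponent hq.out).symm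
  have : Fact (1 ≤ q.conjExponent) := ⟨ENNReal.HolderConjugate.one_le _ q⟩
  refine ⟨(ContinuousLinearMap.mul ℝ ℝ).lpPairing volume q.conjExponent q
    (indicatorConstLp q.conjExponent hs hμs 1), fun f => ?_⟩
  rw [ContinuousLinearMap.lpPairing_eq_integral, ← integral_indicator hs]
  apply integral_congr_ae
  filter_upwards [indicatorConstLp_coeFn (p := q.conjExponent) (hs := hs) (hμs := hμs)
    (c := (1 : ℝ))] with x hx
  rw [hx]
  by_cases h : x ∈ s <;> simp [h]

/-- Integration over a set of finite measure is a continuous functional on every `L^q`, hence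
commutes with both Bochner integrals, and these functionals determine a function almost everywhere.
-/
theorem integral_Lp_ae_eq {q r : ℝ≥0∞} [hq : Fact (1 ≤ q)] [hr : Fact (1 ≤ r)] {μ : Measure ℝ}
    {F : ℝ → Lp ℝ q (volume : Measure E3)} {H : ℝ → Lp ℝ r (volume : Measure E3)}
    (hF : Integrable F μ) (hH : Integrable H μ) (h : ∀ᵐ θ ∂μ, F θ =ᵐ[volume] H θ) :
    (∫ θ, F θ ∂μ : Lp ℝ q (volume : Measure E3)) =ᵐ[volume]
      (∫ θ, H θ ∂μ : Lp ℝ r (volume : Measure E3)) := by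
  refine ae_eq_of_forall_setIntegral_eq_of_sigmaFinite
    (fun s _ hμs => integrableOn_Lp_of_measure_ne_top _ hq.out hμs.ne)
    (fun s _ hμs => integrableOn_Lp_of_measure_ne_top _ hr.out hμs.ne) fun s hs hμs => ?_
  obtain ⟨φ, hφ⟩ := exists_setIntegralCLM (q := q) hs hμs.ne
  obtain ⟨χ, hχ⟩ := exists_setIntegralCLM (q := r) hs hμs.ne
  rw [← hφ, ← hχ, ← φ.integral_comp_comm hF, ← χ.integral_comp_comm hH]
  apply integral_congr_ae
  filter_upwards [h] with θ hθ
  rw [hφ, hχ]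
  exact integral_congr_ae (hθ.filter_mono (ae_mono Measure.restrict_le_self))

/-! ### The linear flow in logarithmic time -/

section LinearPath

variable {q r : ℝ≥0∞} [hq : Fact (1 ≤ q)] [hr : Fact (1 ≤ r)]

/-- The weighted heat flow of a function in `L^q`, as a path in `L^r` vanishing at infinity. -/
noncomputable def linearPath (hq1 : 1 < q) (hqr : q < r) (hr' : r ≠ ∞)
    (f : Lp ℝ q (volume : Measure E3)) : C₀(ℝ, Lp ℝ r (volume : Measure E3)) where
  toFun s := Real.exp s ^ smoothingExp q r • heatOp q r (Real.exp s) f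
  continuous_toFun := by
    have h1 : Continuous fun s => heatOp q r (Real.exp s) :=
      (continuousOn_heatOp hqr.le hr').comp_continuous Real.continuous_exp
        fun s => mem_Ioi.2 (Real.exp_pos s)
    have h2 : Continuous fun s => Real.exp s ^ smoothingExp q r :=
      Real.continuous_exp.rpow_const fun s => Or.inl (Real.exp_pos s).ne'
    exact h2.smul (h1.clm_apply continuous_const)
  zero_at_infty' := by
    have e : ∀ s, ‖Real.exp s ^ smoothingExp q r • heatOp q r (Real.exp s) f‖ =
        Real.exp s ^ smoothingExp q r * ‖heatOp q r (Real.exp s) f‖ := fun s => by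
      rw [norm_smul, Real.norm_of_nonneg (by positivity)]
    rw [tendsto_zero_iff_norm_tendsto_zero]
    simp_rw [e]
    rw [cocompact_eq_atBot_atTop, tendsto_sup]
    exact ⟨(tendsto_heatOp_nhdsGT_zero hqr hr' f).comp Real.tendsto_exp_atBot_nhdsGT,
      (tendsto_heatOp_atTop hq1 hqr hr' f).comp Real.tendsto_exp_atTop⟩

theorem linearPath_apply (hq1 : 1 < q) (hqr : q < r) (hr' : r ≠ ∞)
    (f : Lp ℝ q (volume : Measure E3)) (s : ℝ) : linearPath hq1 hqr hr' f s =
      Real.exp s ^ smoothingExp q r • heatOp q r (Real.exp s) f := rfl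

theorem norm_linearPath_le (hq1 : 1 < q) (hqr : q < r) (hr' : r ≠ ∞)
    (f : Lp ℝ q (volume : Measure E3)) {ε : ℝ} (hε : 0 ≤ ε)
    (h : ∀ t : ℝ, 0 < t → eLpNorm (heat t f) r volume ≤
      ENNReal.ofReal (ε * t ^ (-smoothingExp q r))) : ‖linearPath hq1 hqr hr' f‖ ≤ ε := by
  refine ZeroAtInftyContinuousMap.norm_le_of_forall hε fun s => ?_
  have hs := Real.exp_pos s
  rw [linearPath_apply, norm_smul, Real.norm_of_nonneg (by positivity), Lp.norm_def,
    eLpNorm_congr_ae (coeFn_heatOp hqr.le hr' hs f)]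
  have h1 := ENNReal.toReal_mono ENNReal.ofReal_ne_top (h _ hs)
  rw [ENNReal.toReal_ofReal (by positivity)] at h1
  calc _ ≤ Real.exp s ^ smoothingExp q r * (ε * Real.exp s ^ (-smoothingExp q r)) := by gcongr
    _ = ε * (Real.exp s ^ smoothingExp q r * Real.exp s ^ (-smoothingExp q r)) := by ring
    _ = ε := by rw [← Real.rpow_add hs]; simp

end LinearPath

theorem duhamelPath_apply {q r : ℝ≥0∞} [Fact (1 ≤ q)] [Fact (1 ≤ r)] (hqr : q ≤ r) (hr' : r ≠ ∞)
    {β : ℝ} (hβ : β < 1) (hα : smoothingExp q r < 1)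
    (g : C₀(ℝ, Lp ℝ q (volume : Measure E3))) (s : ℝ) :
    duhamelPath hqr hr' hβ hα g s = ∫ θ in Ioo (0 : ℝ) 1, duhamelIntegrand r β g s θ := rfl

/-- The Duhamel integrals in `L^r` and `L^{r'}` agree up to the change of weight. -/
theorem duhamelPath_ae_eq {q r r' : ℝ≥0∞} [hq : Fact (1 ≤ q)] [hr : Fact (1 ≤ r)]
    [hr' : Fact (1 ≤ r')] (hqr : q ≤ r) (hrt : r ≠ ∞) (hqr' : q ≤ r') (hrt' : r' ≠ ∞) {β : ℝ}
    (hβ : β < 1) (hα : smoothingExp q r < 1) (hα' : smoothingExp q r' < 1)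
    (g : C₀(ℝ, Lp ℝ q (volume : Measure E3))) (s : ℝ) :
    duhamelPath hqr hrt hβ hα g s =ᵐ[volume]
      fun x => Real.exp s ^ smoothingExp r' r * duhamelPath hqr' hrt' hβ hα' g s x := by
  have hs := Real.exp_pos s
  have hi := integrableOn_duhamelIntegrand hqr' hrt' hβ hα' g.continuous g.norm_apply_le s
  have hi2 : Integrable (fun θ => Real.exp s ^ smoothingExp r' r • duhamelIntegrand r' β g s θ)
      (volume.restrict (Ioo (0 : ℝ) 1)) := Integrable.smul (Real.exp s ^ smoothingExp r' r) hi
  have h : (∫ θ in Ioo (0 : ℝ) 1, duhamelIntegrand r β g s θ : Lp ℝ r (volume : Measure E3))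
      =ᵐ[volume] (∫ θ in Ioo (0 : ℝ) 1, Real.exp s ^ smoothingExp r' r •
        duhamelIntegrand r' β g s θ : Lp ℝ r' (volume : Measure E3)) := by
    refine integral_Lp_ae_eq
      (integrableOn_duhamelIntegrand hqr hrt hβ hα g.continuous g.norm_apply_le s)
      hi2 ?_
    filter_upwards [ae_restrict_mem measurableSet_Ioo] with θ hθ
    have ht : 0 < Real.exp s * (1 - θ) := mul_pos hs (by linarith [hθ.2])
    unfold duhamelIntegrand
    rw [smul_smul]
    filter_upwards [Lp.coeFn_smul (Real.exp s ^ smoothingExp q r * θ ^ (-β))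
        (heatOp q r (Real.exp s * (1 - θ)) (g (s + Real.log θ))),
      Lp.coeFn_smul (Real.exp s ^ smoothingExp r' r *
        (Real.exp s ^ smoothingExp q r' * θ ^ (-β)))
        (heatOp q r' (Real.exp s * (1 - θ)) (g (s + Real.log θ))),
      coeFn_heatOp hqr hrt ht (g (s + Real.log θ)),
      coeFn_heatOp hqr' hrt' ht (g (s + Real.log θ))] with x h1 h2 h3 h4
    rw [h1, h2, Pi.smul_apply, Pi.smul_apply, h3, h4, ← mul_assoc, ← Real.rpow_add hs]
    -- The smoothing exponents are additive along `q`, `r'`, `r`, whatever the order of `r` and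
    -- `r'`.
    congr 3
    unfold smoothingExp
    ring
  rw [duhamelPath_apply, duhamelPath_apply]
  refine h.trans ?_
  rw [integral_smul]
  exact Lp.coeFn_smul _ _

/-! ### From logarithmic time to the mild formulation -/

theorem integrableOn_Ioo_comp_mul_left {F : ℝ → L3} {t : ℝ} (ht : 0 < t) :
    IntegrableOn (fun θ => F (t * θ)) (Ioo 0 1) ↔ IntegrableOn F (Ioo 0 t) := by
  rw [← intervalIntegrable_iff_integrableOn_Ioo_of_le zero_le_one,
    ← intervalIntegrable_iff_integrableOn_Ioo_of_le ht.le]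
  have := IntervalIntegrable.comp_mul_left_iff (f := F) (a := 0) (b := t) ht.ne'
  rwa [zero_div, div_self ht.ne'] at this

theorem smul_integral_Ioo_comp_mul_left (F : ℝ → L3) {t : ℝ} (ht : 0 < t) :
    t • ∫ θ in Ioo (0 : ℝ) 1, F (t * θ) = ∫ τ in Ioo (0 : ℝ) t, F τ := by
  have := intervalIntegral.smul_integral_comp_mul_left (a := 0) (b := 1) F t
  rwa [mul_zero, mul_one, intervalIntegral.integral_of_le zero_le_one,
    intervalIntegral.integral_of_le ht.le, integral_Ioc_eq_integral_Ioo,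
    integral_Ioc_eq_integral_Ioo] at this

/-- When the two exponents add up to `1`, the prefactor is `t · t^{-β}`: exactly the Jacobian of `τ
= tθ` and the missing part of `τ^{-β}`, so no weight remains in `L³`. -/
theorem duhamelIntegrand_eq_smul {q : ℝ≥0∞} [Fact (1 ≤ q)] {β : ℝ}
    (hβ : smoothingExp q 3 + β = 1) (g : ℝ → Lp ℝ q (volume : Measure E3)) {t θ : ℝ} (ht : 0 < t)
    (hθ : θ ∈ Ioo (0 : ℝ) 1) :
    duhamelIntegrand 3 β g (Real.log t) θ =
      t • ((t * θ) ^ (-β) • heatOp q 3 (t - t * θ) (g (Real.log (t * θ)))) := by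
  unfold duhamelIntegrand
  rw [Real.exp_log ht, smul_smul, Real.log_mul ht.ne' hθ.1.ne', mul_sub, mul_one,
    Real.mul_rpow ht.le hθ.1.le]
  congr 1
  rw [show smoothingExp q 3 = 1 + -β by linarith, Real.rpow_add ht, Real.rpow_one]
  ring

theorem isGlobalMildSolution_of_duhamelPath {q : ℝ≥0∞} [hq : Fact (1 ≤ q)] (hq3 : q ≤ 3) {β : ℝ}
    (hβ : β < 1) (hα : smoothingExp q 3 < 1) (hsum : smoothingExp q 3 + β = 1)
    (g : C₀(ℝ, Lp ℝ q (volume : Measure E3))) {u₀ : L3} {u : ℝ → L3} (hu0 : u 0 = u₀)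
    (hu : ∀ t, 0 < t → u t = heatOp 3 3 t u₀ +
      duhamelPath hq3 ENNReal.ofNat_ne_top hβ hα g (Real.log t))
    (hg : ∀ t, 0 < t → (fun x => u t x ^ 3) =ᵐ[volume] fun x => t ^ (-β) * g (Real.log t) x) :
    IsGlobalMildSolution u₀ u := by
  refine ⟨hu0, fun t ht => ?_⟩
  set F : ℝ → L3 := fun τ => τ ^ (-β) • heatOp q 3 (t - τ) (g (Real.log τ)) with hF
  have hcongr : ∀ θ ∈ Ioo (0 : ℝ) 1, duhamelIntegrand 3 β g (Real.log t) θ = t • F (t * θ) :=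
    fun θ hθ => duhamelIntegrand_eq_smul hsum g ht hθ
  have hint : IntegrableOn (fun θ => F (t * θ)) (Ioo 0 1) := by
    have h1 := (integrableOn_duhamelIntegrand hq3 ENNReal.ofNat_ne_top hβ hα g.continuous
      g.norm_apply_le (Real.log t)).congr_fun hcongr measurableSet_Ioo
    refine (Integrable.smul t⁻¹ h1).congr (ae_of_all _ fun θ => ?_)
    simp only [Pi.smul_apply, smul_smul, inv_mul_cancel₀ ht.ne', one_smul]
  refine ⟨F, fun τ hτ => ?_, (integrableOn_Ioo_comp_mul_left ht).1 hint, ?_⟩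
  · have hpos : 0 < t - τ := sub_pos.2 hτ.2
    rw [heat_congr_ae (hg τ hτ.1)]
    filter_upwards [Lp.coeFn_smul (τ ^ (-β)) (heatOp q 3 (t - τ) (g (Real.log τ))),
      coeFn_heatOp hq3 ENNReal.ofNat_ne_top hpos (g (Real.log τ))] with x h1 h2
    rw [hF]
    simp only
    rw [h1, Pi.smul_apply, h2, smul_eq_mul]
    simp only [heat, ← integral_const_mul]
    congr 1
    ext y
    ring
  · have e : duhamelPath hq3 ENNReal.ofNat_ne_top hβ hα g (Real.log t) =
        ∫ τ in Ioo (0 : ℝ) t, F τ := by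
      rw [duhamelPath_apply, setIntegral_congr_fun measurableSet_Ioo hcongr, integral_smul,
        smul_integral_Ioo_comp_mul_left F ht]
    rw [hu t ht, e]
    filter_upwards [Lp.coeFn_add (heatOp 3 3 t u₀) (∫ τ in Ioo (0 : ℝ) t, F τ),
      coeFn_heatOp le_rfl ENNReal.ofNat_ne_top ht u₀] with x h1 h2
    rw [h1, Pi.add_apply, h2]

/-- At `t = 0` the heat flow is strongly continuous, and the Duhamel part vanishes because `log t →
-∞`. -/
theorem continuousOn_heatOp_add {u₀ : L3} {u : ℝ → L3} {w : C₀(ℝ, L3)} (hu0 : u 0 = u₀)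
    (hu : ∀ t, 0 < t → u t = heatOp 3 3 t u₀ + w (Real.log t)) : ContinuousOn u (Ici 0) := by
  intro t (ht : 0 ≤ t)
  rcases ht.eq_or_lt with rfl | ht
  · rw [← continuousWithinAt_Ioi_iff_Ici, ContinuousWithinAt, hu0]
    have h1 := tendsto_heatOp_self (q := 3) ENNReal.ofNat_ne_top u₀
    have h2 : Tendsto (fun t => w (Real.log t)) (𝓝[>] 0) (𝓝 0) :=
      (w.zero_at_infty'.mono_left (by rw [cocompact_eq_atBot_atTop]; exact le_sup_left)).comp
        Real.tendsto_log_nhdsGT_zero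
    have h3 := h1.add h2
    rw [add_zero] at h3
    refine h3.congr' ?_
    filter_upwards [self_mem_nhdsWithin] with t ht
    exact (hu t ht).symm
  · apply ContinuousAt.continuousWithinAt
    have h1 : ContinuousAt (fun t => heatOp 3 3 t u₀) t :=
      ((continuousOn_heatOp (q := 3) (r := 3) le_rfl ENNReal.ofNat_ne_top).continuousAt
        (Ioi_mem_nhds ht)).clm_apply continuousAt_const
    have h2 : ContinuousAt (fun t => w (Real.log t)) t :=
      w.continuous.continuousAt.comp (Real.continuousAt_log ht.ne')
    refine (h1.add h2).congr ?_
    filter_upwards [Ioi_mem_nhds ht] with t ht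
    exact (hu t ht).symm

theorem norm_le_of_heatOp_add {u₀ : L3} {u : ℝ → L3} {w : C₀(ℝ, L3)} (hu0 : u 0 = u₀)
    (hu : ∀ t, 0 < t → u t = heatOp 3 3 t u₀ + w (Real.log t)) (t : ℝ) (ht : 0 ≤ t) :
    ‖u t‖ ≤ ‖u₀‖ + ‖w‖ := by
  rcases ht.eq_or_lt with rfl | ht
  · rw [hu0]; linarith [norm_nonneg w]
  · rw [hu t ht]
    refine (norm_add_le _ _).trans (add_le_add ?_ (w.norm_apply_le _))
    have := norm_heatOp_apply_le (q := 3) (r := 3) ht u₀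
    simpa [smoothingExp] using this

/-- A path in `L³` that is, after weighting, a path in `L^p` vanishing at infinity in logarithmic
time belongs to `Y`. -/
theorem memY_of_path {p σ : ℝ} (hσ : 0 < σ) [Fact (1 ≤ ENNReal.ofReal p)] {u : ℝ → L3}
    (hc : ContinuousOn u (Ici 0)) (hb : ∃ C : ℝ, ∀ t : ℝ, 0 ≤ t → ‖u t‖ ≤ C)
    (v : C₀(ℝ, Lp ℝ (ENNReal.ofReal p) (volume : Measure E3)))
    (hv : ∀ t, 0 < t → (fun x => t ^ (σ / 2) * u t x) =ᵐ[volume] v (Real.log t)) :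
    MemY p σ u := by
  -- The value `0` at time zero is the right one, since `0 ^ (σ / 2) = 0` for `σ > 0`.
  set V : ℝ → Lp ℝ (ENNReal.ofReal p) (volume : Measure E3) :=
    fun t => if t ≤ 0 then 0 else v (Real.log t) with hV
  have hVpos : ∀ t, 0 < t → V t = v (Real.log t) := fun t ht => if_neg (not_le.2 ht)
  have hV0 : V 0 = 0 := if_pos le_rfl
  have hVu : ∀ t, 0 ≤ t → (fun x => t ^ (σ / 2) * u t x) =ᵐ[volume] V t := by
    intro t ht
    rcases ht.eq_or_lt with rfl | ht
    · rw [hV0]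
      filter_upwards [Lp.coeFn_zero ℝ (ENNReal.ofReal p) (volume : Measure E3)] with x hx
      rw [hx, Real.zero_rpow (by positivity), zero_mul, Pi.zero_apply]
    · rw [hVpos t ht]; exact hv t ht
  have hcoc : Tendsto v (atBot ⊔ atTop) (𝓝 0) := by
    rw [← cocompact_eq_atBot_atTop]; exact v.zero_at_infty'
  have hlim0 : Tendsto V (𝓝[>] 0) (𝓝 0) := by
    refine ((hcoc.mono_left le_sup_left).comp Real.tendsto_log_nhdsGT_zero).congr' ?_
    filter_upwards [self_mem_nhdsWithin] with t ht
    exact (hVpos t ht).symm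
  have hlimT : Tendsto V atTop (𝓝 0) := by
    refine ((hcoc.mono_left le_sup_right).comp Real.tendsto_log_atTop).congr' ?_
    filter_upwards [eventually_gt_atTop 0] with t ht
    exact (hVpos t ht).symm
  have hVc : ∀ t, 0 ≤ t → Tendsto V (𝓝[Ici 0] t) (𝓝 (V t)) := by
    intro t ht
    rcases ht.eq_or_lt with rfl | ht
    · rw [← hV0] at hlim0
      exact continuousWithinAt_Ioi_iff_Ici.1 hlim0
    · refine Tendsto.mono_left ?_ nhdsWithin_le_nhds
      have h2 : ContinuousAt (fun t => v (Real.log t)) t :=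
        v.continuous.continuousAt.comp (Real.continuousAt_log ht.ne')
      refine (h2.congr ?_ : ContinuousAt V t)
      filter_upwards [Ioi_mem_nhds ht] with t ht
      exact (hVpos t ht).symm
  have hnorm : ∀ t, 0 < t → ENNReal.ofReal (t ^ (σ / 2)) *
      eLpNorm (u t) (ENNReal.ofReal p) volume = ‖V t‖ₑ := by
    intro t ht
    rw [Lp.enorm_def, ← eLpNorm_congr_ae (hVu t ht.le)]
    have : (fun x => t ^ (σ / 2) * u t x) = t ^ (σ / 2) • (u t : E3 → ℝ) := rfl
    rw [this, eLpNorm_const_smul, Real.enorm_of_nonneg (by positivity)]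
  refine ⟨hc, hb, fun t ht => (Lp.memLp (V t)).ae_eq (hVu t ht).symm, fun t₀ ht₀ => ?_, ?_, ?_, ?_⟩
  · have h := (Lp.tendsto_Lp_iff_tendsto_eLpNorm' V (V t₀)).1 (hVc t₀ ht₀)
    refine h.congr' ?_
    filter_upwards [self_mem_nhdsWithin] with t ht
    apply eLpNorm_congr_ae
    filter_upwards [hVu t ht, hVu t₀ ht₀] with x h1 h2
    rw [Pi.sub_apply, h1, h2]
  · have := hlim0.enorm
    rw [enorm_zero] at this
    refine this.congr' ?_
    filter_upwards [self_mem_nhdsWithin] with t ht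
    exact (hnorm t ht).symm
  · have := hlimT.enorm
    rw [enorm_zero] at this
    refine this.congr' ?_
    filter_upwards [eventually_gt_atTop 0] with t ht
    exact (hnorm t ht).symm
  · refine lt_of_le_of_lt (iSup₂_le fun t ht => ?_) (ENNReal.ofReal_lt_top (r := ‖v‖))
    rw [hnorm t ht, hVpos t ht, ← ofReal_norm]
    exact ENNReal.ofReal_le_ofReal (v.norm_apply_le _)

theorem coeFn_cubePath {p p₂ q : ℝ≥0∞} [Fact (1 ≤ p)] [Fact (1 ≤ p₂)] [Fact (1 ≤ q)]
    [ENNReal.HolderTriple p p p₂] [ENNReal.HolderTriple p p₂ q]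
    (v : C₀(ℝ, Lp ℝ p (volume : Measure E3))) (s : ℝ) :
    cubePath p₂ q v s =ᵐ[volume] fun x => v s x ^ 3 :=
  coeFn_cube (v s)

theorem ae_eq_smul_add {p q : ℝ≥0∞} {a : ℝ} {f b : Lp ℝ q (volume : Measure E3)}
    {g c : Lp ℝ p (volume : Measure E3)} {h : E3 → ℝ} (hf : f =ᵐ[volume] h)
    (hg : g =ᵐ[volume] h) (hc : c =ᵐ[volume] fun x => a * b x) :
    (fun x => a * (f + b : Lp ℝ q (volume : Measure E3)) x) =ᵐ[volume]
      (a • g + c : Lp ℝ p (volume : Measure E3)) := by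
  filter_upwards [hf, hg, hc, Lp.coeFn_add f b, Lp.coeFn_add (a • g) c, Lp.coeFn_smul a g]
    with x h1 h2 h3 h4 h5 h6
  rw [h4, h5, Pi.add_apply, Pi.add_apply, h6, Pi.smul_apply, h1, h2, h3, smul_eq_mul, mul_add]

theorem smoothingExp_ofReal {a b : ℝ} (ha : 0 ≤ a) (hb : 0 ≤ b) :
    smoothingExp (ENNReal.ofReal a) (ENNReal.ofReal b) = 3 / 2 * (1 / a - 1 / b) := by
  rw [smoothingExp, ENNReal.toReal_ofReal ha, ENNReal.toReal_ofReal hb]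

end CubicHeat

/-! ### Choice of exponents, fixed point in `L^p`, and recovery of the solution in `L³`. -/

open CubicHeat in
theorem theorem3p2 (p σ : ℝ) (hp3 : 3 < p) (hp9 : p < 9) (hσ : σ = 1 - 3 / p)
    (ψ : SchwartzMap CubicHeat.E3 ℂ) (hψ : CubicHeat.IsLittlewoodPaley ψ) :
    ∃ η : ℝ, 0 < η ∧ ∀ u₀ : CubicHeat.L3,
      CubicHeat.besovNorm ψ (-σ) (ENNReal.ofReal p) u₀ ≤ ENNReal.ofReal η →
      ∃ u : ℝ → CubicHeat.L3,
        CubicHeat.IsGlobalMildSolution u₀ u ∧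
        ContinuousOn u (Set.Ici 0) ∧
        CubicHeat.MemY p σ u := by
  have hp0 : 0 < p := by linarith
  have hinv : 1 / p < 1 / 3 := one_div_lt_one_div_of_lt (by norm_num) hp3
  have hinv9 : 1 / 9 < 1 / p := one_div_lt_one_div_of_lt hp0 hp9
  have hσ' : σ = 1 - 3 * (1 / p) := by rw [hσ]; ring
  have hσ0 : 0 < σ := by linarith
  -- This is `p < 9`; it makes the singularity `τ^{-3σ/2}` of the cube integrable at zero.
  have hσ1 : σ < 2 / 3 := by linarith
  set P : ℝ≥0∞ := ENNReal.ofReal p with hP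
  set P₂ : ℝ≥0∞ := ENNReal.ofReal (p / 2) with hP₂
  set Q : ℝ≥0∞ := ENNReal.ofReal (p / 3) with hQ
  have hle : ∀ a : ℝ, 1 ≤ a → (1 : ℝ≥0∞) ≤ ENNReal.ofReal a := fun a ha => by
    rw [← ENNReal.ofReal_one]; exact ENNReal.ofReal_le_ofReal ha
  have : Fact (1 ≤ P) := ⟨hle p (by linarith)⟩
  have : Fact (1 ≤ P₂) := ⟨hle _ (by linarith)⟩
  have : Fact (1 ≤ Q) := ⟨hle _ (by linarith)⟩
  have : ENNReal.HolderTriple P P P₂ :=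
    Real.HolderTriple.ennrealOfReal ⟨by field_simp; norm_num, hp0, hp0⟩
  have : ENNReal.HolderTriple P P₂ Q :=
    Real.HolderTriple.ennrealOfReal ⟨by field_simp; norm_num, hp0, by positivity⟩
  have h3 : (3 : ℝ≥0∞) = ENNReal.ofReal 3 := by simp
  have hPt : P ≠ ∞ := ENNReal.ofReal_ne_top
  have h3t : (3 : ℝ≥0∞) ≠ ∞ := ENNReal.ofNat_ne_top
  have hQP : Q ≤ P := ENNReal.ofReal_le_ofReal (by linarith)
  have hQ3 : Q ≤ 3 := by rw [h3]; exact ENNReal.ofReal_le_ofReal (by linarith)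
  have h3P : 3 < P := by rw [h3]; exact (ENNReal.ofReal_lt_ofReal_iff hp0).2 hp3
  have h13 : (1 : ℝ≥0∞) < 3 := by norm_num
  have hdiv : 1 / (p / 3) = 3 * (1 / p) := by field_simp
  have eQP : smoothingExp Q P = 1 - σ := by
    rw [smoothingExp_ofReal (by positivity) hp0.le, hdiv]; linarith
  have eQ3 : smoothingExp Q 3 = 1 - 3 / 2 * σ := by
    rw [h3, smoothingExp_ofReal (by positivity) (by norm_num), hdiv]; linarith
  have e3P : smoothingExp 3 P = σ / 2 := by
    rw [h3, smoothingExp_ofReal (by norm_num) hp0.le]; linarith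
  have hβ : 3 / 2 * σ < 1 := by linarith
  have hαP : smoothingExp Q P < 1 := by linarith
  have hα3 : smoothingExp Q 3 < 1 := by linarith
  set K : ℝ := ∫ θ in Ioo (0 : ℝ) 1, θ ^ (-(3 / 2 * σ)) * (1 - θ) ^ (-smoothingExp Q P) with hK
  have hK0 : 0 ≤ K := by
    refine setIntegral_nonneg measurableSet_Ioo fun θ hθ => ?_
    have h0 := hθ.1
    have h1 : 0 < 1 - θ := by linarith [hθ.2]
    positivity
  obtain ⟨ε, hε, hfix⟩ := exists_fixedPoint_of_locally_lipschitz
    (N := fun v : C₀(ℝ, Lp ℝ P (volume : Measure E3)) =>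
      duhamelPath hQP hPt hβ hαP (cubePath P₂ Q v)) (K := K * 3 + 1) (by positivity)
    (by
      ext1 s
      rw [duhamelPath_apply]
      have h0 : ∀ θ, duhamelIntegrand P (3 / 2 * σ)
          (cubePath P₂ Q (0 : C₀(ℝ, Lp ℝ P (volume : Measure E3)))) s θ = 0 := fun θ => by
        have : cubePath P₂ Q (0 : C₀(ℝ, Lp ℝ P (volume : Measure E3))) (s + Real.log θ) = 0 :=
          cube_zero
        rw [duhamelIntegrand, this, map_zero, smul_zero]
      simp_rw [h0, integral_zero]
      rfl)
    (fun M v w hv hw => by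
      refine (norm_duhamelPath_sub_le hQP hPt hβ hαP _ _).trans ?_
      calc K * ‖cubePath P₂ Q v - cubePath P₂ Q w‖ ≤ K * (3 * M ^ 2 * ‖v - w‖) := by
            gcongr; exact norm_cubePath_sub_le hv hw
        _ = K * 3 * (M ^ 2 * ‖v - w‖) := by ring
        _ ≤ (K * 3 + 1) * (M ^ 2 * ‖v - w‖) := by gcongr; linarith
        _ = _ := by ring)
  obtain ⟨C, hC, hheat⟩ := hψ.exists_eLpNorm_heat_le hσ0 (by linarith : σ < 1)
    (Fact.out : 1 ≤ P) hPt
  refine ⟨ε / C, by positivity, fun u₀ hu₀ => ?_⟩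
  have hlin : ‖linearPath h13 h3P hPt u₀‖ ≤ ε := by
    refine norm_linearPath_le h13 h3P hPt u₀ hε.le fun t ht => ?_
    have := hheat u₀ (ε / C) (by positivity) hu₀ t ht
    rwa [mul_div_cancel₀ _ hC.ne', ← e3P] at this
  obtain ⟨v, hv⟩ := hfix _ hlin
  set g := cubePath P₂ Q v with hg
  -- The source `g` is already known from the fixed point, so the integral in `L³` is an explicit
  -- formula and no second contraction is needed.
  set w := duhamelPath hQ3 h3t hβ hα3 g with hw
  set u : ℝ → L3 := fun t => if t ≤ 0 then u₀ else heatOp 3 3 t u₀ + w (Real.log t) with hu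
  have hu0 : u 0 = u₀ := if_pos le_rfl
  have hut : ∀ t, 0 < t → u t = heatOp 3 3 t u₀ + w (Real.log t) := fun t ht =>
    if_neg (not_le.2 ht)
  have huv : ∀ t, 0 < t → (fun x => t ^ (σ / 2) * u t x) =ᵐ[volume] v (Real.log t) := by
    intro t ht
    have hvt : v (Real.log t) = t ^ (σ / 2) • heatOp 3 P t u₀ +
        duhamelPath hQP hPt hβ hαP g (Real.log t) := by
      conv_lhs => rw [hv]
      rw [ZeroAtInftyContinuousMap.add_apply, linearPath_apply, Real.exp_log ht, e3P]
    have hd := duhamelPath_ae_eq hQP hPt hQ3 h3t hβ hαP hα3 g (Real.log t)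
    rw [Real.exp_log ht, e3P] at hd
    rw [hvt, hut t ht]
    exact ae_eq_smul_add (coeFn_heatOp le_rfl h3t ht u₀) (coeFn_heatOp h3P.le hPt ht u₀) hd
  have hcube : ∀ t, 0 < t →
      (fun x => u t x ^ 3) =ᵐ[volume] fun x => t ^ (-(3 / 2 * σ)) * g (Real.log t) x := by
    intro t ht
    filter_upwards [huv t ht, coeFn_cubePath (p₂ := P₂) (q := Q) v (Real.log t)] with x h1 h2
    -- The exponent `3σ/2` is three times the weight `σ/2` of `v`, so the cube of `u` is `t^{-3σ/2}`
    -- times the cube of `v`.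
    have h3 : t ^ (-(3 / 2 * σ)) * (t ^ (σ / 2)) ^ 3 = 1 := by
      rw [← Real.rpow_natCast, ← Real.rpow_mul ht.le, ← Real.rpow_add ht]
      push_cast
      rw [show -(3 / 2 * σ) + σ / 2 * 3 = 0 by ring, Real.rpow_zero]
    rw [h2, ← h1, mul_pow, ← mul_assoc, h3, one_mul]
  have hcont : ContinuousOn u (Ici 0) := continuousOn_heatOp_add hu0 hut
  exact ⟨u, isGlobalMildSolution_of_duhamelPath hQ3 hβ hα3 (by rw [eQ3]; ring) g hu0 hut hcube,
    hcont, memY_of_path hσ0 hcont ⟨_, norm_le_of_heatOp_add hu0 hut⟩ v huv⟩
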